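/- Let $N\ge 1$ and let $\mathcal D$ be a distribution of tangent hyperplanes on $\mathbb R^N$ with an adapted global frame $X_i=\sum_j A_i^j(x)\,\partial/\partial x^j$, $1\le i\le N$: the $A_i^j$ are $C^\infty$, all their derivatives (including those of order $0$) are bounded on $\mathbb R^N$, $\inf_x|\det(A_i^j(x))|>0$, and $X_1,\dots,X_{N-1}$ span $\mathcal D_x$ at every $x$. Let $(B_j^k)$ be the inverse matrix, $\sum_j A_i^jB_j^k=\delta_i^k$, put $(M_x\xi)_i=\sum_j A_i^j(x)\xi_j$ and $\rho_x(\xi)=\bigl(\sum_{i<N}|(M_x\xi)_i|^2\bigr)^{1/2}$. On functions of $(x,y,\xi)\in(\mathbb R^N)^3$ put $$D_\xi=\sum_j B_j^N(x)\frac{\partial}{\partial \xi_j},\qquad D_i=\frac{\partial}{\partial y^i}+\frac{\partial}{\partial x^i}+\sum_{k,p,l}\frac{\partial B_k^p}{\partial x^i}(x)\,A_p^l(x)\,\xi_l\,\frac{\partial}{\partial\xi_k},$$ and $D^I=D_{i_1}\cdots D_{i_r}$ for $I=(i_1,\dots,i_r)$; on functions of $(x,\xi)$ use the same operators without the term $\partial/\partial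 y^i$. Let $m,n\in\mathbb R$. **Symbols.** $a\in S^{m,n}$ means that $a\in C^\infty(\mathbb R^N\times\mathbb R^N;\mathbb C)$ and that for all multiindices $\alpha$, all $\beta\in\mathbb N$ and all $I$ there is $C$ such that, for all $x,\xi$, $$|\partial_\xi^\alpha D_\xi^\beta D^I a(x,\xi)|\le C(1+|\xi|)^{m-\beta}(1+\rho_x(\xi)+|\xi|^{1/2})^{n-|\alpha|}.$$ Put $T_af(x)=\int a(x,\xi)\widehat f(\xi)e^{2\pi i x\cdot\xi}\,d\xi$ for $f\in\mathcal S(\mathbb R^N)$, where $\widehat f(\xi)=\int f(y)e^{-2\pi i y\cdot\xi}\,dy$. **Compound symbols.** A function $\rho_{x,y}(\xi)\ge 0$ is *compatible* with $\rho_x(\xi)$ if there is $C$ such that $|\rho_{x,y}(\xi)-\rho_x(\xi)|\le C|x-y||\xi|$ for all $x,y,\xi$. $PCS^{m,n}$ is the set of finite sums of functions $c_i\in C^\infty((\mathbb R^N)^3;\mathbb C)$ such that for each $i$ there are real numbers $n_1+\dots+n_k=n$ and compatible functions $\rho^{(1)},\dots,\rho^{(k)}$ with the property that for all multiindices $\alpha,\gamma,\delta$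 there is $C$ such that, for all $x,y,\xi$, $$|\partial_\xi^\alpha\partial_y^\gamma\partial_x^\delta c_i(x,y,\xi)|\le C(1+|\xi|)^{m+\frac{|\gamma|+|\delta|-|\alpha|}{2}}\prod_{j=1}^k(1+\rho^{(j)}_{x,y}(\xi)+|\xi|^{1/2})^{n_j}.$$ $c\in CS^{m,n}$ means that $c\in C^\infty((\mathbb R^N)^3;\mathbb C)$ and that for all multiindices $\alpha$, all $\beta\in\mathbb N$ and all $I$ there is a finite expansion over multiindices $\sigma$ $$\partial_\xi^\alpha D_\xi^\beta D^I c(x,y,\xi)=\sum_\sigma (x-y)^\sigma c_\sigma^{\alpha,\beta,I}(x,y,\xi),\qquad c_\sigma^{\alpha,\beta,I}\in PCS^{m-\beta+\frac{|\sigma|}{2},\,n-|\alpha|}.$$ For $f\in\mathcal S(\mathbb R^N)$, $T_cf(x)$ is the oscillatory integral $$T_cf(x)=\lim_{\varepsilon\to0^+}\int\!\!\int\chi(\varepsilon y,\varepsilon\xi)\,c(x,y,\xi)f(y)e^{2\pi i(x-y)\cdot\xi}\,d\xi\,dy,$$ where $\chi\in C_c^\infty(\mathbb R^N\times\mathbb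 R^N;\mathbb C)$ with $\chi(0,0)=1$. **Theorem.** If $c\in CS^{m,n}$, then there is a symbol $a\in S^{m,n}$ such that for all $f\in\mathcal S(\mathbb R^N)$ and all $x\in\mathbb R^N$ the limit defining $T_cf(x)$ exists for every such $\chi$, does not depend on $\chi$, and $T_cf(x)=T_af(x)$. -/

import Mathlib

open scoped FourierTransform SchwartzMap ContDiff InnerProductSpace

noncomputable section

namespace MixedSymbols

/-- Euclidean space `ℝ^N`, where `N = d + 1 ≥ 1`. The last coordinate (the
`N`-th one) has index `Fin.last d`; the first `N - 1` coordinates are `i.castSucc`, `i : Fin d`. -/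
abbrev RN (d : ℕ) : Type := EuclideanSpace ℝ (Fin (d + 1))

variable {d : ℕ}

/-! ### Partial derivatives -/

/-- The partial derivative `∂_i g` of a function on `ℝ^N`. -/
def pd {F : Type*} [NormedAddCommGroup F] [NormedSpace ℝ F]
    (i : Fin (d + 1)) (g : RN d → F) : RN d → F :=
  fun x => fderiv ℝ g x (EuclideanSpace.single i 1)

/-- The iterated partial derivative `∂_{i_1} ⋯ ∂_{i_k} g` for `α = [i_1, …, i_k]`. A multiindex
`α` is recorded as a list of coordinate directions, and `|α|` is the length of the list. -/
def ipd {F : Type*} [NormedAddCommGroup F] [NormedSpace ℝ F]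
    (α : List (Fin (d + 1))) (g : RN d → F) : RN d → F :=
  α.foldr pd g

/-! ### The distribution and its frame -/

/-- A global frame `X_1, …, X_N` adapted to a distribution `𝒟` of tangent hyperplanes of `ℝ^N`:
`X_i = ∑_j A_i^j(x) ∂/∂x^j` with smooth coefficients all of whose derivatives are bounded, with
`|det A|` bounded away from zero, and with `X_1, …, X_{N-1}` spanning `𝒟` at every point. -/
structure AdaptedFrame (𝒟 : RN d → Submodule ℝ (RN d)) where
  /-- `A x i j` is the coefficient `A_i^j(x)`. -/
  A : RN d → Matrix (Fin (d + 1)) (Fin (d + 1)) ℝ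
  smooth : ∀ i j, ContDiff ℝ ∞ (fun x => A x i j)
  bounded : ∀ (I : List (Fin (d + 1))) (i j : Fin (d + 1)),
    ∃ C : ℝ, ∀ x, |ipd I (fun x => A x i j) x| ≤ C
  nondegenerate : ∃ c : ℝ, 0 < c ∧ ∀ x, c ≤ |(A x).det|
  spans : ∀ x, 𝒟 x = Submodule.span ℝ
    (Set.range fun i : Fin d => (WithLp.toLp 2 (A x i.castSucc) : RN d))

variable {𝒟 : RN d → Submodule ℝ (RN d)}

namespace AdaptedFrame

/-- The inverse matrix: `X.B x j k` is `B_j^k(x)`, where `∑_j A_i^j B_j^k = δ_i^k`. -/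
def B (X : AdaptedFrame 𝒟) (x : RN d) : Matrix (Fin (d + 1)) (Fin (d + 1)) ℝ := (X.A x)⁻¹

/-- The defining relation of the inverse matrix. -/
theorem A_mul_B (X : AdaptedFrame 𝒟) (x : RN d) : X.A x * X.B x = 1 := by
  obtain ⟨c, hc, h⟩ := X.nondegenerate
  exact Matrix.mul_nonsing_inv _ (isUnit_iff_ne_zero.mpr (abs_pos.mp (hc.trans_le (h x))))

/-- The components of `M_x ξ`, namely `(M_x ξ)_i = ∑_j A_i^j(x) ξ_j`. -/
def M (X : AdaptedFrame 𝒟) (x ξ : RN d) (i : Fin (d + 1)) : ℝ := ∑ j, X.A x i j * ξ j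

/-- The variable seminorm `ρ_x(ξ)`: the Euclidean length of the first `N - 1` components of
`M_x ξ`. -/
def rho (X : AdaptedFrame 𝒟) (x ξ : RN d) : ℝ :=
  Real.sqrt (∑ i : Fin d, |X.M x ξ i.castSucc| ^ 2)

/-- The vector field `∑_j B_j^N(x) ∂/∂ξ_j` in the `ξ` variable, for a fixed `x`. -/
def vert (X : AdaptedFrame 𝒟) (x : RN d) (g : RN d → ℂ) (ξ : RN d) : ℂ :=
  ∑ j, (X.B x j (Fin.last d) : ℂ) * pd j g ξ

/-- The vector field `∑_{k,p,l} (∂B_k^p/∂x^i)(x) A_p^l(x) ξ_l ∂/∂ξ_k` in the `ξ` variable, for a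
fixed `x`. -/
def shear (X : AdaptedFrame 𝒟) (i : Fin (d + 1)) (x : RN d) (g : RN d → ℂ) (ξ : RN d) : ℂ :=
  ∑ k, ∑ p, ∑ l, ((pd i (fun z => X.B z k p) x * X.A x p l * ξ l : ℝ) : ℂ) * pd k g ξ

end AdaptedFrame

/-! ### Symbols `a(x, ξ)` -/

/-- `∂_ξ^α` on functions of `(x, ξ)`. -/
def symDerivXi (α : List (Fin (d + 1))) (a : RN d → RN d → ℂ) : RN d → RN d → ℂ :=
  fun x ξ => ipd α (a x) ξ

/-- `D_ξ` on functions of `(x, ξ)`. -/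
def symDxi (X : AdaptedFrame 𝒟) (a : RN d → RN d → ℂ) : RN d → RN d → ℂ :=
  fun x ξ => X.vert x (a x) ξ

/-- `D_i = ∂/∂x^i + ∑ (∂B_k^p/∂x^i) A_p^l ξ_l ∂/∂ξ_k` on functions of `(x, ξ)`. -/
def symD (X : AdaptedFrame 𝒟) (i : Fin (d + 1)) (a : RN d → RN d → ℂ) : RN d → RN d → ℂ :=
  fun x ξ => pd i (fun z => a z ξ) x + X.shear i x (a x) ξ

/-- The class `S^{m,n}` of symbols of mixed homogeneity. -/
def IsSymbol (X : AdaptedFrame 𝒟) (m n : ℝ) (a : RN d → RN d → ℂ) : Prop :=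
  ContDiff ℝ ∞ (fun p : RN d × RN d => a p.1 p.2) ∧
  ∀ (α : List (Fin (d + 1))) (β : ℕ) (I : List (Fin (d + 1))), ∃ C : ℝ, ∀ x ξ : RN d,
    ‖symDerivXi α ((symDxi X)^[β] (I.foldr (symD X) a)) x ξ‖ ≤
      C * (1 + ‖ξ‖) ^ (m - β) *
        (1 + X.rho x ξ + ‖ξ‖ ^ (1 / 2 : ℝ)) ^ (n - α.length)

/-- The operator `T_a f(x) = ∫ a(x, ξ) f̂(ξ) e^{2πi x·ξ} dξ`. -/
def symbolOp (a : RN d → RN d → ℂ) (f : 𝓢(RN d, ℂ)) (x : RN d) : ℂ :=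
  ∫ ξ : RN d, a x ξ * 𝓕 (f : RN d → ℂ) ξ *
    Complex.exp (2 * Real.pi * Complex.I * (⟪x, ξ⟫_ℝ : ℝ))

/-! ### Compound symbols `c(x, y, ξ)` -/

/-- `∂_x^δ` on functions of `(x, y, ξ)`. -/
def cmpDerivX (δ : List (Fin (d + 1))) (c : RN d → RN d → RN d → ℂ) : RN d → RN d → RN d → ℂ :=
  fun x y ξ => ipd δ (fun z => c z y ξ) x

/-- `∂_y^γ` on functions of `(x, y, ξ)`. -/
def cmpDerivY (γ : List (Fin (d + 1))) (c : RN d → RN d → RN d → ℂ) : RN d → RN d → RN d → ℂ :=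
  fun x y ξ => ipd γ (fun z => c x z ξ) y

/-- `∂_ξ^α` on functions of `(x, y, ξ)`. -/
def cmpDerivXi (α : List (Fin (d + 1))) (c : RN d → RN d → RN d → ℂ) : RN d → RN d → RN d → ℂ :=
  fun x y ξ => ipd α (c x y) ξ

/-- `D_ξ` on functions of `(x, y, ξ)`; it does not differentiate in `y`. -/
def cmpDxi (X : AdaptedFrame 𝒟) (c : RN d → RN d → RN d → ℂ) : RN d → RN d → RN d → ℂ :=
  fun x y ξ => X.vert x (c x y) ξ

/-- `D_i = ∂/∂y^i + ∂/∂x^i + ∑ (∂B_k^p/∂x^i)(x) A_p^l(x) ξ_l ∂/∂ξ_k` on functions of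
`(x, y, ξ)`. -/
def cmpD (X : AdaptedFrame 𝒟) (i : Fin (d + 1)) (c : RN d → RN d → RN d → ℂ) :
    RN d → RN d → RN d → ℂ :=
  fun x y ξ => pd i (fun z => c x z ξ) y + pd i (fun z => c z y ξ) x + X.shear i x (c x y) ξ

/-- Joint smoothness of a function of `(x, y, ξ)`. -/
def Smooth₃ (c : RN d → RN d → RN d → ℂ) : Prop :=
  ContDiff ℝ ∞ (fun p : RN d × RN d × RN d => c p.1 p.2.1 p.2.2)

/-- A nonnegative function `ρ_{x,y}(ξ)` is compatible with `ρ_x(ξ)` if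
`|ρ_{x,y}(ξ) - ρ_x(ξ)| ≤ C |x - y| |ξ|`. -/
def IsCompatible (X : AdaptedFrame 𝒟) (r : RN d → RN d → RN d → ℝ) : Prop :=
  (∀ x y ξ, 0 ≤ r x y ξ) ∧
  ∃ C : ℝ, ∀ x y ξ, |r x y ξ - X.rho x ξ| ≤ C * ‖x - y‖ * ‖ξ‖

/-- The estimate satisfied by one summand `c_i` of a preliminary compound symbol. -/
def IsPCSTerm (X : AdaptedFrame 𝒟) (m n : ℝ) (c : RN d → RN d → RN d → ℂ) : Prop :=
  Smooth₃ c ∧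
  ∃ (k : ℕ) (ν : Fin k → ℝ) (r : Fin k → RN d → RN d → RN d → ℝ),
    ∑ j, ν j = n ∧ (∀ j, IsCompatible X (r j)) ∧
    ∀ α γ δ : List (Fin (d + 1)), ∃ C : ℝ, ∀ x y ξ : RN d,
      ‖cmpDerivXi α (cmpDerivY γ (cmpDerivX δ c)) x y ξ‖ ≤
        C * (1 + ‖ξ‖) ^ (m + ((γ.length : ℝ) + δ.length - α.length) / 2) *
          ∏ j, (1 + r j x y ξ + ‖ξ‖ ^ (1 / 2 : ℝ)) ^ ν j

/-- The class `PCS^{m,n}` of preliminary compound symbols: finite sums of functions satisfying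
the estimates above. -/
def IsPCS (X : AdaptedFrame 𝒟) (m n : ℝ) (c : RN d → RN d → RN d → ℂ) : Prop :=
  ∃ (s : ℕ) (t : Fin s → RN d → RN d → RN d → ℂ),
    (∀ i, IsPCSTerm X m n (t i)) ∧ ∀ x y ξ, c x y ξ = ∑ i, t i x y ξ

/-- The class `CS^{m,n}` of compound symbols: every `∂_ξ^α D_ξ^β D^I c` is a finite sum
`∑_σ (x - y)^σ c_σ` with `c_σ ∈ PCS^{m - |β| + |σ|/2, n - |α|}`. -/
def IsCompoundSymbol (X : AdaptedFrame 𝒟) (m n : ℝ) (c : RN d → RN d → RN d → ℂ) : Prop :=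
  Smooth₃ c ∧
  ∀ (α : List (Fin (d + 1))) (β : ℕ) (I : List (Fin (d + 1))),
    ∃ (S : Finset (Fin (d + 1) → ℕ)) (e : (Fin (d + 1) → ℕ) → RN d → RN d → RN d → ℂ),
      (∀ σ ∈ S, IsPCS X (m - β + (∑ i, (σ i : ℝ)) / 2) (n - α.length) (e σ)) ∧
      ∀ x y ξ, cmpDerivXi α ((cmpDxi X)^[β] (I.foldr (cmpD X) c)) x y ξ =
        ∑ σ ∈ S, ((∏ i, (x i - y i) ^ σ i : ℝ) : ℂ) * e σ x y ξ

/-- The integral `∫∫ c(x, y, ξ) f(y) e^{2πi (x-y)·ξ} dξ dy`; it is used as it stands only for `c`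
compactly supported in `(y, ξ)`. -/
def compoundIntegral (c : RN d → RN d → RN d → ℂ) (f : 𝓢(RN d, ℂ)) (x : RN d) : ℂ :=
  ∫ y : RN d, ∫ ξ : RN d, c x y ξ * f y *
    Complex.exp (2 * Real.pi * Complex.I * (⟪x - y, ξ⟫_ℝ : ℝ))

/-- The truncation `χ(εy, εξ) c(x, y, ξ)` of `c`. -/
def truncate (χ : RN d × RN d → ℂ) (ε : ℝ) (c : RN d → RN d → RN d → ℂ) :
    RN d → RN d → RN d → ℂ :=
  fun x y ξ => χ (ε • y, ε • ξ) * c x y ξ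

/-- `HasCompoundValue c f x z` says that the oscillatory integral `T_c f(x)` exists and equals
`z`: for every smooth compactly supported cut-off `χ(y, ξ)` with `χ(0, 0) = 1`, the integrals for
the compactly supported truncations `χ(εy, εξ) c(x, y, ξ)` converge to `z` as `ε → 0⁺`. -/
def HasCompoundValue (c : RN d → RN d → RN d → ℂ) (f : 𝓢(RN d, ℂ)) (x : RN d) (z : ℂ) : Prop :=
  ∀ χ : RN d × RN d → ℂ, ContDiff ℝ ∞ χ → HasCompactSupport χ → χ 0 = 1 →
    Filter.Tendsto (fun ε : ℝ => compoundIntegral (truncate χ ε c) f x)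
      (nhdsWithin 0 (Set.Ioi 0)) (nhds z)

end MixedSymbols

end

/-! Inserting $f(y)=\int\widehat f(\xi)e^{2\pi i y\cdot\xi}d\xi$ into $T_cf$ and exchanging
integrals gives $T_cf=T_af$ with $a(x,\xi)=\iint c(x,y,\eta)e^{2\pi
i(x-y)\cdot(\eta-\xi)}\,dy\,d\eta$. The task is to make sense of this oscillatory integral and to
prove the estimates of $S^{m,n}$ for it.

Size. Compound symbols lie in a larger class of amplitudes (`Ampl`): derivatives in $x,y$ cost
$\langle\eta\rangle^{1/2}$, those in $\eta$ gain it, and the weight may contain any power of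
$1+\langle\eta\rangle|x-y|^2$. That power absorbs both the passage from a compatible $\rho_{x,y}$ to
$\rho_x$ and the factors $(x-y)^\sigma$, each $x_j-y_j$ being worth $\langle\eta\rangle^{-1/2}$.
Integration by parts against the phase gains powers of
$q=1+\langle\eta\rangle|x-y|^2+|\eta-\xi|^2/\langle\eta\rangle$ (`osc_ibp`, `cls_ibp`). The weights
at $(x,\eta)$ and $(x,\xi)$ agree up to powers of $q$ (`exists_ampW_le`), and a high negative power
of $q$ has an integral bounded uniformly in $x,\xi$. Hence amplitudes of order $(m,n)$ give
functions of size $\langle\xi\rangle^m\lambda^n$, where $\lambda=1+\rho_x(\xi)+|\xi|^{1/2}$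
(`osc_bound`). The same estimate applied to a difference of two cut-offs gives convergence and
independence of the cut-off, with a rate (`osc_cut_sub_bound`).

Derivatives. The phase depends only on $(x,\xi)-(y,\eta)$, so $\partial_\xi$ and $\partial_x$ of $a$
come from the amplitudes $\partial_\eta c$ and $(\partial_x+\partial_y)c$; this is why $D_i$ on
compound symbols contains $\partial_y$. Multiplication by $\xi_l$ becomes multiplication by $\eta_l$
minus $(2\pi i)^{-1}\partial_{y_l}$. So $D_ia$ comes from $D_ic$ plus a bounded combination of terms
$\partial_{y_l}\partial_{\eta_k}c$ (`symD_ampSymbol`). These have order $(m+\frac12,n-1)$, which is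
admissible since $\langle\eta\rangle^{1/2}\le\lambda$ (`Ampl.trade`).

To iterate, words in $D_i$, $\partial_\xi$, $D_\xi$ in arbitrary order are needed. $D_\xi$ commutes
with $D_i$ and with $\partial_\xi$, while $[D_i,\partial_{\xi_j}]$ is a bounded combination of the
$\partial_{\xi_k}$, so the ordered words in the definition of $CS^{m,n}$ suffice
(`stable_of_words`). -/

noncomputable section

namespace MixedSymbols

/-! ### Weighted symbol classes -/

section SymbolClass

variable {ι P Q V F : Type*} [NormedAddCommGroup V] [NormedSpace ℝ V]
  [NormedAddCommGroup F] [NormedSpace ℝ F]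

/-- All derivatives of order at most `k` of the family `u`, in the directions `D i`, are bounded by
the weight `w` times the product of the scales `s i` of these directions. -/
def SymBound (D : ι → V) (s : ι → V → ℝ) : ℕ → (P → V → ℝ) → (P → V → F) → Prop
  | 0, w, u => ∃ C : ℝ, ∀ p v, ‖u p v‖ ≤ C * w p v
  | k + 1, w, u => (∃ C : ℝ, ∀ p v, ‖u p v‖ ≤ C * w p v) ∧
      ∀ i, SymBound D s k (fun p v => w p v * s i v) (fun p v => fderiv ℝ (u p) v (D i))

/-- Smooth families all of whose derivatives are controlled by `w` in the sense of `SymBound`. -/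
structure SymClass (D : ι → V) (s : ι → V → ℝ) (w : P → V → ℝ) (u : P → V → F) : Prop where
  smooth : ∀ p, ContDiff ℝ ∞ (u p)
  bound : ∀ k, SymBound D s k w u

variable {D : ι → V} {s : ι → V → ℝ} {w w₁ w₂ : P → V → ℝ} {u : P → V → F}

theorem contDiff_fderiv_apply_const {f : V → F} (hf : ContDiff ℝ ∞ f) (v : V) :
    ContDiff ℝ ∞ (fun x => fderiv ℝ f x v) :=
  (hf.fderiv_right (m := ∞) (by simp)).clm_apply contDiff_const

/-- `SymBound` puts no sign on its constant. Replacing it by its absolute value is harmless wherever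
the weight is nonnegative. -/
theorem SymBound.zeroth {k : ℕ} (h : SymBound D s k w u) :
    ∃ C : ℝ, 0 ≤ C ∧ ∀ p v, 0 ≤ w p v → ‖u p v‖ ≤ C * w p v := by
  have : ∃ C : ℝ, ∀ p v, ‖u p v‖ ≤ C * w p v := by
    cases k with
    | zero => exact h
    | succ k => exact h.1
  obtain ⟨C, hC⟩ := this
  exact ⟨|C|, abs_nonneg C, fun p v hw =>
    (hC p v).trans (mul_le_mul_of_nonneg_right (le_abs_self C) hw)⟩

theorem SymBound.mono (hs : ∀ i v, 0 ≤ s i v) {k : ℕ} (h0 : ∀ p v, 0 ≤ w₁ p v) {K : ℝ}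
    (hle : ∀ p v, w₁ p v ≤ K * w₂ p v) (h : SymBound D s k w₁ u) : SymBound D s k w₂ u := by
  induction k generalizing w₁ w₂ u with
  | zero =>
    obtain ⟨C, hC0, hC⟩ := h.zeroth
    exact ⟨C * K, fun p v => (hC p v (h0 p v)).trans (by
      rw [mul_assoc]; exact mul_le_mul_of_nonneg_left (hle p v) hC0)⟩
  | succ k ih =>
    obtain ⟨C, hC0, hC⟩ := h.zeroth
    refine ⟨⟨C * K, fun p v => (hC p v (h0 p v)).trans (by
      rw [mul_assoc]; exact mul_le_mul_of_nonneg_left (hle p v) hC0)⟩, fun i => ?_⟩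
    refine ih (fun p v => mul_nonneg (h0 p v) (hs i v)) (fun p v => ?_) (h.2 i)
    rw [← mul_assoc]
    exact mul_le_mul_of_nonneg_right (hle p v) (hs i v)

theorem SymBound.of_succ {k : ℕ} (h : SymBound D s (k + 1) w u) : SymBound D s k w u := by
  induction k generalizing w u with
  | zero => exact h.1
  | succ k ih => exact ⟨h.1, fun i => ih (h.2 i)⟩

theorem SymBound.add {k : ℕ} {u' : P → V → F} (hu : ∀ p, ContDiff ℝ ∞ (u p))
    (hu' : ∀ p, ContDiff ℝ ∞ (u' p)) (h : SymBound D s k w u) (h' : SymBound D s k w u') :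
    SymBound D s k w (fun p v => u p v + u' p v) := by
  induction k generalizing w u u' with
  | zero =>
    obtain ⟨C, hC⟩ := h
    obtain ⟨C', hC'⟩ := h'
    exact ⟨C + C', fun p v => (norm_add_le _ _).trans (by linarith [hC p v, hC' p v])⟩
  | succ k ih =>
    obtain ⟨⟨C, hC⟩, h⟩ := h
    obtain ⟨⟨C', hC'⟩, h'⟩ := h'
    refine ⟨⟨C + C', fun p v => (norm_add_le _ _).trans (by linarith [hC p v, hC' p v])⟩,
      fun i => ?_⟩
    convert ih (fun p => contDiff_fderiv_apply_const (hu p) (D i))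
      (fun p => contDiff_fderiv_apply_const (hu' p) (D i)) (h i) (h' i) using 3 with p v
    rw [fderiv_fun_add ((hu p).differentiable (by simp) v) ((hu' p).differentiable (by simp) v)]
    rfl

/-- Both Leibniz terms carry the same weight `w₁ * w₂ * s i`, so the induction closes. -/
theorem SymBound.mul {A : Type*} [NormedCommRing A] [NormedAlgebra ℝ A] {k : ℕ}
    {f g : P → V → A} (hf : ∀ p, ContDiff ℝ ∞ (f p)) (hg : ∀ p, ContDiff ℝ ∞ (g p))
    (h : SymBound D s k w₁ f) (h' : SymBound D s k w₂ g) :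
    SymBound D s k (fun p v => w₁ p v * w₂ p v) (fun p v => f p v * g p v) := by
  have zero : ∀ {w₁ w₂ : P → V → ℝ} {f g : P → V → A}, (∃ C : ℝ, ∀ p v, ‖f p v‖ ≤ C * w₁ p v) →
      (∃ C : ℝ, ∀ p v, ‖g p v‖ ≤ C * w₂ p v) →
      ∃ C : ℝ, ∀ p v, ‖f p v * g p v‖ ≤ C * (w₁ p v * w₂ p v) := by
    rintro w₁ w₂ f g ⟨C, hC⟩ ⟨C', hC'⟩
    refine ⟨C * C', fun p v => (norm_mul_le _ _).trans ?_⟩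
    calc ‖f p v‖ * ‖g p v‖ ≤ (C * w₁ p v) * (C' * w₂ p v) :=
          mul_le_mul (hC p v) (hC' p v) (norm_nonneg _) ((norm_nonneg _).trans (hC p v))
      _ = _ := by ring
  induction k generalizing w₁ w₂ f g with
  | zero => exact zero h h'
  | succ k ih =>
    refine ⟨zero h.1 h'.1, fun i => ?_⟩
    have h1 := ih hf (fun p => contDiff_fderiv_apply_const (hg p) (D i)) h.of_succ (h'.2 i)
    have h2 := ih (fun p => contDiff_fderiv_apply_const (hf p) (D i)) hg (h.2 i) h'.of_succ
    have e1 : (fun p v => w₁ p v * (w₂ p v * s i v)) = fun p v => w₁ p v * w₂ p v * s i v := by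
      funext p v; ring
    have e2 : (fun p v => w₁ p v * s i v * w₂ p v) = fun p v => w₁ p v * w₂ p v * s i v := by
      funext p v; ring
    rw [e1] at h1
    rw [e2] at h2
    convert SymBound.add
      (fun p => (hf p).mul (contDiff_fderiv_apply_const (hg p) (D i)))
      (fun p => (contDiff_fderiv_apply_const (hf p) (D i)).mul (hg p)) h1 h2 using 3 with p v
    rw [fderiv_fun_mul ((hf p).differentiable (by simp) v) ((hg p).differentiable (by simp) v)]
    simp [mul_comm]

theorem SymBound.clm {G : Type*} [NormedAddCommGroup G] [NormedSpace ℝ G] (L : F →L[ℝ] G) {k : ℕ}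
    (hu : ∀ p, ContDiff ℝ ∞ (u p)) (h : SymBound D s k w u) :
    SymBound D s k w (fun p v => L (u p v)) := by
  have zero : ∀ {w : P → V → ℝ} {u : P → V → F}, (∃ C : ℝ, ∀ p v, ‖u p v‖ ≤ C * w p v) →
      ∃ C : ℝ, ∀ p v, ‖L (u p v)‖ ≤ C * w p v := by
    rintro w u ⟨C, hC⟩
    refine ⟨‖L‖ * C, fun p v => (L.le_opNorm _).trans ?_⟩
    rw [mul_assoc]
    exact mul_le_mul_of_nonneg_left (hC p v) (norm_nonneg _)
  induction k generalizing w u with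
  | zero => exact zero h
  | succ k ih =>
    refine ⟨zero h.1, fun i => ?_⟩
    convert ih (fun p => contDiff_fderiv_apply_const (hu p) (D i)) (h.2 i) using 3 with p v
    have := (L.hasFDerivAt.comp v ((hu p).differentiable (by simp) v).hasFDerivAt).fderiv
    simp only [Function.comp_def] at this
    rw [this]
    rfl

theorem SymBound.comp_param (φ : Q → P) {k : ℕ} (h : SymBound D s k w u) :
    SymBound D s k (fun q => w (φ q)) (fun q => u (φ q)) := by
  induction k generalizing w u with
  | zero => exact h.imp fun C hC q => hC (φ q)
  | succ k ih => exact ⟨h.1.imp fun C hC q => hC (φ q), fun i => ih (h.2 i)⟩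

theorem SymBound.zero {k : ℕ} (h0 : ∀ p v, 0 ≤ w p v) (hs : ∀ i v, 0 ≤ s i v) :
    SymBound D s k w (fun _ _ => (0 : F)) := by
  induction k generalizing w with
  | zero => exact ⟨0, by simp⟩
  | succ k ih =>
    refine ⟨⟨0, by simp⟩, fun i => ?_⟩
    simpa using ih (fun p v => mul_nonneg (h0 p v) (hs i v))

namespace SymClass

theorem mono (hs : ∀ i v, 0 ≤ s i v) (h : SymClass D s w₁ u) (h0 : ∀ p v, 0 ≤ w₁ p v) (K : ℝ)
    (hle : ∀ p v, w₁ p v ≤ K * w₂ p v) : SymClass D s w₂ u :=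
  ⟨h.smooth, fun k => (h.bound k).mono hs h0 hle⟩

theorem congr {u' : P → V → F} (h : SymClass D s w₁ u) (hw : ∀ p v, w₁ p v = w₂ p v)
    (hu : ∀ p v, u p v = u' p v) : SymClass D s w₂ u' := by
  have e1 : w₁ = w₂ := funext fun p => funext fun v => hw p v
  have e2 : u = u' := funext fun p => funext fun v => hu p v
  rwa [← e1, ← e2]

theorem add {u' : P → V → F} (h : SymClass D s w u) (h' : SymClass D s w u') :
    SymClass D s w (fun p v => u p v + u' p v) :=
  ⟨fun p => (h.smooth p).add (h'.smooth p),
    fun k => (h.bound k).add h.smooth h'.smooth (h'.bound k)⟩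

theorem mul {A : Type*} [NormedCommRing A] [NormedAlgebra ℝ A] {f g : P → V → A}
    (h : SymClass D s w₁ f) (h' : SymClass D s w₂ g) :
    SymClass D s (fun p v => w₁ p v * w₂ p v) (fun p v => f p v * g p v) :=
  ⟨fun p => (h.smooth p).mul (h'.smooth p),
    fun k => (h.bound k).mul h.smooth h'.smooth (h'.bound k)⟩

theorem clm {G : Type*} [NormedAddCommGroup G] [NormedSpace ℝ G] (L : F →L[ℝ] G)
    (h : SymClass D s w u) : SymClass D s w (fun p v => L (u p v)) :=
  ⟨fun p => L.contDiff.comp (h.smooth p), fun k => (h.bound k).clm L h.smooth⟩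

theorem neg (h : SymClass D s w u) : SymClass D s w (fun p v => -u p v) :=
  h.clm (-ContinuousLinearMap.id ℝ F)

theorem sub {u' : P → V → F} (h : SymClass D s w u) (h' : SymClass D s w u') :
    SymClass D s w (fun p v => u p v - u' p v) := by
  simpa only [sub_eq_add_neg] using h.add h'.neg

theorem ofReal {f : P → V → ℝ} (h : SymClass D s w f) :
    SymClass D s w (fun p v => (f p v : ℂ)) :=
  h.clm Complex.ofRealCLM

theorem comp_param (φ : Q → P) (h : SymClass D s w u) :
    SymClass D s (fun q => w (φ q)) (fun q => u (φ q)) :=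
  ⟨fun q => h.smooth (φ q), fun k => (h.bound k).comp_param φ⟩

theorem fderiv_apply (h : SymClass D s w u) (i : ι) :
    SymClass D s (fun p v => w p v * s i v) (fun p v => fderiv ℝ (u p) v (D i)) :=
  ⟨fun p => contDiff_fderiv_apply_const (h.smooth p) (D i), fun k => (h.bound (k + 1)).2 i⟩

/-- Membership can be checked on the values and on the first derivatives, provided these are already
known to lie in a class. -/
theorem of_fderiv (h : ∀ p, ContDiff ℝ ∞ (u p)) (hw : ∃ C : ℝ, ∀ p v, ‖u p v‖ ≤ C * w p v)
    (hd : ∀ i, SymClass D s (fun p v => w p v * s i v) (fun p v => fderiv ℝ (u p) v (D i))) :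
    SymClass D s w u :=
  ⟨h, fun k => by
    cases k with
    | zero => exact hw
    | succ k => exact ⟨hw, fun i => (hd i).bound k⟩⟩

theorem zero (hs : ∀ i v, 0 ≤ s i v) (h0 : ∀ p v, 0 ≤ w p v) :
    SymClass D s w (fun _ _ => (0 : F)) :=
  ⟨fun _ => contDiff_const, fun _ => SymBound.zero h0 hs⟩

theorem const (hs : ∀ i v, 0 ≤ s i v) (h0 : ∀ p v, 0 ≤ w p v) (a : P → F)
    (ha : ∃ C : ℝ, ∀ p v, ‖a p‖ ≤ C * w p v) : SymClass D s w (fun p _ => a p) := by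
  refine of_fderiv (fun _ => contDiff_const) ha fun i => ?_
  simpa using zero (P := P) (F := F) hs (fun p v => mul_nonneg (h0 p v) (hs i v))

theorem of_affine (hs : ∀ i v, 0 ≤ s i v) (h0 : ∀ p v, 0 ≤ w p v) (h : ∀ p, ContDiff ℝ ∞ (u p))
    (hw : ∃ C : ℝ, ∀ p v, ‖u p v‖ ≤ C * w p v) (a : ι → P → F)
    (hd : ∀ i p v, fderiv ℝ (u p) v (D i) = a i p)
    (ha : ∀ i, ∃ C : ℝ, ∀ p v, ‖a i p‖ ≤ C * (w p v * s i v)) : SymClass D s w u := by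
  refine of_fderiv h hw fun i => ?_
  simp only [hd]
  exact const hs (fun p v => mul_nonneg (h0 p v) (hs i v)) (a i) (ha i)

theorem of_clm (hs : ∀ i v, 0 ≤ s i v) (h0 : ∀ p v, 0 ≤ w p v) (L : V →L[ℝ] F) (b : P → F)
    (hw : ∃ C : ℝ, ∀ p v, ‖L v + b p‖ ≤ C * w p v)
    (hd : ∀ i, ∃ C : ℝ, ∀ p v, ‖L (D i)‖ ≤ C * (w p v * s i v)) :
    SymClass D s w (fun p v => L v + b p) :=
  of_affine hs h0 (fun _ => L.contDiff.add contDiff_const) hw (fun i _ => L (D i))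
    (fun i p v => by rw [fderiv_add_const, L.fderiv]) hd

theorem sum {κ : Type*} (hs : ∀ i v, 0 ≤ s i v) (h0 : ∀ p v, 0 ≤ w p v) (S : Finset κ)
    {f : κ → P → V → F} (h : ∀ j ∈ S, SymClass D s w (f j)) :
    SymClass D s w (fun p v => ∑ j ∈ S, f j p v) := by
  classical
  induction S using Finset.induction_on with
  | empty => simpa using zero (P := P) (F := F) hs h0
  | insert a S ha ih =>
    simp only [Finset.sum_insert ha]
    exact (h a (Finset.mem_insert_self a S)).add
      (ih fun j hj => h j (Finset.mem_insert_of_mem hj))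

/-- A positive function controlled by itself has all its real powers controlled by themselves: the
derivative $r\,q^{r-1}\partial_iq$ has weight $q^{r-1}\cdot q\,s_i=q^r s_i$. The induction must
therefore allow the exponent to drop to `r - 1`. -/
theorem rpow {q : P → V → ℝ} (hq : ∀ p v, 0 < q p v)
    (h : SymClass D s q q) (r : ℝ) :
    SymClass D s (fun p v => q p v ^ r) (fun p v => q p v ^ r) := by
  have hsm : ∀ (r : ℝ) (p : P), ContDiff ℝ ∞ (fun v => q p v ^ r) := fun r p =>
    (h.smooth p).rpow_const_of_ne fun v => (hq p v).ne'
  refine ⟨hsm r, fun k => ?_⟩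
  have zero : ∀ r : ℝ, ∃ C : ℝ, ∀ p v, ‖q p v ^ r‖ ≤ C * q p v ^ r := fun r =>
    ⟨1, fun p v => by
      rw [one_mul, Real.norm_of_nonneg (Real.rpow_nonneg (hq p v).le r)]⟩
  induction k generalizing r with
  | zero => exact zero r
  | succ k ih =>
    refine ⟨zero r, fun i => ?_⟩
    have h1 := ((ih (r - 1)).mul (hsm (r - 1))
      (fun p => contDiff_fderiv_apply_const (h.smooth p) (D i)) ((h.fderiv_apply i).bound k)).clm
        (r • ContinuousLinearMap.id ℝ ℝ)
        (fun p => (hsm (r - 1) p).mul (contDiff_fderiv_apply_const (h.smooth p) (D i)))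
    have e1 : (fun p v => q p v ^ (r - 1) * (q p v * s i v)) = fun p v => q p v ^ r * s i v := by
      funext p v
      rw [← mul_assoc, ← Real.rpow_add_one (hq p v).ne', sub_add_cancel]
    rw [e1] at h1
    convert h1 using 3 with p v
    have := (((h.smooth p).differentiable (by simp) v).hasFDerivAt.rpow_const (p := r)
      (Or.inl (hq p v).ne')).fderiv
    rw [this]
    simp [mul_assoc]

end SymClass

end SymbolClass

/-! ### The phase space `(x, y, ξ)` and its scales -/

section PhaseSpace

variable {d : ℕ}

/-- The space of triples `(x, y, ξ)`. -/
abbrev V3 (d : ℕ) : Type := RN d × RN d × RN d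

/-- The coordinate directions of `V3 d`: first those of `x`, then those of `y`, then those of
`ξ`. -/
abbrev Dir (d : ℕ) : Type := Fin (d + 1) ⊕ Fin (d + 1) ⊕ Fin (d + 1)

/-- The unit vector in a coordinate direction. -/
def dir : Dir d → V3 d
  | .inl i => (EuclideanSpace.single i 1, 0, 0)
  | .inr (.inl i) => (0, EuclideanSpace.single i 1, 0)
  | .inr (.inr i) => (0, 0, EuclideanSpace.single i 1)

/-- The Japanese bracket `(1 + |ξ|²)^{1/2}`. -/
def jap (ξ : RN d) : ℝ := (1 + ‖ξ‖ ^ 2) ^ (1 / 2 : ℝ)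

/-- The scale of a coordinate direction: a derivative in `x` or `y` costs `⟨ξ⟩^{1/2}`, and a
derivative in `ξ` gains `⟨ξ⟩^{1/2}`. -/
def scale : Dir d → V3 d → ℝ
  | .inl _, v => jap v.2.2 ^ (1 / 2 : ℝ)
  | .inr (.inl _), v => jap v.2.2 ^ (1 / 2 : ℝ)
  | .inr (.inr _), v => jap v.2.2 ^ (-1 / 2 : ℝ)

theorem jap_sq (ξ : RN d) : jap ξ ^ 2 = 1 + ‖ξ‖ ^ 2 := by
  rw [jap, ← Real.sqrt_eq_rpow, Real.sq_sqrt (by positivity)]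

theorem one_le_jap (ξ : RN d) : 1 ≤ jap ξ :=
  Real.one_le_rpow (by nlinarith [sq_nonneg ‖ξ‖]) (by norm_num)

theorem jap_pos (ξ : RN d) : 0 < jap ξ := one_pos.trans_le (one_le_jap ξ)

theorem norm_le_jap (ξ : RN d) : ‖ξ‖ ≤ jap ξ :=
  abs_le_of_sq_le_sq' (by rw [jap_sq]; linarith) (jap_pos ξ).le |>.2

theorem jap_le (ξ : RN d) : jap ξ ≤ 1 + ‖ξ‖ :=
  abs_le_of_sq_le_sq' (by rw [jap_sq]; nlinarith [norm_nonneg ξ]) (by positivity) |>.2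

theorem one_add_norm_le_jap (ξ : RN d) : 1 + ‖ξ‖ ≤ 2 * jap ξ := by
  linarith [one_le_jap ξ, norm_le_jap ξ]

theorem jap_le_add (η ξ : RN d) : jap η ≤ jap ξ + ‖η - ξ‖ := by
  refine abs_le_of_sq_le_sq' ?_ (by linarith [jap_pos ξ, norm_nonneg (η - ξ)]) |>.2
  have h1 : ‖η‖ ≤ ‖ξ‖ + ‖η - ξ‖ := by
    calc ‖η‖ = ‖ξ + (η - ξ)‖ := by congr 1; abel
      _ ≤ _ := norm_add_le _ _
  have h2 := mul_le_mul_of_nonneg_right (norm_le_jap ξ) (norm_nonneg (η - ξ))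
  have h3 := pow_le_pow_left₀ (norm_nonneg η) h1 2
  rw [jap_sq, add_sq, jap_sq]
  nlinarith

theorem sqrt_jap_sq (ξ : RN d) : jap ξ ^ (1 / 2 : ℝ) * jap ξ ^ (1 / 2 : ℝ) = jap ξ := by
  rw [← Real.rpow_add (jap_pos ξ)]; norm_num

theorem one_le_sqrt_jap (ξ : RN d) : 1 ≤ jap ξ ^ (1 / 2 : ℝ) :=
  Real.one_le_rpow (one_le_jap ξ) (by norm_num)

theorem inv_sqrt_jap_mul (ξ : RN d) : jap ξ ^ (-1 / 2 : ℝ) * jap ξ ^ (1 / 2 : ℝ) = 1 := by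
  rw [← Real.rpow_add (jap_pos ξ)]; norm_num

theorem scale_pos (i : Dir d) (v : V3 d) : 0 < scale i v := by
  rcases i with i | i | i <;> exact Real.rpow_pos_of_pos (jap_pos _) _

theorem scale_nonneg (i : Dir d) (v : V3 d) : 0 ≤ scale i v := (scale_pos i v).le

theorem scale_ge (i : Dir d) (v : V3 d) : jap v.2.2 ^ (-1 / 2 : ℝ) ≤ scale i v := by
  rcases i with i | i | i <;>
    exact Real.rpow_le_rpow_of_exponent_le (one_le_jap _) (by norm_num)

variable {P F : Type*} [NormedAddCommGroup F] [NormedSpace ℝ F]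

/-- Symbol classes on the space of triples `(x, y, ξ)`. -/
abbrev Cls (w : P → V3 d → ℝ) (u : P → V3 d → F) : Prop := SymClass dir scale w u

/-- The `j`-th coordinate of `ξ`. -/
def xiL (j : Fin (d + 1)) : V3 d →L[ℝ] ℝ :=
  (EuclideanSpace.proj j).comp
    ((ContinuousLinearMap.snd ℝ _ _).comp (ContinuousLinearMap.snd ℝ _ _))

/-- The `j`-th coordinate of `x - y`. -/
def xyL (j : Fin (d + 1)) : V3 d →L[ℝ] ℝ :=
  (EuclideanSpace.proj j).comp (ContinuousLinearMap.fst ℝ _ _ -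
    (ContinuousLinearMap.fst ℝ _ _).comp (ContinuousLinearMap.snd ℝ _ _))

@[simp] theorem xiL_apply (j : Fin (d + 1)) (v : V3 d) : xiL j v = v.2.2 j := rfl

@[simp] theorem xyL_apply (j : Fin (d + 1)) (v : V3 d) : xyL j v = v.1 j - v.2.1 j := rfl

theorem norm_single_one_apply_le (i j : Fin (d + 1)) :
    |(EuclideanSpace.single i (1 : ℝ) : RN d) j| ≤ 1 := by
  have := PiLp.norm_apply_le (EuclideanSpace.single i (1 : ℝ) : RN d) j
  simpa using this

theorem abs_apply_le_norm (x : RN d) (j : Fin (d + 1)) : |x j| ≤ ‖x‖ := PiLp.norm_apply_le x j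

theorem cls_const {w : P → V3 d → ℝ} (h : ∀ p v, 1 ≤ w p v) (a : F) :
    Cls w (fun (_ : P) (_ : V3 d) => a) :=
  SymClass.const scale_nonneg (fun p v => zero_le_one.trans (h p v)) (fun _ => a)
    ⟨‖a‖, fun p v => le_mul_of_one_le_right (norm_nonneg a) (h p v)⟩

/-- An affine function of `ξ` belongs to any class whose weight dominates both its values and
`⟨ξ⟩^{1/2}`. -/
theorem cls_xi {w : P → V3 d → ℝ} (j : Fin (d + 1)) (b : P → ℝ)
    (hw : ∃ C : ℝ, ∀ p v, |v.2.2 j + b p| ≤ C * w p v)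
    (hw' : ∀ p v, jap v.2.2 ^ (1 / 2 : ℝ) ≤ w p v) :
    Cls w (fun (p : P) (v : V3 d) => v.2.2 j + b p) := by
  have h0 : ∀ p v, 0 ≤ w p v := fun p v => zero_le_one.trans ((one_le_sqrt_jap _).trans (hw' p v))
  refine SymClass.of_clm scale_nonneg h0 (xiL j) b hw fun i => ⟨1, fun p v => ?_⟩
  rcases i with i | i | i
  · simpa [dir] using mul_nonneg (h0 p v) (scale_nonneg _ v)
  · simpa [dir] using mul_nonneg (h0 p v) (scale_nonneg _ v)
  · rw [one_mul]
    refine (norm_single_one_apply_le i j).trans ?_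
    rw [← inv_sqrt_jap_mul v.2.2, mul_comm]
    exact mul_le_mul_of_nonneg_right (hw' p v) (scale_nonneg (.inr (.inr i)) v)

/-- A coordinate of `x - y` belongs to any class whose weight dominates both its values and
`⟨ξ⟩^{-1/2}`. -/
theorem cls_xy {w : P → V3 d → ℝ} (j : Fin (d + 1))
    (hw : ∃ C : ℝ, ∀ p v, |v.1 j - v.2.1 j| ≤ C * w p v)
    (hw' : ∀ p v, jap v.2.2 ^ (-1 / 2 : ℝ) ≤ w p v) :
    Cls w (fun (_ : P) (v : V3 d) => v.1 j - v.2.1 j) := by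
  have h0 : ∀ p v, 0 ≤ w p v := fun p v =>
    (Real.rpow_nonneg (jap_pos _).le _).trans (hw' p v)
  have h := SymClass.of_clm (P := P) (D := dir) (w := w) scale_nonneg h0 (xyL j) (fun _ => 0)
    (by simpa using hw) fun i => ⟨1, fun p v => ?_⟩
  · simpa using h
  have key : ∀ i : Fin (d + 1), |(EuclideanSpace.single i (1 : ℝ) : RN d) j| ≤
      w p v * jap v.2.2 ^ (1 / 2 : ℝ) := fun i => by
    refine (norm_single_one_apply_le i j).trans ?_
    refine (inv_sqrt_jap_mul v.2.2).symm.le.trans ?_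
    exact mul_le_mul_of_nonneg_right (hw' p v) (by have := one_le_sqrt_jap v.2.2; linarith)
  rcases i with i | i | i
  · simpa [dir, scale] using key i
  · simpa [dir, scale] using key i
  · simpa [dir] using mul_nonneg (h0 p v) (scale_nonneg _ v)

/-- $\langle\xi\rangle^2=1+\sum_j\xi_j^2$ is controlled by itself, each $\xi_j$ having weight
$\langle\xi\rangle$; the square root is then an instance of `SymClass.rpow`. -/
theorem cls_jap : Cls (fun (_ : P) (v : V3 d) => jap v.2.2) (fun _ v => jap v.2.2) := by
  have h1 : ∀ j, Cls (fun (_ : P) (v : V3 d) => jap v.2.2) (fun _ v => v.2.2 j) := fun j => by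
    simpa using cls_xi (P := P) (w := fun (_ : P) (v : V3 d) => jap v.2.2) j (fun _ => 0)
      ⟨1, fun p v => by simpa using (abs_apply_le_norm v.2.2 j).trans (norm_le_jap v.2.2)⟩
      (fun p v => by
        simpa using Real.rpow_le_rpow_of_exponent_le (one_le_jap v.2.2) (by norm_num : (1/2:ℝ) ≤ 1))
  have e : ∀ v : V3 d, jap v.2.2 * jap v.2.2 = 1 + ∑ j, v.2.2 j * v.2.2 j := fun v => by
    rw [← sq, jap_sq, EuclideanSpace.real_norm_sq_eq]
    simp [sq]
  have h2 : Cls (fun (_ : P) (v : V3 d) => jap v.2.2 * jap v.2.2)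
      (fun _ v => jap v.2.2 * jap v.2.2) := by
    simp only [e]
    refine SymClass.add (cls_const (fun p v => ?_) _) (SymClass.sum scale_nonneg
      (fun p v => ?_) _ fun j _ => ?_)
    · rw [← e]; nlinarith [one_le_jap v.2.2]
    · rw [← e]; nlinarith [one_le_jap v.2.2]
    · simp only [← e]
      exact (h1 j).mul (h1 j)
  have h3 := h2.rpow (fun p v => mul_pos (jap_pos _) (jap_pos _)) (1 / 2)
  have e3 : ∀ v : V3 d, (jap v.2.2 * jap v.2.2) ^ (1 / 2 : ℝ) = jap v.2.2 := fun v => by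
    rw [Real.mul_rpow (jap_pos _).le (jap_pos _).le, sqrt_jap_sq]
  simpa only [e3] using h3

/-! ### The phase-space distance `osq` and its symbol estimates -/

/-- The weight `1 + ⟨η⟩|x - y|² + |η - ξ|²/⟨η⟩` measuring the distance of `(y, η)` to `(x, ξ)`. -/
def osq (ξ : RN d) (v : V3 d) : ℝ :=
  1 + jap v.2.2 * ‖v.1 - v.2.1‖ ^ 2 + ‖v.2.2 - ξ‖ ^ 2 / jap v.2.2

theorem one_le_osq (ξ : RN d) (v : V3 d) : 1 ≤ osq ξ v := by
  have := jap_pos v.2.2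
  have h1 : 0 ≤ jap v.2.2 * ‖v.1 - v.2.1‖ ^ 2 := by positivity
  have h2 : 0 ≤ ‖v.2.2 - ξ‖ ^ 2 / jap v.2.2 := by positivity
  rw [osq]; linarith

theorem osq_pos (ξ : RN d) (v : V3 d) : 0 < osq ξ v := one_pos.trans_le (one_le_osq ξ v)

theorem one_le_sqrt_osq (ξ : RN d) (v : V3 d) : 1 ≤ osq ξ v ^ (1 / 2 : ℝ) :=
  Real.one_le_rpow (one_le_osq ξ v) (by norm_num)

theorem sqrt_osq_sq (ξ : RN d) (v : V3 d) :
    osq ξ v ^ (1 / 2 : ℝ) * osq ξ v ^ (1 / 2 : ℝ) = osq ξ v := by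
  rw [← Real.rpow_add (osq_pos ξ v)]; norm_num

theorem norm_sub_snd_le (ξ : RN d) (v : V3 d) :
    ‖v.2.2 - ξ‖ ≤ jap v.2.2 ^ (1 / 2 : ℝ) * osq ξ v ^ (1 / 2 : ℝ) := by
  have hJ := jap_pos v.2.2
  refine abs_le_of_sq_le_sq' ?_ (mul_nonneg (Real.rpow_nonneg hJ.le _)
    (Real.rpow_nonneg (osq_pos ξ v).le _)) |>.2
  rw [mul_pow, sq (jap _ ^ _), sqrt_jap_sq, sq (osq _ _ ^ _), sqrt_osq_sq, osq, mul_add,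
    mul_div_cancel₀ _ hJ.ne']
  have h1 : 0 ≤ jap v.2.2 * ‖v.1 - v.2.1‖ ^ 2 := by positivity
  nlinarith

theorem norm_sub_fst_le (ξ : RN d) (v : V3 d) :
    ‖v.1 - v.2.1‖ ≤ jap v.2.2 ^ (-1 / 2 : ℝ) * osq ξ v ^ (1 / 2 : ℝ) := by
  have hJ := jap_pos v.2.2
  have h1 : jap v.2.2 ^ (1 / 2 : ℝ) * ‖v.1 - v.2.1‖ ≤ osq ξ v ^ (1 / 2 : ℝ) := by
    refine abs_le_of_sq_le_sq' ?_ (Real.rpow_nonneg (osq_pos ξ v).le _) |>.2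
    rw [mul_pow, sq (jap _ ^ _), sqrt_jap_sq, sq (osq _ _ ^ _), sqrt_osq_sq, osq]
    have : 0 ≤ ‖v.2.2 - ξ‖ ^ 2 / jap v.2.2 := by positivity
    linarith
  have h2 := mul_le_mul_of_nonneg_left h1 (Real.rpow_nonneg hJ.le (-1 / 2))
  rwa [← mul_assoc, inv_sqrt_jap_mul, one_mul] at h2

theorem jap_rpow_cls (r : ℝ) :
    Cls (fun (_ : P) (v : V3 d) => jap v.2.2 ^ r) (fun _ v => jap v.2.2 ^ r) :=
  cls_jap.rpow (fun _ _ => jap_pos _) r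

theorem cls_sub_xi (j : Fin (d + 1)) :
    Cls (fun (ξ : RN d) (v : V3 d) => jap v.2.2 ^ (1 / 2 : ℝ) * osq ξ v ^ (1 / 2 : ℝ))
      (fun ξ v => v.2.2 j - ξ j) := by
  simpa only [sub_eq_add_neg] using cls_xi (P := RN d)
    (w := fun (ξ : RN d) (v : V3 d) => jap v.2.2 ^ (1 / 2 : ℝ) * osq ξ v ^ (1 / 2 : ℝ)) j
    (fun ξ => -ξ j)
    ⟨1, fun ξ v => by
      rw [one_mul, ← sub_eq_add_neg]
      exact (abs_apply_le_norm (v.2.2 - ξ) j).trans (norm_sub_snd_le ξ v)⟩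
    (fun ξ v => le_mul_of_one_le_right (Real.rpow_nonneg (jap_pos _).le _) (one_le_sqrt_osq ξ v))

theorem cls_sub_xy (j : Fin (d + 1)) :
    Cls (fun (ξ : RN d) (v : V3 d) => jap v.2.2 ^ (-1 / 2 : ℝ) * osq ξ v ^ (1 / 2 : ℝ))
      (fun _ v => v.1 j - v.2.1 j) :=
  cls_xy j
    ⟨1, fun ξ v => by
      rw [one_mul]
      exact (abs_apply_le_norm (v.1 - v.2.1) j).trans (norm_sub_fst_le ξ v)⟩
    (fun ξ v => le_mul_of_one_le_right (Real.rpow_nonneg (jap_pos _).le _) (one_le_sqrt_osq ξ v))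

theorem osq_eq (ξ : RN d) (v : V3 d) : osq ξ v = 1 +
    ∑ j, jap v.2.2 ^ (1 : ℝ) * ((v.1 j - v.2.1 j) * (v.1 j - v.2.1 j)) +
    ∑ j, jap v.2.2 ^ (-1 : ℝ) * ((v.2.2 j - ξ j) * (v.2.2 j - ξ j)) := by
  rw [osq, EuclideanSpace.real_norm_sq_eq, EuclideanSpace.real_norm_sq_eq, Finset.mul_sum,
    Finset.sum_div, Real.rpow_one, Real.rpow_neg_one]
  simp [sq, div_eq_inv_mul]

/-- In each term the powers of $\langle\eta\rangle$ cancel: $(x-y)_j$ has weight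
$\langle\eta\rangle^{-1/2}q^{1/2}$ and $(\eta-\xi)_j$ has weight $\langle\eta\rangle^{1/2}q^{1/2}$.
So $q$ is controlled by itself, uniformly in $\xi$, and its negative powers may be used as
multipliers. -/
theorem cls_osq : Cls (fun (ξ : RN d) (v : V3 d) => osq ξ v) (fun ξ v => osq ξ v) := by
  have h0 : ∀ (ξ : RN d) v, 0 ≤ osq ξ v := fun ξ v => (osq_pos ξ v).le
  have h := ((cls_const (P := RN d) (w := fun ξ v => osq ξ v) one_le_osq (1 : ℝ)).add
    (SymClass.sum (w := fun ξ v => osq ξ v) scale_nonneg h0 Finset.univ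
      (f := fun j _ v => jap v.2.2 ^ (1 : ℝ) * ((v.1 j - v.2.1 j) * (v.1 j - v.2.1 j)))
      fun j _ => ?_)).add
    (SymClass.sum (w := fun ξ v => osq ξ v) scale_nonneg h0 Finset.univ
      (f := fun j ξ v => jap v.2.2 ^ (-1 : ℝ) * ((v.2.2 j - ξ j) * (v.2.2 j - ξ j)))
      fun j _ => ?_)
  · exact h.congr (fun _ _ => rfl) fun ξ v => (osq_eq ξ v).symm
  · refine ((jap_rpow_cls 1).mul ((cls_sub_xy j).mul (cls_sub_xy j))).congr (fun ξ v => ?_)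
      fun _ _ => rfl
    rw [mul_mul_mul_comm, sqrt_osq_sq, ← Real.rpow_add (jap_pos _), ← mul_assoc,
      ← Real.rpow_add (jap_pos _)]
    norm_num
  · refine ((jap_rpow_cls (-1)).mul ((cls_sub_xi j).mul (cls_sub_xi j))).congr (fun ξ v => ?_)
      fun _ _ => rfl
    rw [mul_mul_mul_comm, sqrt_osq_sq, sqrt_jap_sq, ← mul_assoc, Real.rpow_neg_one,
      inv_mul_cancel₀ (jap_pos _).ne', one_mul]

end PhaseSpace

/-! ### Oscillatory integrals of compactly supported amplitudes -/

section Oscillatory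

open MeasureTheory

variable {d : ℕ} {P : Type*}

/-- `u(x, y, ξ)` vanishes when `(y, ξ)` is outside a compact set that does not depend on `x`. -/
def CptSupp (u : V3 d → ℂ) : Prop :=
  ∃ K : Set (RN d × RN d), IsCompact K ∧ ∀ x, ∀ t ∉ K, u (x, t) = 0

theorem CptSupp.mul_left {u : V3 d → ℂ} (hu : CptSupp u) (g : V3 d → ℂ) :
    CptSupp (fun v => g v * u v) := by
  obtain ⟨K, hK, h⟩ := hu
  exact ⟨K, hK, fun x t ht => by simp [h x t ht]⟩

theorem CptSupp.mul_right {u : V3 d → ℂ} (hu : CptSupp u) (g : V3 d → ℂ) :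
    CptSupp (fun v => u v * g v) := by
  simpa only [mul_comm] using hu.mul_left g

theorem CptSupp.add {u u' : V3 d → ℂ} (hu : CptSupp u) (hu' : CptSupp u') :
    CptSupp (fun v => u v + u' v) := by
  obtain ⟨K, hK, h⟩ := hu
  obtain ⟨K', hK', h'⟩ := hu'
  refine ⟨K ∪ K', hK.union hK', fun x t ht => ?_⟩
  rw [Set.mem_union, not_or] at ht
  simp [h x t ht.1, h' x t ht.2]

theorem CptSupp.sum {κ : Type*} (S : Finset κ) {f : κ → V3 d → ℂ} (h : ∀ j, CptSupp (f j)) :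
    CptSupp (fun v => ∑ j ∈ S, f j v) := by
  classical
  induction S using Finset.induction_on with
  | empty => exact ⟨∅, isCompact_empty, by simp⟩
  | insert a S ha ih =>
    simp only [Finset.sum_insert ha]
    exact (h a).add ih

theorem CptSupp.fderiv_apply {u : V3 d → ℂ} (hu : CptSupp u) (a : V3 d) :
    CptSupp (fun v => fderiv ℝ u v a) := by
  obtain ⟨K, hK, h⟩ := hu
  refine ⟨K, hK, fun x t ht => ?_⟩
  have hev : u =ᶠ[nhds (x, t)] fun _ => 0 := by
    have : {v : V3 d | v.2 ∉ K} ∈ nhds (x, t) :=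
      (hK.isClosed.isOpen_compl.preimage continuous_snd).mem_nhds ht
    filter_upwards [this] with v hv
    exact h v.1 v.2 hv
  simp [hev.fderiv_eq]

theorem CptSupp.slice {u : V3 d → ℂ} (hu : CptSupp u) (x : RN d) :
    HasCompactSupport (fun t => u (x, t)) := by
  obtain ⟨K, hK, h⟩ := hu
  exact HasCompactSupport.intro hK (h x)

/-- Smooth amplitudes with compact support in `(y, ξ)`. -/
structure Adm (u : V3 d → ℂ) : Prop where
  smooth : ContDiff ℝ ∞ u
  cpt : CptSupp u

theorem Adm.mul_left {u g : V3 d → ℂ} (hu : Adm u) (hg : ContDiff ℝ ∞ g) :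
    Adm (fun v => g v * u v) := ⟨hg.mul hu.smooth, hu.cpt.mul_left g⟩

theorem Adm.const_mul {u : V3 d → ℂ} (hu : Adm u) (a : ℂ) : Adm (fun v => a * u v) :=
  hu.mul_left contDiff_const

theorem Adm.mul_right {u g : V3 d → ℂ} (hu : Adm u) (hg : ContDiff ℝ ∞ g) :
    Adm (fun v => u v * g v) := ⟨hu.smooth.mul hg, hu.cpt.mul_right g⟩

theorem Adm.add {u u' : V3 d → ℂ} (hu : Adm u) (hu' : Adm u') : Adm (fun v => u v + u' v) :=
  ⟨hu.smooth.add hu'.smooth, hu.cpt.add hu'.cpt⟩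

theorem Adm.sum {κ : Type*} (S : Finset κ) {f : κ → V3 d → ℂ} (h : ∀ j, Adm (f j)) :
    Adm (fun v => ∑ j ∈ S, f j v) :=
  ⟨ContDiff.sum fun j _ => (h j).smooth, CptSupp.sum S fun j => (h j).cpt⟩

theorem Adm.fderiv_apply {u : V3 d → ℂ} (hu : Adm u) (a : V3 d) :
    Adm (fun v => fderiv ℝ u v a) :=
  ⟨contDiff_fderiv_apply_const hu.smooth a, hu.cpt.fderiv_apply a⟩

/-- The phase factor `e^{2πi (x-y)·(η-ξ)}`, as a function of `t = (y, η)`. -/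
def oscPhase (x ξ : RN d) (t : RN d × RN d) : ℂ :=
  Complex.exp (2 * Real.pi * Complex.I * (⟪x - t.1, t.2 - ξ⟫_ℝ : ℝ))

/-- The integral `∫∫ u(x, y, η) e^{2πi (x-y)·(η-ξ)} dy dη`. -/
def osc (u : V3 d → ℂ) (x ξ : RN d) : ℂ :=
  ∫ t : RN d × RN d, u (x, t) * oscPhase x ξ t

theorem norm_oscPhase (x ξ : RN d) (t : RN d × RN d) : ‖oscPhase x ξ t‖ = 1 := by
  rw [oscPhase, Complex.norm_exp]
  simp

theorem contDiff_oscPhase (x ξ : RN d) : ContDiff ℝ ∞ (oscPhase x ξ) := by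
  unfold oscPhase
  refine ContDiff.cexp (contDiff_const.mul (Complex.ofRealCLM.contDiff.comp ?_))
  exact (contDiff_const.sub contDiff_fst).inner ℝ (contDiff_snd.sub contDiff_const)

theorem fderiv_oscPhase (x ξ : RN d) (t : RN d × RN d) (a b : RN d) :
    fderiv ℝ (oscPhase x ξ) t (a, b) =
      2 * Real.pi * Complex.I * ((⟪x - t.1, b⟫_ℝ - ⟪a, t.2 - ξ⟫_ℝ : ℝ) : ℂ) * oscPhase x ξ t := by
  have h1 : HasFDerivAt (fun t : RN d × RN d => x - t.1)
      (-ContinuousLinearMap.fst ℝ (RN d) (RN d)) t :=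
    (hasFDerivAt_fst (𝕜 := ℝ) (p := t)).const_sub x
  have h2 : HasFDerivAt (fun t : RN d × RN d => t.2 - ξ)
      (ContinuousLinearMap.snd ℝ (RN d) (RN d)) t := hasFDerivAt_snd.sub_const ξ
  have h3 := ((Complex.ofRealCLM.hasFDerivAt.comp t (h1.inner ℝ h2)).const_mul
    (2 * Real.pi * Complex.I : ℂ)).cexp.fderiv
  have h4 := congrArg (fun L : RN d × RN d →L[ℝ] ℂ => L (a, b)) h3
  change fderiv ℝ (oscPhase x ξ) t (a, b) = _ at h4
  rw [h4]
  simp [oscPhase, fderivInnerCLM_apply]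
  ring

theorem integrable_osc {u : V3 d → ℂ} (hu : Adm u) (x ξ : RN d) :
    Integrable (fun t : RN d × RN d => u (x, t) * oscPhase x ξ t) :=
  Continuous.integrable_of_hasCompactSupport
    ((hu.smooth.continuous.comp (by fun_prop)).mul (contDiff_oscPhase x ξ).continuous)
    (hu.cpt.slice x).mul_right

theorem osc_add {u u' : V3 d → ℂ} (hu : Adm u) (hu' : Adm u') (x ξ : RN d) :
    osc (fun v => u v + u' v) x ξ = osc u x ξ + osc u' x ξ := by
  unfold osc
  simp only [add_mul]
  exact integral_add (integrable_osc hu x ξ) (integrable_osc hu' x ξ)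

theorem osc_mul_left (g : RN d → ℂ) (u : V3 d → ℂ) (x ξ : RN d) :
    osc (fun v => g v.1 * u v) x ξ = g x * osc u x ξ := by
  unfold osc
  simp only [mul_assoc]
  exact integral_const_mul _ _

theorem osc_const_mul (a : ℂ) (u : V3 d → ℂ) (x ξ : RN d) :
    osc (fun v => a * u v) x ξ = a * osc u x ξ := osc_mul_left (fun _ => a) u x ξ

theorem osc_sum {κ : Type*} (S : Finset κ) {f : κ → V3 d → ℂ} (hf : ∀ j, Adm (f j)) (x ξ : RN d) :
    osc (fun v => ∑ j ∈ S, f j v) x ξ = ∑ j ∈ S, osc (f j) x ξ := by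
  unfold osc
  simp only [Finset.sum_mul]
  exact integral_finsetSum _ fun j _ => integrable_osc (hf j) x ξ

/-- Integration by parts in $(y,\eta)$; the compact support of the amplitude removes the boundary
terms. -/
theorem osc_fderiv {u : V3 d → ℂ} (hu : Adm u) (x ξ a b : RN d) :
    osc (fun v => fderiv ℝ u v (0, a, b)) x ξ = 2 * Real.pi * Complex.I *
      osc (fun v => ((⟪a, v.2.2 - ξ⟫_ℝ - ⟪v.1 - v.2.1, b⟫_ℝ : ℝ) : ℂ) * u v) x ξ := by
  have hd : ∀ t : RN d × RN d,
      fderiv ℝ (fun t => u (x, t)) t (a, b) = fderiv ℝ u (x, t) (0, a, b) := fun t => by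
    have := ((hu.smooth.differentiable (by simp) (x, t)).hasFDerivAt.comp t
      (hasFDerivAt_prodMk_right x t)).fderiv
    simp only [Function.comp_def] at this
    rw [this]
    simp
  have hs : ContDiff ℝ ∞ (fun t => u (x, t)) := hu.smooth.comp (contDiff_const.prodMk contDiff_id)
  have hp := contDiff_oscPhase x ξ
  have hcs := hu.cpt.slice x
  have : (volume : Measure (RN d × RN d)).IsAddHaarMeasure :=
    Measure.prod.instIsAddHaarMeasure volume volume
  have key := integral_mul_fderiv_eq_neg_fderiv_mul_of_integrable (μ := volume)
    (f := oscPhase x ξ) (g := fun t => u (x, t)) (v := ((a, b) : RN d × RN d))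
    (Continuous.integrable_of_hasCompactSupport
      ((contDiff_fderiv_apply_const hp _).continuous.mul hs.continuous) hcs.mul_left)
    (Continuous.integrable_of_hasCompactSupport
      (hp.continuous.mul (contDiff_fderiv_apply_const hs _).continuous)
      (hcs.fderiv_apply ℝ _).mul_left)
    (Continuous.integrable_of_hasCompactSupport (hp.continuous.mul hs.continuous) hcs.mul_left)
    (fun t _ => hp.differentiable (by simp) t) (fun t _ => hs.differentiable (by simp) t)
  simp only [hd, fderiv_oscPhase] at key
  unfold osc
  rw [← integral_const_mul]
  calc _ = ∫ t : RN d × RN d, oscPhase x ξ t * fderiv ℝ u (x, t) (0, a, b) := by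
        congr 1; funext t; ring
    _ = _ := by
        rw [key, ← integral_neg]
        congr 1; funext t; push_cast; ring

theorem osc_fderiv_y {u : V3 d → ℂ} (hu : Adm u) (x ξ : RN d)
    (j : Fin (d + 1)) :
    osc (fun v => fderiv ℝ u v (dir (.inr (.inl j)))) x ξ =
      2 * Real.pi * Complex.I * osc (fun v => ((v.2.2 j - ξ j : ℝ) : ℂ) * u v) x ξ := by
  have := osc_fderiv hu x ξ (EuclideanSpace.single j 1) 0
  simpa [dir, EuclideanSpace.inner_single_left] using this

theorem osc_fderiv_xi {u : V3 d → ℂ} (hu : Adm u) (x ξ : RN d)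
    (j : Fin (d + 1)) :
    osc (fun v => fderiv ℝ u v (dir (.inr (.inr j)))) x ξ =
      2 * Real.pi * Complex.I * osc (fun v => (-(v.1 j - v.2.1 j : ℝ) : ℂ) * u v) x ξ := by
  have := osc_fderiv hu x ξ 0 (EuclideanSpace.single j 1)
  simpa [dir, EuclideanSpace.inner_single_right] using this

/-- The multipliers `⟨η⟩(x - y)_j / q` of the integration by parts in `η`. -/
def oscMu (ξ : RN d) (j : Fin (d + 1)) (v : V3 d) : ℝ :=
  jap v.2.2 ^ (1 : ℝ) * (v.1 j - v.2.1 j) * osq ξ v ^ (-1 : ℝ)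

/-- The multipliers `(η - ξ)_j / (⟨η⟩ q)` of the integration by parts in `y`. -/
def oscNu (ξ : RN d) (j : Fin (d + 1)) (v : V3 d) : ℝ :=
  jap v.2.2 ^ (-1 : ℝ) * (v.2.2 j - ξ j) * osq ξ v ^ (-1 : ℝ)

/-- One integration by parts: it does not change the oscillatory integral and gains
`osq ξ ^ (-1/2)`. -/
def ibp (ξ : RN d) (u : V3 d → ℂ) (v : V3 d) : ℂ :=
  ((osq ξ v ^ (-1 : ℝ) : ℝ) : ℂ) * u v +
    (∑ j, -(2 * Real.pi * Complex.I)⁻¹ *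
      fderiv ℝ (fun v => (oscMu ξ j v : ℂ) * u v) v (dir (.inr (.inr j)))) +
    ∑ j, (2 * Real.pi * Complex.I)⁻¹ *
      fderiv ℝ (fun v => (oscNu ξ j v : ℂ) * u v) v (dir (.inr (.inl j)))

theorem cls_oscMu (j : Fin (d + 1)) :
    Cls (fun (ξ : RN d) v => jap v.2.2 ^ (1 / 2 : ℝ) * osq ξ v ^ (-1 / 2 : ℝ))
      (fun ξ v => oscMu ξ j v) := by
  refine (((jap_rpow_cls 1).mul (cls_sub_xy j)).mul (cls_osq.rpow osq_pos (-1))).congr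
    (fun ξ v => ?_) fun _ _ => rfl
  rw [← mul_assoc, ← Real.rpow_add (jap_pos _), mul_assoc, ← Real.rpow_add (osq_pos _ _)]
  norm_num

theorem cls_oscNu (j : Fin (d + 1)) :
    Cls (fun (ξ : RN d) v => jap v.2.2 ^ (-1 / 2 : ℝ) * osq ξ v ^ (-1 / 2 : ℝ))
      (fun ξ v => oscNu ξ j v) := by
  refine (((jap_rpow_cls (-1)).mul (cls_sub_xi j)).mul (cls_osq.rpow osq_pos (-1))).congr
    (fun ξ v => ?_) fun _ _ => rfl
  rw [← mul_assoc, ← Real.rpow_add (jap_pos _), mul_assoc, ← Real.rpow_add (osq_pos _ _)]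
  norm_num

/-- The multipliers have weights $\langle\eta\rangle^{\pm1/2}q^{-1/2}$, and the derivative applied
to each has the opposite scale $\langle\eta\rangle^{\mp1/2}$. Only the gain $q^{-1/2}$ remains. -/
theorem cls_ibp {w : P → V3 d → ℝ} {u : P → V3 d → ℂ} (hw : ∀ p v, 0 ≤ w p v) (Ξ : P → RN d)
    (hu : Cls w u) :
    Cls (fun p v => w p v * osq (Ξ p) v ^ (-1 / 2 : ℝ)) (fun p => ibp (Ξ p) (u p)) := by
  have hq : ∀ (p : P) (v : V3 d), 0 ≤ osq (Ξ p) v ^ (-1 / 2 : ℝ) := fun p v =>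
    Real.rpow_nonneg (osq_pos _ _).le _
  have h0 : ∀ p v, 0 ≤ w p v * osq (Ξ p) v ^ (-1 / 2 : ℝ) := fun p v => mul_nonneg (hw p v) (hq p v)
  refine SymClass.add (SymClass.add ?_ (SymClass.sum scale_nonneg h0 _ fun j _ => ?_))
    (SymClass.sum scale_nonneg h0 _ fun j _ => ?_)
  · refine (((cls_osq.rpow osq_pos (-1)).comp_param Ξ).ofReal.mul hu).mono scale_nonneg
      (fun p v => mul_nonneg (Real.rpow_nonneg (osq_pos _ _).le _) (hw p v)) 1 fun p v => ?_
    rw [one_mul, mul_comm]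
    exact mul_le_mul_of_nonneg_left
      (Real.rpow_le_rpow_of_exponent_le (one_le_osq _ _) (by norm_num)) (hw p v)
  · refine SymClass.congr ((((((cls_oscMu j).comp_param Ξ).ofReal.mul hu).fderiv_apply
      (.inr (.inr j)))).clm
        ((-(2 * Real.pi * Complex.I)⁻¹ : ℂ) • ContinuousLinearMap.id ℝ ℂ)) (fun p v => ?_)
        fun p v => rfl
    have := inv_sqrt_jap_mul v.2.2
    simp only [scale]
    linear_combination (w p v * osq (Ξ p) v ^ (-1 / 2 : ℝ)) * this
  · refine SymClass.congr ((((((cls_oscNu j).comp_param Ξ).ofReal.mul hu).fderiv_apply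
      (.inr (.inl j)))).clm
        (((2 * Real.pi * Complex.I)⁻¹ : ℂ) • ContinuousLinearMap.id ℝ ℂ)) (fun p v => ?_)
        fun p v => rfl
    have := inv_sqrt_jap_mul v.2.2
    simp only [scale]
    linear_combination (w p v * osq (Ξ p) v ^ (-1 / 2 : ℝ)) * this

theorem Adm.oscMu {u : V3 d → ℂ} (hu : Adm u) (ξ : RN d) (j : Fin (d + 1)) :
    Adm (fun v => (oscMu ξ j v : ℂ) * u v) := hu.mul_left ((cls_oscMu j).ofReal.smooth ξ)

theorem Adm.oscNu {u : V3 d → ℂ} (hu : Adm u) (ξ : RN d) (j : Fin (d + 1)) :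
    Adm (fun v => (oscNu ξ j v : ℂ) * u v) := hu.mul_left ((cls_oscNu j).ofReal.smooth ξ)

theorem Adm.ibp {u : V3 d → ℂ} (hu : Adm u) (ξ : RN d) : Adm (ibp ξ u) :=
  ((hu.mul_left ((cls_osq.rpow osq_pos (-1)).ofReal.smooth ξ)).add
    (Adm.sum _ fun j => ((hu.oscMu ξ j).fderiv_apply _).const_mul _)).add
    (Adm.sum _ fun j => ((hu.oscNu ξ j).fderiv_apply _).const_mul _)

/-- With $\mu_j,\nu_j$ the two families of multipliers,
$q^{-1}+\sum_j(x-y)_j\mu_j+\sum_j(\eta-\xi)_j\nu_j=q^{-1}q=1$. Under the oscillatory integral the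
factors $(x-y)_j$ and $(\eta-\xi)_j$ turn into derivatives in $\eta_j$ and $y_j$. -/
theorem osc_ibp {u : V3 d → ℂ} (hu : Adm u) (x ξ : RN d) :
    osc (ibp ξ u) x ξ = osc u x ξ := by
  have hπ : (2 * Real.pi * Complex.I : ℂ) ≠ 0 := by simp [Real.pi_ne_zero]
  have hq : Adm (fun v => ((osq ξ v ^ (-1 : ℝ) : ℝ) : ℂ) * u v) :=
    hu.mul_left ((cls_osq.rpow osq_pos (-1)).ofReal.smooth ξ)
  have dμ := fun j => ((hu.oscMu ξ j).fderiv_apply (dir (.inr (.inr j)))).const_mul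
    (-(2 * Real.pi * Complex.I)⁻¹)
  have dν := fun j => ((hu.oscNu ξ j).fderiv_apply (dir (.inr (.inl j)))).const_mul
    ((2 * Real.pi * Complex.I)⁻¹)
  have kμ := fun j => (hu.oscMu ξ j).mul_left (g := fun v => ((xyL j v : ℝ) : ℂ))
    (Complex.ofRealCLM.contDiff.comp (xyL j).contDiff)
  have kν := fun j => (hu.oscNu ξ j).mul_left (g := fun v => ((xiL j v - ξ j : ℝ) : ℂ))
    (Complex.ofRealCLM.contDiff.comp ((xiL j).contDiff.sub contDiff_const))
  have sμ := osc_sum Finset.univ dμ x ξ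
  have sν := osc_sum Finset.univ dν x ξ
  have eμ : ∀ j, osc (fun v => -(2 * Real.pi * Complex.I)⁻¹ *
      fderiv ℝ (fun v => (oscMu ξ j v : ℂ) * u v) v (dir (.inr (.inr j)))) x ξ =
      osc (fun v => ((xyL j v : ℝ) : ℂ) * ((oscMu ξ j v : ℂ) * u v)) x ξ := fun j => by
    rw [osc_const_mul, osc_fderiv_xi (hu.oscMu ξ j), ← mul_assoc, neg_mul, inv_mul_cancel₀ hπ,
      ← osc_const_mul]
    congr 1; funext v; simp only [xyL_apply]; push_cast; ring
  have eν : ∀ j, osc (fun v => (2 * Real.pi * Complex.I)⁻¹ *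
      fderiv ℝ (fun v => (oscNu ξ j v : ℂ) * u v) v (dir (.inr (.inl j)))) x ξ =
      osc (fun v => ((xiL j v - ξ j : ℝ) : ℂ) * ((oscNu ξ j v : ℂ) * u v)) x ξ := fun j => by
    rw [osc_const_mul, osc_fderiv_y (hu.oscNu ξ j), ← mul_assoc, inv_mul_cancel₀ hπ, one_mul]
    rfl
  simp only [eμ] at sμ
  simp only [eν] at sν
  rw [← osc_sum Finset.univ kμ] at sμ
  rw [← osc_sum Finset.univ kν] at sν
  unfold ibp
  rw [osc_add (hq.add (Adm.sum _ dμ)) (Adm.sum _ dν), osc_add hq (Adm.sum _ dμ), sμ, sν,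
    ← osc_add hq (Adm.sum _ kμ), ← osc_add (hq.add (Adm.sum _ kμ)) (Adm.sum _ kν)]
  congr 1
  funext v
  have h1 : osq ξ v ^ (-1 : ℝ) * osq ξ v = 1 := by
    rw [Real.rpow_neg_one, inv_mul_cancel₀ (osq_pos _ _).ne']
  have h2 : osq ξ v ^ (-1 : ℝ) + ∑ j, xyL j v * oscMu ξ j v +
      ∑ j, (xiL j v - ξ j) * oscNu ξ j v = 1 := by
    refine Eq.trans ?_ h1
    conv_rhs => rw [osq_eq, mul_add, mul_add, mul_one, Finset.mul_sum, Finset.mul_sum, ← osq_eq]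
    unfold MixedSymbols.oscMu MixedSymbols.oscNu
    congr 1
    · congr 1
      exact Finset.sum_congr rfl fun j _ => by simp only [xyL_apply]; ring
    · exact Finset.sum_congr rfl fun j _ => by simp only [xiL_apply]; ring
  have h3 := congrArg (fun r : ℝ => (r : ℂ) * u v) h2
  simp only [Complex.ofReal_add, Complex.ofReal_sum, Complex.ofReal_mul, add_mul, Finset.sum_mul,
    Complex.ofReal_one, one_mul, mul_assoc] at h3
  exact h3

end Oscillatory

/-! ### The basic estimate for oscillatory integrals -/

section KeyBound

open MeasureTheory

variable {d : ℕ} {P : Type*}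

theorem norm_sub_le_jap_add_osq (ξ : RN d) (v : V3 d) :
    ‖v.2.2 - ξ‖ ≤ jap v.2.2 / 2 + osq ξ v / 2 := by
  have h := norm_sub_snd_le ξ v
  have h1 := sqrt_jap_sq v.2.2
  have h2 := sqrt_osq_sq ξ v
  nlinarith [sq_nonneg (jap v.2.2 ^ (1 / 2 : ℝ) - osq ξ v ^ (1 / 2 : ℝ))]

/-- This bound and the next say that $\langle\xi\rangle$ and $\langle\eta\rangle$ are comparable up
to a factor $q$: by the arithmetic-geometric mean inequality
$|\eta-\xi|\le\frac12\langle\eta\rangle+\frac12q$. -/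
theorem jap_le_mul_osq (ξ : RN d) (v : V3 d) : jap ξ ≤ 2 * jap v.2.2 * osq ξ v := by
  have h := norm_sub_le_jap_add_osq ξ v
  have h1 := jap_le_add ξ v.2.2
  rw [norm_sub_rev] at h1
  nlinarith [one_le_jap v.2.2, one_le_osq ξ v,
    mul_nonneg (sub_nonneg.2 (one_le_jap v.2.2)) (sub_nonneg.2 (one_le_osq ξ v))]

theorem jap_snd_le_mul_osq (ξ : RN d) (v : V3 d) : jap v.2.2 ≤ 3 * jap ξ * osq ξ v := by
  have h := norm_sub_le_jap_add_osq ξ v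
  have h1 := jap_le_add v.2.2 ξ
  nlinarith [one_le_jap ξ, one_le_osq ξ v,
    mul_nonneg (sub_nonneg.2 (one_le_jap ξ)) (sub_nonneg.2 (one_le_osq ξ v))]

/-- Replacing $\langle\eta\rangle$ by the fixed $\langle\xi\rangle$ costs one more factor $q$ in
each bracket and separates the variables $y$ and $\eta$. The brackets are at most $3q^2$ and $4q^2$;
the constant 36 is not sharp. -/
theorem mul_le_osq_pow (ξ : RN d) (v : V3 d) :
    (1 + jap ξ * ‖v.1 - v.2.1‖ ^ 2) * (1 + ‖v.2.2 - ξ‖ ^ 2 / jap ξ) ≤ 36 * osq ξ v ^ 4 := by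
  have hq := one_le_osq ξ v
  have hJ := jap_pos v.2.2
  have hJ' := jap_pos ξ
  set q := osq ξ v
  have h0 : 0 ≤ jap v.2.2 * ‖v.1 - v.2.1‖ ^ 2 := by positivity
  have h0' : 0 ≤ ‖v.2.2 - ξ‖ ^ 2 / jap v.2.2 := by positivity
  have ha : jap v.2.2 * ‖v.1 - v.2.1‖ ^ 2 ≤ q := by
    change _ ≤ osq ξ v; rw [osq]; linarith
  have hb : ‖v.2.2 - ξ‖ ^ 2 / jap v.2.2 ≤ q := by
    change _ ≤ osq ξ v; rw [osq]; linarith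
  have hA : jap ξ * ‖v.1 - v.2.1‖ ^ 2 ≤ 2 * q ^ 2 := by
    calc jap ξ * ‖v.1 - v.2.1‖ ^ 2 ≤ (2 * jap v.2.2 * q) * ‖v.1 - v.2.1‖ ^ 2 :=
          mul_le_mul_of_nonneg_right (jap_le_mul_osq ξ v) (by positivity)
      _ = 2 * q * (jap v.2.2 * ‖v.1 - v.2.1‖ ^ 2) := by ring
      _ ≤ 2 * q * q := mul_le_mul_of_nonneg_left ha (by linarith)
      _ = _ := by ring
  have hB : ‖v.2.2 - ξ‖ ^ 2 / jap ξ ≤ 3 * q ^ 2 := by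
    rw [div_le_iff₀ hJ']
    rw [div_le_iff₀ hJ] at hb
    calc ‖v.2.2 - ξ‖ ^ 2 ≤ q * jap v.2.2 := hb
      _ ≤ q * (3 * jap ξ * q) :=
          mul_le_mul_of_nonneg_left (jap_snd_le_mul_osq ξ v) (by linarith)
      _ = _ := by ring
  have hq2 : 1 ≤ q ^ 2 := one_le_pow₀ hq
  have hA0 : 0 ≤ jap ξ * ‖v.1 - v.2.1‖ ^ 2 := by positivity
  calc _ ≤ (3 * q ^ 2) * (4 * q ^ 2) :=
        mul_le_mul (by linarith) (by linarith) (by positivity) (by positivity)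
    _ ≤ _ := by nlinarith [pow_nonneg (zero_le_one.trans hq) 4]

/-- The decay exponent used to integrate in each of the two groups of variables. -/
def decay (d : ℕ) : ℝ := ((d : ℝ) + 2) / 2

/-- Twice the exponent `decay d` is $d+2$, which exceeds the dimension $d+1$. -/
theorem integrable_decay :
    Integrable (fun y : RN d => (1 + ‖y‖ ^ 2) ^ (-decay d)) := by
  have h := integrable_rpow_neg_one_add_norm_sq (E := RN d) (μ := volume) (r := (d : ℝ) + 2)
    (by rw [finrank_euclideanSpace_fin]; push_cast; linarith)
  convert h using 3
  rw [decay]; ring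

/-- The dominating function `(1 + ⟨ξ⟩|x - y|²)^{-r} (1 + |η - ξ|²/⟨ξ⟩)^{-r}`. -/
def domFn (x ξ : RN d) (t : RN d × RN d) : ℝ :=
  (1 + ‖jap ξ ^ (1 / 2 : ℝ) • (x - t.1)‖ ^ 2) ^ (-decay d) *
    (1 + ‖jap ξ ^ (-1 / 2 : ℝ) • (t.2 - ξ)‖ ^ 2) ^ (-decay d)

theorem osq_rpow_le_domFn (x ξ : RN d) (t : RN d × RN d) :
    osq ξ (x, t) ^ (-(4 * decay d)) ≤ (36 : ℝ) ^ decay d * domFn x ξ t := by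
  have hr : 0 ≤ decay d := by unfold decay; positivity
  have hJ := jap_pos ξ
  have e1 : ‖jap ξ ^ (1 / 2 : ℝ) • (x - t.1)‖ ^ 2 = jap ξ * ‖x - t.1‖ ^ 2 := by
    rw [norm_smul, mul_pow, Real.norm_of_nonneg (Real.rpow_nonneg hJ.le _), sq (jap _ ^ _),
      sqrt_jap_sq]
  have e2 : ‖jap ξ ^ (-1 / 2 : ℝ) • (t.2 - ξ)‖ ^ 2 = ‖t.2 - ξ‖ ^ 2 / jap ξ := by
    rw [norm_smul, mul_pow, Real.norm_of_nonneg (Real.rpow_nonneg hJ.le _), sq (jap _ ^ _),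
      ← Real.rpow_add hJ, show (-1 / 2 + -1 / 2 : ℝ) = -1 by norm_num, Real.rpow_neg_one,
      div_eq_inv_mul]
  have h := mul_le_osq_pow ξ (x, t)
  have hA0 : 0 ≤ jap ξ * ‖x - t.1‖ ^ 2 := by positivity
  have hB0 : 0 ≤ ‖t.2 - ξ‖ ^ 2 / jap ξ := by positivity
  have hq := osq_pos ξ (x, t)
  rw [domFn, e1, e2, ← Real.mul_rpow (by linarith) (by linarith)]
  have h' := Real.rpow_le_rpow_of_nonpos
    (mul_pos (by linarith : 0 < 1 + jap ξ * ‖x - t.1‖ ^ 2)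
      (by linarith : 0 < 1 + ‖t.2 - ξ‖ ^ 2 / jap ξ)) h (by linarith : -decay d ≤ 0)
  rw [Real.mul_rpow (by norm_num) (by positivity), ← Real.rpow_natCast_mul hq.le] at h'
  have h36 : (36 : ℝ) ^ decay d * 36 ^ (-decay d) = 1 := by
    rw [← Real.rpow_add (by norm_num)]; simp
  have h'' := mul_le_mul_of_nonneg_left h' (Real.rpow_nonneg (by norm_num : (0 : ℝ) ≤ 36) (decay d))
  rw [← mul_assoc, h36, one_mul] at h''
  rwa [show ((4 : ℕ) : ℝ) * -decay d = -(4 * decay d) by push_cast; ring] at h''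

theorem integrable_domFn (x ξ : RN d) : Integrable (domFn x ξ) := by
  have h1 : Integrable (fun y : RN d =>
      (1 + ‖jap ξ ^ (1 / 2 : ℝ) • (x - y)‖ ^ 2) ^ (-decay d)) :=
    ((integrable_decay (d := d)).comp_smul (Real.rpow_pos_of_pos (jap_pos ξ) (1 / 2)).ne').comp_sub_left x
  have h2 : Integrable (fun y : RN d =>
      (1 + ‖jap ξ ^ (-1 / 2 : ℝ) • (y - ξ)‖ ^ 2) ^ (-decay d)) :=
    ((integrable_decay (d := d)).comp_smul
      (Real.rpow_pos_of_pos (jap_pos ξ) (-1 / 2)).ne').comp_sub_right ξ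
  exact h1.mul_prod h2

/-- The Jacobians of the dilations by $\langle\xi\rangle^{1/2}$ in $y$ and
$\langle\xi\rangle^{-1/2}$ in $\eta$ cancel, so the integral depends on neither $x$ nor $\xi$. -/
theorem integral_domFn (x ξ : RN d) :
    ∫ t, domFn x ξ t = (∫ y : RN d, (1 + ‖y‖ ^ 2) ^ (-decay d)) ^ 2 := by
  unfold domFn
  rw [Measure.volume_eq_prod, integral_prod_mul
    (fun y : RN d => (1 + ‖jap ξ ^ (1 / 2 : ℝ) • (x - y)‖ ^ 2) ^ (-decay d))
    (fun y : RN d => (1 + ‖jap ξ ^ (-1 / 2 : ℝ) • (y - ξ)‖ ^ 2) ^ (-decay d)),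
    integral_sub_left_eq_self
      (fun y : RN d => (1 + ‖jap ξ ^ (1 / 2 : ℝ) • y‖ ^ 2) ^ (-decay d)) volume x,
    integral_sub_right_eq_self
      (fun y : RN d => (1 + ‖jap ξ ^ (-1 / 2 : ℝ) • y‖ ^ 2) ^ (-decay d)) ξ,
    Measure.integral_comp_smul volume (fun y : RN d => (1 + ‖y‖ ^ 2) ^ (-decay d)),
    Measure.integral_comp_smul volume (fun y : RN d => (1 + ‖y‖ ^ 2) ^ (-decay d)),
    smul_eq_mul, smul_eq_mul, mul_mul_mul_comm, ← abs_mul, ← mul_inv, ← mul_pow,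
    mul_comm (jap ξ ^ (1 / 2 : ℝ)), inv_sqrt_jap_mul]
  simp [sq]

theorem exists_ibp_iterate {w : P → V3 d → ℝ} {u : P → V3 d → ℂ} (hu : Cls w u)
    (hadm : ∀ p, Adm (u p)) (hw : ∀ p v, 0 ≤ w p v) (Ξ : P → RN d) (n : ℕ) :
    ∃ u' : P → V3 d → ℂ, Cls (fun p v => w p v * osq (Ξ p) v ^ (-(n : ℝ) / 2)) u' ∧
      (∀ p, Adm (u' p)) ∧ ∀ p x, osc (u' p) x (Ξ p) = osc (u p) x (Ξ p) := by
  induction n with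
  | zero => exact ⟨u, hu.congr (fun p v => by simp) fun _ _ => rfl, hadm, fun _ _ => rfl⟩
  | succ n ih =>
    obtain ⟨u', h1, h2, h3⟩ := ih
    refine ⟨fun p => ibp (Ξ p) (u' p), (cls_ibp (fun p v =>
      mul_nonneg (hw p v) (Real.rpow_nonneg (osq_pos _ _).le _)) Ξ h1).congr (fun p v => ?_)
      fun _ _ => rfl, fun p => (h2 p).ibp _, fun p x => (osc_ibp (h2 p) x _).trans (h3 p x)⟩
    rw [mul_assoc, ← Real.rpow_add (osq_pos _ _)]
    congr 2; push_cast; ring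

/-- If the weight of the amplitude `u` is at most `W(x)` times a power of `osq`, then the
oscillatory integral is bounded by `W`. -/
theorem osc_bound {w : P → V3 d → ℝ} {u : P → V3 d → ℂ} (hu : Cls w u)
    (hadm : ∀ p, Adm (u p)) (hw : ∀ p v, 0 ≤ w p v) (Ξ : P → RN d) {W : P → RN d → ℝ}
    (hW : ∀ p x, 0 ≤ W p x) (k : ℝ)
    (hle : ∃ C, ∀ p v, w p v ≤ C * (W p v.1 * osq (Ξ p) v ^ k)) :
    ∃ C, 0 ≤ C ∧ ∀ p x, ‖osc (u p) x (Ξ p)‖ ≤ C * W p x := by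
  obtain ⟨C₁, hC₁⟩ := hle
  -- Each integration by parts gains $q^{-1/2}$; `n` of them beat the growth $q^k$ and leave the
  -- integrable power $q^{-4\,\mathrm{decay}}$.
  obtain ⟨n, hn⟩ := exists_nat_ge (2 * (k + 4 * decay d))
  obtain ⟨u', h1, h2, h3⟩ := exists_ibp_iterate hu hadm hw Ξ n
  have hW' : ∀ p v, 0 ≤ W p v.1 * osq (Ξ p) v ^ (-(4 * decay d)) := fun p v =>
    mul_nonneg (hW p _) (Real.rpow_nonneg (osq_pos _ _).le _)
  have h4 : Cls (fun p v => W p v.1 * osq (Ξ p) v ^ (-(4 * decay d))) u' := by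
    refine h1.mono scale_nonneg (fun p v => mul_nonneg (hw p v)
      (Real.rpow_nonneg (osq_pos _ _).le _)) |C₁| fun p v => ?_
    have hq := osq_pos (Ξ p) v
    calc w p v * osq (Ξ p) v ^ (-(n : ℝ) / 2)
        ≤ (|C₁| * (W p v.1 * osq (Ξ p) v ^ k)) * osq (Ξ p) v ^ (-(n : ℝ) / 2) := by
          refine mul_le_mul_of_nonneg_right ((hC₁ p v).trans ?_) (Real.rpow_nonneg hq.le _)
          exact mul_le_mul_of_nonneg_right (le_abs_self _)
            (mul_nonneg (hW p _) (Real.rpow_nonneg hq.le _))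
      _ = |C₁| * (W p v.1 * osq (Ξ p) v ^ (k + -(n : ℝ) / 2)) := by
          rw [Real.rpow_add hq]; ring
      _ ≤ _ := by
          refine mul_le_mul_of_nonneg_left (mul_le_mul_of_nonneg_left ?_ (hW p _)) (abs_nonneg _)
          exact Real.rpow_le_rpow_of_exponent_le (one_le_osq _ _) (by linarith)
  obtain ⟨C, hC0, hC⟩ := (h4.bound 0).zeroth
  refine ⟨C * (36 : ℝ) ^ decay d * (∫ y : RN d, (1 + ‖y‖ ^ 2) ^ (-decay d)) ^ 2, by positivity,
    fun p x => ?_⟩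
  rw [← h3, osc]
  refine (norm_integral_le_of_norm_le
    ((integrable_domFn x (Ξ p)).const_mul (C * (36 : ℝ) ^ decay d * W p x))
    (Filter.Eventually.of_forall fun t => ?_)).trans (le_of_eq ?_)
  · rw [norm_mul, norm_oscPhase, mul_one]
    refine (hC p (x, t) (hW' p _)).trans ?_
    have := mul_le_mul_of_nonneg_left (osq_rpow_le_domFn x (Ξ p) t) (mul_nonneg hC0 (hW p x))
    calc _ = C * W p x * osq (Ξ p) (x, t) ^ (-(4 * decay d)) := by ring
      _ ≤ _ := this
      _ = _ := by ring
  · rw [integral_const_mul, integral_domFn]; ring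

end KeyBound

/-! ### The weights of mixed homogeneity and the amplitudes they control -/

section Weights

variable {d : ℕ} {𝒟 : RN d → Submodule ℝ (RN d)}

theorem AdaptedFrame.rho_eq_norm (X : AdaptedFrame 𝒟) (x ξ : RN d) :
    X.rho x ξ = ‖(WithLp.toLp 2 fun i : Fin d => X.M x ξ i.castSucc :
      EuclideanSpace ℝ (Fin d))‖ := by
  rw [EuclideanSpace.norm_eq]
  rfl

theorem AdaptedFrame.rho_nonneg (X : AdaptedFrame 𝒟) (x ξ : RN d) : 0 ≤ X.rho x ξ :=
  Real.sqrt_nonneg _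

theorem AdaptedFrame.exists_rho_le (X : AdaptedFrame 𝒟) :
    ∃ C, 0 ≤ C ∧ ∀ x ξ, X.rho x ξ ≤ C * ‖ξ‖ := by
  choose C hC using fun i j => X.bounded [] i j
  set K := ∑ i, ∑ j, |C i j| with hK
  have hK0 : 0 ≤ K := by positivity
  have hM : ∀ x ξ i, |X.M x ξ i| ≤ K * ‖ξ‖ := fun x ξ i => by
    calc |X.M x ξ i| ≤ ∑ j, |X.A x i j * ξ j| := Finset.abs_sum_le_sum_abs _ _
      _ ≤ ∑ j, |C i j| * ‖ξ‖ := Finset.sum_le_sum fun j _ => by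
          rw [abs_mul]
          exact mul_le_mul ((hC i j x).trans (le_abs_self _)) (abs_apply_le_norm ξ j)
            (abs_nonneg _) (abs_nonneg _)
      _ ≤ K * ‖ξ‖ := by
          rw [← Finset.sum_mul]
          refine mul_le_mul_of_nonneg_right ?_ (norm_nonneg _)
          exact Finset.single_le_sum (f := fun i => ∑ j, |C i j|)
            (fun i _ => Finset.sum_nonneg fun j _ => abs_nonneg _) (Finset.mem_univ i)
  refine ⟨(d + 1) * K, by positivity, fun x ξ => ?_⟩
  refine Real.sqrt_le_iff.2 ⟨by positivity, ?_⟩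
  calc ∑ i : Fin d, |X.M x ξ i.castSucc| ^ 2 ≤ ∑ i : Fin d, (K * ‖ξ‖) ^ 2 :=
        Finset.sum_le_sum fun i _ => pow_le_pow_left₀ (abs_nonneg _) (hM _ _ _) 2
    _ = d * (K * ‖ξ‖) ^ 2 := by simp
    _ ≤ ((d + 1) * K * ‖ξ‖) ^ 2 := by
        rw [mul_assoc ((d : ℝ) + 1), mul_pow ((d : ℝ) + 1)]
        refine mul_le_mul_of_nonneg_right ?_ (sq_nonneg _)
        have : (0 : ℝ) ≤ d := Nat.cast_nonneg d
        nlinarith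

/-- $\rho_x$ is the norm of a linear function of $\xi$, hence subadditive. -/
theorem AdaptedFrame.exists_rho_sub_le (X : AdaptedFrame 𝒟) :
    ∃ C, 0 ≤ C ∧ ∀ x η ξ, X.rho x η ≤ X.rho x ξ + C * ‖η - ξ‖ := by
  obtain ⟨C, hC0, hC⟩ := X.exists_rho_le
  refine ⟨C, hC0, fun x η ξ => ?_⟩
  have h := hC x (η - ξ)
  rw [X.rho_eq_norm] at h ⊢
  rw [X.rho_eq_norm]
  refine le_trans ?_ (add_le_add_right h _)
  refine le_trans (le_of_eq ?_) (norm_add_le _ _)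
  congr 1
  ext i
  simp [AdaptedFrame.M, mul_sub]

/-- The weight `1 + ρ_x(ξ) + |ξ|^{1/2}`. -/
def lam (X : AdaptedFrame 𝒟) (x ξ : RN d) : ℝ := 1 + X.rho x ξ + ‖ξ‖ ^ (1 / 2 : ℝ)

theorem one_le_lam (X : AdaptedFrame 𝒟) (x ξ : RN d) : 1 ≤ lam X x ξ := by
  have := X.rho_nonneg x ξ
  have : 0 ≤ ‖ξ‖ ^ (1 / 2 : ℝ) := by positivity
  unfold lam; linarith

theorem lam_pos (X : AdaptedFrame 𝒟) (x ξ : RN d) : 0 < lam X x ξ :=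
  one_pos.trans_le (one_le_lam X x ξ)

theorem sqrt_jap_le (ξ : RN d) : jap ξ ^ (1 / 2 : ℝ) ≤ 1 + ‖ξ‖ ^ (1 / 2 : ℝ) := by
  refine (Real.rpow_le_rpow (jap_pos ξ).le (jap_le ξ) (by norm_num)).trans ?_
  simpa using Real.rpow_add_le_add_rpow zero_le_one (norm_nonneg ξ)
    (by norm_num : (0 : ℝ) ≤ 1 / 2) (by norm_num)

theorem sqrt_jap_le_lam (X : AdaptedFrame 𝒟) (x ξ : RN d) : jap ξ ^ (1 / 2 : ℝ) ≤ lam X x ξ := by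
  have := sqrt_jap_le ξ
  have := X.rho_nonneg x ξ
  unfold lam; linarith

theorem exists_lam_le (X : AdaptedFrame 𝒟) :
    ∃ C, 1 ≤ C ∧ ∀ x η ξ, lam X x η ≤ lam X x ξ + C * (1 + ‖η - ξ‖) := by
  obtain ⟨C, hC0, hC⟩ := X.exists_rho_sub_le
  refine ⟨C + 1, by linarith, fun x η ξ => ?_⟩
  have h1 : ‖η‖ ^ (1 / 2 : ℝ) ≤ ‖ξ‖ ^ (1 / 2 : ℝ) + (1 + ‖η - ξ‖) := by
    have h2 : ‖η‖ ≤ ‖ξ‖ + ‖η - ξ‖ := by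
      calc ‖η‖ = ‖ξ + (η - ξ)‖ := by congr 1; abel
        _ ≤ _ := norm_add_le _ _
    refine (Real.rpow_le_rpow (norm_nonneg _) h2 (by norm_num)).trans ?_
    refine (Real.rpow_add_le_add_rpow (norm_nonneg _) (norm_nonneg _) (by norm_num)
      (by norm_num)).trans (add_le_add_right ?_ _)
    calc ‖η - ξ‖ ^ (1 / 2 : ℝ) ≤ (1 + ‖η - ξ‖) ^ (1 / 2 : ℝ) :=
          Real.rpow_le_rpow (norm_nonneg _) (by linarith) (by norm_num)
      _ ≤ (1 + ‖η - ξ‖) ^ (1 : ℝ) := Real.rpow_le_rpow_of_exponent_le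
          (by linarith [norm_nonneg (η - ξ)]) (by norm_num)
      _ = _ := Real.rpow_one _
  have := hC x η ξ
  have h3 : 0 ≤ C * ‖η - ξ‖ := by positivity
  unfold lam
  nlinarith

/-- $\lambda$ changes by at most a multiple of $1+|\eta-\xi|$, and
$|\eta-\xi|\le\langle\eta\rangle^{1/2}q^{1/2}$. Since $\langle\cdot\rangle^{1/2}\le\lambda$, the
change is at most a multiple of $q\lambda$ at either point. -/
theorem exists_lam_le_osq (X : AdaptedFrame 𝒟) :
    ∃ C, 1 ≤ C ∧ ∀ ξ (v : V3 d), lam X v.1 v.2.2 ≤ (C * osq ξ v) * lam X v.1 ξ ∧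
      lam X v.1 ξ ≤ (C * osq ξ v) * lam X v.1 v.2.2 := by
  obtain ⟨C, hC1, hC⟩ := exists_lam_le X
  refine ⟨1 + 3 * C, by linarith, fun ξ v => ?_⟩
  have hq := one_le_osq ξ v
  have hs := sqrt_osq_sq ξ v
  have hs1 := one_le_sqrt_osq ξ v
  have hsJ := sqrt_jap_sq v.2.2
  have hJ1 := one_le_sqrt_jap v.2.2
  have hn := norm_sub_snd_le ξ v
  have key : ∀ l l' : ℝ, 1 ≤ l' → l ≤ l' + C * (1 + ‖v.2.2 - ξ‖) →
      ‖v.2.2 - ξ‖ ≤ 2 * l' * osq ξ v → l ≤ ((1 + 3 * C) * osq ξ v) * l' := by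
    intro l l' h1 h2 h3
    have h4 : 1 ≤ l' * osq ξ v := one_le_mul_of_one_le_of_one_le h1 hq
    have h5 : l' ≤ l' * osq ξ v := le_mul_of_one_le_right (by linarith) hq
    have h6 : C * (1 + ‖v.2.2 - ξ‖) ≤ C * (3 * (l' * osq ξ v)) :=
      mul_le_mul_of_nonneg_left (by linarith) (by linarith)
    calc l ≤ l' * osq ξ v + C * (3 * (l' * osq ξ v)) := by linarith
      _ = _ := by ring
  constructor
  · refine key _ _ (one_le_lam X v.1 ξ) (hC v.1 v.2.2 ξ) ?_
    have hl := sqrt_jap_le_lam X v.1 ξ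
    have h3 : jap v.2.2 ^ (1 / 2 : ℝ) ≤ 2 * (jap ξ ^ (1 / 2 : ℝ) * osq ξ v ^ (1 / 2 : ℝ)) := by
      refine abs_le_of_sq_le_sq' ?_ (mul_nonneg zero_le_two (mul_nonneg
        (Real.rpow_nonneg (jap_pos _).le _) (by linarith))) |>.2
      rw [mul_pow, mul_pow, sq (jap _ ^ _), hsJ, sq (jap _ ^ _), sqrt_jap_sq, sq (osq _ _ ^ _), hs]
      have := jap_snd_le_mul_osq ξ v
      nlinarith [mul_pos (jap_pos ξ) (osq_pos ξ v)]
    calc ‖v.2.2 - ξ‖ ≤ jap v.2.2 ^ (1 / 2 : ℝ) * osq ξ v ^ (1 / 2 : ℝ) := hn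
      _ ≤ (2 * (jap ξ ^ (1 / 2 : ℝ) * osq ξ v ^ (1 / 2 : ℝ))) * osq ξ v ^ (1 / 2 : ℝ) :=
          mul_le_mul_of_nonneg_right h3 (by linarith)
      _ = 2 * jap ξ ^ (1 / 2 : ℝ) * osq ξ v := by linear_combination 2 * jap ξ ^ (1 / 2 : ℝ) * hs
      _ ≤ _ := by gcongr
  · refine key _ _ (one_le_lam X v.1 v.2.2) ?_ ?_
    · rw [norm_sub_rev]; exact hC v.1 ξ v.2.2
    · have hl := sqrt_jap_le_lam X v.1 v.2.2
      calc ‖v.2.2 - ξ‖ ≤ jap v.2.2 ^ (1 / 2 : ℝ) * osq ξ v ^ (1 / 2 : ℝ) := hn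
        _ ≤ (2 * lam X v.1 v.2.2) * osq ξ v := by
            refine mul_le_mul ?_ ?_ (by linarith) (by linarith)
            · linarith
            · exact (le_mul_of_one_le_left (by linarith) hs1).trans hs.le

/-- The orders `m` and `n` may have either sign, so weights are compared from both sides before
powers are taken. -/
theorem rpow_le_rpow_of_comparable {a b c : ℝ} (ha : 0 < a) (hb : 0 < b) (hc : 0 < c)
    (h1 : a ≤ c * b) (h2 : b ≤ c * a) (s : ℝ) : a ^ s ≤ c ^ |s| * b ^ s := by
  rcases le_total 0 s with hs | hs
  · rw [abs_of_nonneg hs, ← Real.mul_rpow hc.le hb.le]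
    exact Real.rpow_le_rpow ha.le h1 hs
  · rw [abs_of_nonpos hs]
    have h3 : (c * a) ^ s ≤ b ^ s := Real.rpow_le_rpow_of_nonpos hb h2 hs
    rw [Real.mul_rpow hc.le ha.le] at h3
    calc a ^ s = c ^ (-s) * (c ^ s * a ^ s) := by
          rw [← mul_assoc, ← Real.rpow_add hc]; simp
      _ ≤ _ := mul_le_mul_of_nonneg_left h3 (Real.rpow_nonneg hc.le _)

/-- The weights of the amplitudes of order `(m, n)`. -/
def ampW (X : AdaptedFrame 𝒟) (m n : ℝ) (k : ℕ) (v : V3 d) : ℝ :=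
  jap v.2.2 ^ m * lam X v.1 v.2.2 ^ n * (1 + jap v.2.2 * ‖v.1 - v.2.1‖ ^ 2) ^ k

theorem one_le_off (v : V3 d) : 1 ≤ 1 + jap v.2.2 * ‖v.1 - v.2.1‖ ^ 2 := by
  have := mul_nonneg (jap_pos v.2.2).le (sq_nonneg ‖v.1 - v.2.1‖)
  linarith

theorem ampW_pos (X : AdaptedFrame 𝒟) (m n : ℝ) (k : ℕ) (v : V3 d) : 0 < ampW X m n k v :=
  mul_pos (mul_pos (Real.rpow_pos_of_pos (jap_pos _) _) (Real.rpow_pos_of_pos (lam_pos _ _ _) _))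
    (pow_pos (one_pos.trans_le (one_le_off v)) k)

/-- The weight of the symbols of order `(m, n)`. -/
def symW (X : AdaptedFrame 𝒟) (m n : ℝ) (x ξ : RN d) : ℝ := jap ξ ^ m * lam X x ξ ^ n

theorem symW_pos (X : AdaptedFrame 𝒟) (m n : ℝ) (x ξ : RN d) : 0 < symW X m n x ξ :=
  mul_pos (Real.rpow_pos_of_pos (jap_pos _) _) (Real.rpow_pos_of_pos (lam_pos _ _ _) _)

/-- This supplies the growth hypothesis of `osc_bound`: moving the weight from $\eta$ to $\xi$ costs
only a fixed power of $q$. -/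
theorem exists_ampW_le (X : AdaptedFrame 𝒟) (m n : ℝ) (k : ℕ) :
    ∃ C, 0 ≤ C ∧ ∀ ξ (v : V3 d),
      ampW X m n k v ≤ C * (symW X m n v.1 ξ * osq ξ v ^ (|m| + |n| + k)) := by
  obtain ⟨C, hC1, hC⟩ := exists_lam_le_osq X
  refine ⟨3 ^ |m| * C ^ |n|, by positivity, fun ξ v => ?_⟩
  have hq := osq_pos ξ v
  have h1 : jap v.2.2 ^ m ≤ (3 * osq ξ v) ^ |m| * jap ξ ^ m := by
    refine rpow_le_rpow_of_comparable (jap_pos _) (jap_pos _) (by positivity) ?_ ?_ m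
    · linarith [jap_snd_le_mul_osq ξ v]
    · have := jap_le_mul_osq ξ v
      nlinarith [mul_pos hq (jap_pos v.2.2)]
  have h2 : lam X v.1 v.2.2 ^ n ≤ (C * osq ξ v) ^ |n| * lam X v.1 ξ ^ n :=
    rpow_le_rpow_of_comparable (lam_pos _ _ _) (lam_pos _ _ _) (by positivity) (hC ξ v).1
      (hC ξ v).2 n
  have h3 : (1 + jap v.2.2 * ‖v.1 - v.2.1‖ ^ 2) ^ k ≤ osq ξ v ^ (k : ℝ) := by
    rw [Real.rpow_natCast]
    refine pow_le_pow_left₀ (by linarith [one_le_off v]) ?_ k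
    have : 0 ≤ ‖v.2.2 - ξ‖ ^ 2 / jap v.2.2 := div_nonneg (sq_nonneg _) (jap_pos _).le
    rw [osq]; linarith
  have p1 := Real.rpow_nonneg (jap_pos v.2.2).le m
  have p2 := Real.rpow_nonneg (lam_pos X v.1 v.2.2).le n
  have p3 : 0 ≤ (1 + jap v.2.2 * ‖v.1 - v.2.1‖ ^ 2) ^ k :=
    pow_nonneg (by linarith [one_le_off v]) k
  have p4 : 0 ≤ (3 * osq ξ v) ^ |m| * jap ξ ^ m := p1.trans h1
  have p5 : 0 ≤ (C * osq ξ v) ^ |n| * lam X v.1 ξ ^ n := p2.trans h2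
  calc ampW X m n k v ≤ ((3 * osq ξ v) ^ |m| * jap ξ ^ m) *
        ((C * osq ξ v) ^ |n| * lam X v.1 ξ ^ n) * osq ξ v ^ (k : ℝ) :=
        mul_le_mul (mul_le_mul h1 h2 p2 p4) h3 p3 (mul_nonneg p4 p5)
    _ = _ := by
        rw [Real.mul_rpow (by norm_num) hq.le, Real.mul_rpow (by linarith) hq.le,
          Real.rpow_add hq, Real.rpow_add hq, symW]
        ring

/-- Amplitudes of order `(m, n)`. -/
def Ampl (X : AdaptedFrame 𝒟) (m n : ℝ) (g : V3 d → ℂ) : Prop :=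
  ∃ k : ℕ, Cls (fun _ : Unit => ampW X m n k) (fun _ => g)

end Weights

/-! ### Regularization by cut-offs -/

section Cutoffs

open Filter Topology

variable {d : ℕ} {𝒟 : RN d → Submodule ℝ (RN d)}

/-- The dilated cut-off `(x, y, ξ) ↦ ψ(εy, εξ)`. -/
def cut (ψ : RN d × RN d → ℂ) (ε : ℝ) (v : V3 d) : ℂ := ψ (ε • v.2)

/-- The scaling parameters. -/
abbrev Eps : Type := Set.Ioc (0 : ℝ) 1

theorem contDiff_cut {ψ : RN d × RN d → ℂ} (hψ : ContDiff ℝ ∞ ψ) (ε : ℝ) :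
    ContDiff ℝ ∞ (cut ψ ε) :=
  hψ.comp (contDiff_snd.const_smul ε)

theorem cptSupp_cut {ψ : RN d × RN d → ℂ} (hc : HasCompactSupport ψ) {ε : ℝ} (hε : ε ≠ 0) :
    CptSupp (cut ψ ε) := by
  refine ⟨(fun t => ε⁻¹ • t) '' tsupport ψ, hc.isCompact.image (continuous_const_smul _),
    fun x t ht => ?_⟩
  refine image_eq_zero_of_notMem_tsupport (f := ψ) fun h => ht ?_
  exact ⟨ε • t, h, by simp [smul_smul, inv_mul_cancel₀ hε]⟩

theorem adm_cut {ψ : RN d × RN d → ℂ} (hψ : ContDiff ℝ ∞ ψ) (hc : HasCompactSupport ψ) {ε : ℝ}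
    (hε : ε ≠ 0) {g : V3 d → ℂ} (hg : ContDiff ℝ ∞ g) : Adm (fun v => cut ψ ε v * g v) :=
  Adm.mul_right ⟨contDiff_cut hψ ε, cptSupp_cut hc hε⟩ hg

theorem fderiv_cut {ψ : RN d × RN d → ℂ} (hψ : ContDiff ℝ ∞ ψ) (ε : ℝ) (v a : V3 d) :
    fderiv ℝ (cut ψ ε) v a = (ε : ℂ) * cut (fun t => fderiv ℝ ψ t a.2) ε v := by
  have h := ((hψ.differentiable (by simp) (ε • v.2)).hasFDerivAt.comp v
    ((ContinuousLinearMap.snd ℝ (RN d) (RN d × RN d)).hasFDerivAt.const_smul ε)).fderiv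
  change fderiv ℝ (cut ψ ε) v = _ at h
  rw [h]
  simp [cut]

theorem hasCompactSupport_fderiv_apply {ψ : RN d × RN d → ℂ} (hc : HasCompactSupport ψ)
    (a : RN d × RN d) : HasCompactSupport (fun t => fderiv ℝ ψ t a) :=
  hc.fderiv_apply ℝ a

/-- Each derivative of the cut-off produces a factor $\varepsilon$. On the support
$\varepsilon\langle\xi\rangle$ is bounded (here $\varepsilon\le1$ is used), so that factor is worth
$\langle\xi\rangle^{-1}$, smaller than every scale. The extra $\varepsilon^j$ carries these factors
through the induction, with constants uniform in $\varepsilon$. -/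
theorem cls_cut {ψ : RN d × RN d → ℂ} (hψ : ContDiff ℝ ∞ ψ) (hc : HasCompactSupport ψ) (j : ℕ) :
    Cls (fun (_ : Eps) (v : V3 d) => jap v.2.2 ^ (-(j : ℝ)))
      (fun ε v => ((ε : ℝ) : ℂ) ^ j * cut ψ ε v) := by
  have zero : ∀ (ψ : RN d × RN d → ℂ), ContDiff ℝ ∞ ψ → HasCompactSupport ψ → ∀ j : ℕ,
      ∃ C : ℝ, ∀ (ε : Eps) (v : V3 d), ‖((ε : ℝ) : ℂ) ^ j * cut ψ ε v‖ ≤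
        C * jap v.2.2 ^ (-(j : ℝ)) := by
    intro ψ hψ hc j
    obtain ⟨C, hC⟩ := hc.exists_bound_of_continuous hψ.continuous
    obtain ⟨R, hR⟩ := hc.isCompact.isBounded.exists_norm_le
    have hC0 : 0 ≤ C := (norm_nonneg _).trans (hC 0)
    refine ⟨(1 + |R|) ^ j * C, fun ε v => ?_⟩
    have hJ := jap_pos v.2.2
    by_cases h : (ε : ℝ) • v.2 ∈ tsupport ψ
    · have h1 : (ε : ℝ) * jap v.2.2 ≤ 1 + |R| := by
        have h2 : (ε : ℝ) * ‖v.2.2‖ ≤ |R| := by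
          calc (ε : ℝ) * ‖v.2.2‖ ≤ (ε : ℝ) * ‖v.2‖ :=
                mul_le_mul_of_nonneg_left (norm_snd_le v.2) ε.2.1.le
            _ = ‖(ε : ℝ) • v.2‖ := by rw [norm_smul, Real.norm_of_nonneg ε.2.1.le]
            _ ≤ |R| := (hR _ h).trans (le_abs_self R)
        have h3 := mul_le_mul_of_nonneg_left (jap_le v.2.2) ε.2.1.le
        have h4 := ε.2.2
        linarith
      have h5 : (ε : ℝ) ^ j ≤ (1 + |R|) ^ j * jap v.2.2 ^ (-(j : ℝ)) := by
        rw [Real.rpow_neg hJ.le, Real.rpow_natCast, ← div_eq_mul_inv, le_div_iff₀ (pow_pos hJ j),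
          ← mul_pow]
        exact pow_le_pow_left₀ (mul_nonneg ε.2.1.le hJ.le) h1 j
      rw [norm_mul, norm_pow, Complex.norm_real, Real.norm_of_nonneg ε.2.1.le]
      calc (ε : ℝ) ^ j * ‖cut ψ ε v‖ ≤ ((1 + |R|) ^ j * jap v.2.2 ^ (-(j : ℝ))) * C :=
            mul_le_mul h5 (hC _) (norm_nonneg _) ((pow_nonneg ε.2.1.le j).trans h5)
        _ = _ := by ring
    · rw [cut, image_eq_zero_of_notMem_tsupport h]
      simp only [mul_zero, norm_zero]
      have := Real.rpow_nonneg hJ.le (-(j : ℝ))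
      positivity
  refine ⟨fun ε => contDiff_const.mul (contDiff_cut hψ ε), fun k => ?_⟩
  induction k generalizing ψ j with
  | zero => exact zero ψ hψ hc j
  | succ k ih =>
    refine ⟨zero ψ hψ hc j, fun i => ?_⟩
    have h1 := ih (contDiff_fderiv_apply_const hψ (dir i).2)
      (hasCompactSupport_fderiv_apply hc (dir i).2) (j + 1)
    have h2 : SymBound dir scale k (fun (_ : Eps) (v : V3 d) => jap v.2.2 ^ (-(j : ℝ)) * scale i v)
        (fun ε v => ((ε : ℝ) : ℂ) ^ (j + 1) * cut (fun t => fderiv ℝ ψ t (dir i).2) ε v) := by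
      refine h1.mono scale_nonneg (fun _ v => Real.rpow_nonneg (jap_pos _).le _) (K := 1)
        fun _ v => ?_
      rw [one_mul]
      refine le_trans ?_ (mul_le_mul_of_nonneg_left (scale_ge i v)
        (Real.rpow_nonneg (jap_pos _).le _))
      rw [← Real.rpow_add (jap_pos _)]
      exact Real.rpow_le_rpow_of_exponent_le (one_le_jap _) (by push_cast; linarith)
    convert h2 using 3 with ε v
    rw [fderiv_const_mul ((contDiff_cut hψ ε).differentiable (by simp) v),
      FunLike.coe_smul, Pi.smul_apply, fderiv_cut hψ, smul_eq_mul, pow_succ]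
    ring

theorem cls_cut_one {ψ : RN d × RN d → ℂ} (hψ : ContDiff ℝ ∞ ψ) (hc : HasCompactSupport ψ) :
    Cls (fun (_ : Eps) (_ : V3 d) => (1 : ℝ)) (fun ε v => cut ψ ε v) :=
  (cls_cut hψ hc 0).congr (by simp) (by simp)

/-- The values are bounded by the Lipschitz property of `χ` and `χ 0 = 1`. The derivatives are
$O(\varepsilon)$, which fits the weight because $1\le\langle\xi\rangle\langle\xi\rangle^{-1/2}$. -/
theorem cls_one_sub_cut {χ : RN d × RN d → ℂ} (hχ : ContDiff ℝ ∞ χ) (hc : HasCompactSupport χ)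
    (h1 : χ 0 = 1) :
    Cls (fun (ε : Eps) (v : V3 d) => (ε : ℝ) * (jap v.2.2 + ‖v.2.1‖))
      (fun ε v => 1 - cut χ ε v) := by
  refine SymClass.of_fderiv (fun ε => contDiff_const.sub (contDiff_cut hχ ε)) ?_ fun i => ?_
  · obtain ⟨L, hL⟩ := (hχ.of_le (by simp)).lipschitzWith_of_hasCompactSupport hc one_ne_zero
    refine ⟨L, fun ε v => ?_⟩
    have h2 := hL.norm_sub_le 0 ((ε : ℝ) • v.2)
    rw [h1, zero_sub, norm_neg, norm_smul, Real.norm_of_nonneg ε.2.1.le] at h2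
    refine h2.trans (mul_le_mul_of_nonneg_left (mul_le_mul_of_nonneg_left ?_ ε.2.1.le) L.2)
    refine max_le ?_ ?_
    · linarith [jap_pos v.2.2]
    · linarith [norm_le_jap v.2.2, norm_nonneg v.2.1]
  · have hε : Cls (fun (ε : Eps) (_ : V3 d) => (ε : ℝ)) (fun ε _ => ((ε : ℝ) : ℂ)) :=
      SymClass.const scale_nonneg (fun ε _ => ε.2.1.le) _ ⟨1, fun ε v => by
        rw [one_mul, Complex.norm_real, Real.norm_of_nonneg ε.2.1.le]⟩
    have h2 := (hε.mul (cls_cut_one (contDiff_fderiv_apply_const hχ (dir i).2)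
      (hasCompactSupport_fderiv_apply hc (dir i).2))).neg
    refine (h2.mono scale_nonneg (fun ε v => by simpa using ε.2.1.le) 1 fun ε v => ?_).congr
      (fun _ _ => rfl) fun ε v => ?_
    · rw [mul_one, one_mul, mul_assoc]
      refine le_mul_of_one_le_right ε.2.1.le ?_
      calc (1 : ℝ) ≤ jap v.2.2 * jap v.2.2 ^ (-1 / 2 : ℝ) := by
            nth_rw 1 [← Real.rpow_one (jap v.2.2)]
            rw [← Real.rpow_add (jap_pos _)]
            exact Real.one_le_rpow (one_le_jap _) (by norm_num)
        _ ≤ (jap v.2.2 + ‖v.2.1‖) * scale i v :=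
            mul_le_mul (by linarith [norm_nonneg v.2.1]) (scale_ge i v)
              (Real.rpow_nonneg (jap_pos _).le _) (by linarith [norm_nonneg v.2.1, jap_pos v.2.2])
    · rw [fderiv_const_sub, FunLike.coe_neg, Pi.neg_apply, fderiv_cut hχ]

/-! ### Removal of the cut-offs, with rates of convergence -/

variable {X : AdaptedFrame 𝒟} {m n : ℝ} {g : V3 d → ℂ}

theorem Ampl.smooth (hg : Ampl X m n g) : ContDiff ℝ ∞ g := by
  obtain ⟨k, hk⟩ := hg
  exact hk.smooth ()

theorem osc_cut_bound (hg : Ampl X m n g) {ψ : RN d × RN d → ℂ} (hψ : ContDiff ℝ ∞ ψ)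
    (hc : HasCompactSupport ψ) :
    ∃ C, 0 ≤ C ∧ ∀ (ε : Eps) (x ξ : RN d),
      ‖osc (fun v => cut ψ ε v * g v) x ξ‖ ≤ C * symW X m n x ξ := by
  obtain ⟨k, hk⟩ := hg
  obtain ⟨C₁, -, hC₁⟩ := exists_ampW_le X m n k
  obtain ⟨C, hC0, hC⟩ := osc_bound (P := Eps × RN d)
    (((cls_cut_one hψ hc).comp_param Prod.fst).mul (hk.comp_param fun _ => ()))
    (fun p => adm_cut hψ hc p.1.2.1.ne' (hk.smooth ()))
    (fun p v => by rw [one_mul]; exact (ampW_pos X m n k v).le) Prod.snd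
    (W := fun p x => symW X m n x p.2) (fun p x => (symW_pos X m n x p.2).le)
    (|m| + |n| + k) ⟨C₁, fun p v => by rw [one_mul]; exact hC₁ p.2 v⟩
  exact ⟨C, hC0, fun ε x ξ => hC (ε, ξ) x⟩

theorem osc_sub {u u' : V3 d → ℂ} (hu : Adm u) (hu' : Adm u') (x ξ : RN d) :
    osc (fun v => u v - u' v) x ξ = osc u x ξ - osc u' x ξ := by
  have := osc_add hu (hu'.const_mul (-1)) x ξ
  rw [osc_const_mul] at this
  simpa [sub_eq_add_neg] using this

/-- The growth of $1-\chi(\varepsilon y,\varepsilon\eta)$ is absorbed by one order of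
$\langle\eta\rangle$, one power of the off-diagonal factor, and $1+|x|$, using $|y|\le|x|+|x-y|$. -/
theorem jap_add_norm_le (v : V3 d) :
    jap v.2.2 + ‖v.2.1‖ ≤
      2 * ((1 + ‖v.1‖) * (jap v.2.2 * (1 + jap v.2.2 * ‖v.1 - v.2.1‖ ^ 2))) := by
  have h1 := one_le_jap v.2.2
  have h2 : ‖v.2.1‖ ≤ ‖v.1‖ + ‖v.1 - v.2.1‖ := by
    calc ‖v.2.1‖ = ‖v.1 - (v.1 - v.2.1)‖ := by congr 1; abel
      _ ≤ _ := norm_sub_le _ _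
  set J := jap v.2.2
  set r := ‖v.1 - v.2.1‖
  have hr : 0 ≤ r := norm_nonneg _
  have ha : 0 ≤ ‖v.1‖ := norm_nonneg _
  have h3 : r ≤ 1 + J * r ^ 2 := by nlinarith [sq_nonneg (r - 1)]
  have h4 : 1 ≤ 1 + J * r ^ 2 := by nlinarith [sq_nonneg r]
  have h5 : 1 + J * r ^ 2 ≤ J * (1 + J * r ^ 2) := le_mul_of_one_le_left (by linarith) h1
  have h6 : J ≤ J * (1 + J * r ^ 2) := le_mul_of_one_le_right (by linarith) h4
  have h7 : ‖v.1‖ * 1 ≤ ‖v.1‖ * (J * (1 + J * r ^ 2)) :=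
    mul_le_mul_of_nonneg_left (by linarith) ha
  nlinarith

/-- The difference of the cut-offs is $(1-\chi')-(1-\chi)$, small like $\varepsilon+\varepsilon'$ at
the price of one order in `m`. Allowing two different cut-offs gives at once the Cauchy property and
independence of the choice. -/
theorem osc_cut_sub_bound (hg : Ampl X m n g) {χ χ' : RN d × RN d → ℂ} (hχ : ContDiff ℝ ∞ χ)
    (hc : HasCompactSupport χ) (h1 : χ 0 = 1) (hχ' : ContDiff ℝ ∞ χ')
    (hc' : HasCompactSupport χ') (h1' : χ' 0 = 1) :
    ∃ C, 0 ≤ C ∧ ∀ (ε ε' : Eps) (x ξ : RN d),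
      ‖osc (fun v => cut χ ε v * g v) x ξ - osc (fun v => cut χ' ε' v * g v) x ξ‖ ≤
        C * (((ε : ℝ) + ε') * ((1 + ‖x‖) * symW X (m + 1) n x ξ)) := by
  obtain ⟨k, hk⟩ := hg
  obtain ⟨C₁, hC₁0, hC₁⟩ := exists_ampW_le X (m + 1) n (k + 1)
  have hJy : ∀ v : V3 d, 0 ≤ jap v.2.2 + ‖v.2.1‖ := fun v => by
    linarith [jap_pos v.2.2, norm_nonneg v.2.1]
  have hd : Cls (fun (p : Eps × Eps) (v : V3 d) => ((p.1 : ℝ) + p.2) * (jap v.2.2 + ‖v.2.1‖))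
      (fun p v => cut χ p.1 v - cut χ' p.2 v) := by
    have ha := ((cls_one_sub_cut hχ hc h1).comp_param (Prod.fst : Eps × Eps → Eps)).mono
      (w₂ := fun (p : Eps × Eps) (v : V3 d) => ((p.1 : ℝ) + p.2) * (jap v.2.2 + ‖v.2.1‖))
      scale_nonneg (fun p v => mul_nonneg p.1.2.1.le (hJy v)) 1 fun p v => by
        rw [one_mul]
        exact mul_le_mul_of_nonneg_right (by linarith [p.2.2.1]) (hJy v)
    have hb := ((cls_one_sub_cut hχ' hc' h1').comp_param (Prod.snd : Eps × Eps → Eps)).mono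
      (w₂ := fun (p : Eps × Eps) (v : V3 d) => ((p.1 : ℝ) + p.2) * (jap v.2.2 + ‖v.2.1‖))
      scale_nonneg (fun p v => mul_nonneg p.2.2.1.le (hJy v)) 1 fun p v => by
        rw [one_mul]
        exact mul_le_mul_of_nonneg_right (by linarith [p.1.2.1]) (hJy v)
    exact (hb.sub ha).congr (fun _ _ => rfl) fun p v => by ring
  have hadm := fun (p : (Eps × Eps) × RN d) => adm_cut hχ hc p.1.1.2.1.ne' (hk.smooth ())
  have hadm' := fun (p : (Eps × Eps) × RN d) => adm_cut hχ' hc' p.1.2.2.1.ne' (hk.smooth ())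
  have hε : ∀ p : (Eps × Eps) × RN d, 0 ≤ (p.1.1 : ℝ) + p.1.2 := fun p =>
    add_nonneg p.1.1.2.1.le p.1.2.2.1.le
  have hle : ∀ (p : (Eps × Eps) × RN d) (v : V3 d),
      ((p.1.1 : ℝ) + p.1.2) * (jap v.2.2 + ‖v.2.1‖) * ampW X m n k v ≤
        2 * C₁ * (((p.1.1 : ℝ) + p.1.2) * ((1 + ‖v.1‖) * symW X (m + 1) n v.1 p.2) *
          osq p.2 v ^ (|m + 1| + |n| + (k + 1 : ℕ))) := fun p v => by
    have h2 := jap_add_norm_le v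
    have h3 := hC₁ p.2 v
    have h4 : ampW X (m + 1) n (k + 1) v =
        (jap v.2.2 * (1 + jap v.2.2 * ‖v.1 - v.2.1‖ ^ 2)) * ampW X m n k v := by
      rw [ampW, ampW, Real.rpow_add_one (jap_pos _).ne', pow_succ]; ring
    calc ((p.1.1 : ℝ) + p.1.2) * (jap v.2.2 + ‖v.2.1‖) * ampW X m n k v
        ≤ ((p.1.1 : ℝ) + p.1.2) *
          (2 * ((1 + ‖v.1‖) * (jap v.2.2 * (1 + jap v.2.2 * ‖v.1 - v.2.1‖ ^ 2)))) *
          ampW X m n k v :=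
          mul_le_mul_of_nonneg_right (mul_le_mul_of_nonneg_left h2 (hε p)) (ampW_pos _ _ _ _ _).le
      _ = (((p.1.1 : ℝ) + p.1.2) * (2 * (1 + ‖v.1‖))) * ampW X (m + 1) n (k + 1) v := by
          rw [h4]; ring
      _ ≤ (((p.1.1 : ℝ) + p.1.2) * (2 * (1 + ‖v.1‖))) *
          (C₁ * (symW X (m + 1) n v.1 p.2 * osq p.2 v ^ (|m + 1| + |n| + (k + 1 : ℕ)))) :=
          mul_le_mul_of_nonneg_left h3 (mul_nonneg (hε p) (by positivity))
      _ = _ := by ring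
  obtain ⟨C, hC0, hC⟩ := osc_bound (P := (Eps × Eps) × RN d)
    ((hd.comp_param Prod.fst).mul (hk.comp_param fun _ => ()))
    (fun p => by
      have := (hadm p).add ((hadm' p).const_mul (-1))
      convert this using 2
      ring)
    (fun p v => mul_nonneg (mul_nonneg (hε p) (hJy v)) (ampW_pos X m n k v).le) Prod.snd
    (W := fun p x => ((p.1.1 : ℝ) + p.1.2) * ((1 + ‖x‖) * symW X (m + 1) n x p.2))
    (fun p x => mul_nonneg (hε p) (mul_nonneg (by positivity) (symW_pos X _ _ x p.2).le))
    (|m + 1| + |n| + (k + 1 : ℕ)) ⟨2 * C₁, hle⟩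
  refine ⟨C, hC0, fun ε ε' x ξ => ?_⟩
  have h := hC ((ε, ε'), ξ) x
  rw [← osc_sub (hadm ((ε, ε'), ξ)) (hadm' ((ε, ε'), ξ))]
  simpa only [sub_mul] using h

/-- A smooth cut-off equal to `1` near the origin. -/
def stdCut (t : RN d × RN d) : ℂ := (((default : ContDiffBump (0 : RN d × RN d)) t : ℝ) : ℂ)

theorem contDiff_stdCut : ContDiff ℝ ∞ (stdCut (d := d)) :=
  Complex.ofRealCLM.contDiff.comp (default : ContDiffBump (0 : RN d × RN d)).contDiff

theorem hasCompactSupport_stdCut : HasCompactSupport (stdCut (d := d)) :=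
  (default : ContDiffBump (0 : RN d × RN d)).hasCompactSupport.comp_left
    (g := fun r : ℝ => (r : ℂ)) Complex.ofReal_zero

theorem stdCut_zero : stdCut (0 : RN d × RN d) = 1 := by
  have : (default : ContDiffBump (0 : RN d × RN d)) 0 = 1 :=
    (default : ContDiffBump (0 : RN d × RN d)).one_of_mem_closedBall
      (Metric.mem_closedBall_self (default : ContDiffBump (0 : RN d × RN d)).rIn_pos.le)
  simp [stdCut, this]

/-- The symbol `∫∫ g(x, y, η) e^{2πi (x-y)·(η-ξ)} dy dη` defined by an amplitude, as an oscillatory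
integral. -/
def ampSymbol (g : V3 d → ℂ) (x ξ : RN d) : ℂ :=
  limUnder (𝓝[>] (0 : ℝ)) fun ε => osc (fun v => cut stdCut ε v * g v) x ξ

theorem eventually_eps {p : ℝ → Prop} (h : ∀ ε : Eps, p ε) : ∀ᶠ ε in 𝓝[>] (0 : ℝ), p ε := by
  filter_upwards [Ioc_mem_nhdsGT (zero_lt_one' ℝ)] with ε hε using h ⟨ε, hε⟩

theorem tendsto_ampSymbol_std (hg : Ampl X m n g) (x ξ : RN d) :
    Tendsto (fun ε => osc (fun v => cut stdCut ε v * g v) x ξ) (𝓝[>] (0 : ℝ))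
      (𝓝 (ampSymbol g x ξ)) := by
  obtain ⟨C, hC0, hC⟩ := osc_cut_sub_bound hg contDiff_stdCut hasCompactSupport_stdCut stdCut_zero
    contDiff_stdCut hasCompactSupport_stdCut stdCut_zero
  refine tendsto_nhds_limUnder (cauchy_map_iff_exists_tendsto.1 (Metric.cauchy_iff.2
    ⟨inferInstance, fun δ hδ => ?_⟩))
  set B := C * ((1 + ‖x‖) * symW X (m + 1) n x ξ) with hB
  have hB0 : 0 ≤ B := mul_nonneg hC0 (mul_nonneg (by positivity) (symW_pos _ _ _ _ _).le)
  -- Both parameters being at most $\delta/(4(B+1))$ makes $(\varepsilon+\varepsilon')B<\delta$; the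
  -- summand 1 covers $B=0$.
  set ε₀ := min 1 (δ / (4 * (B + 1))) with hε₀
  have hε₀0 : 0 < ε₀ := lt_min one_pos (by positivity)
  refine ⟨_, image_mem_map (Ioc_mem_nhdsGT hε₀0), ?_⟩
  rintro _ ⟨ε, hε, rfl⟩ _ ⟨ε', hε', rfl⟩
  rw [dist_eq_norm]
  refine (hC ⟨ε, hε.1, hε.2.trans (min_le_left _ _)⟩
    ⟨ε', hε'.1, hε'.2.trans (min_le_left _ _)⟩ x ξ).trans_lt ?_
  have h1 : ε ≤ δ / (4 * (B + 1)) := hε.2.trans (min_le_right _ _)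
  have h2 : ε' ≤ δ / (4 * (B + 1)) := hε'.2.trans (min_le_right _ _)
  rw [le_div_iff₀ (by positivity)] at h1 h2
  calc C * ((ε + ε') * ((1 + ‖x‖) * symW X (m + 1) n x ξ)) = (ε + ε') * B := by rw [hB]; ring
    _ < δ := by nlinarith [hε.1, hε'.1]

/-- Let $\varepsilon'\to0$ in `osc_cut_sub_bound`, with the second cut-off equal to `stdCut`. -/
theorem ampSymbol_rate (hg : Ampl X m n g) {χ : RN d × RN d → ℂ} (hχ : ContDiff ℝ ∞ χ)
    (hc : HasCompactSupport χ) (h1 : χ 0 = 1) :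
    ∃ C, 0 ≤ C ∧ ∀ (ε : Eps) (x ξ : RN d),
      ‖osc (fun v => cut χ ε v * g v) x ξ - ampSymbol g x ξ‖ ≤
        C * ((ε : ℝ) * ((1 + ‖x‖) * symW X (m + 1) n x ξ)) := by
  obtain ⟨C, hC0, hC⟩ := osc_cut_sub_bound hg hχ hc h1 contDiff_stdCut hasCompactSupport_stdCut
    stdCut_zero
  refine ⟨C, hC0, fun ε x ξ => ?_⟩
  have h2 : Tendsto (fun ε' : ℝ => C * (((ε : ℝ) + ε') * ((1 + ‖x‖) * symW X (m + 1) n x ξ)))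
      (𝓝[>] 0) (𝓝 (C * (((ε : ℝ) + 0) * ((1 + ‖x‖) * symW X (m + 1) n x ξ)))) :=
    ((tendsto_const_nhds.add (tendsto_id.mono_left nhdsWithin_le_nhds)).mul_const _).const_mul _
  rw [add_zero] at h2
  exact le_of_tendsto_of_tendsto ((tendsto_const_nhds.sub (tendsto_ampSymbol_std hg x ξ)).norm) h2
    (eventually_eps fun ε' => hC ε ε' x ξ)

theorem ampSymbol_bound (hg : Ampl X m n g) :
    ∃ C, 0 ≤ C ∧ ∀ x ξ : RN d, ‖ampSymbol g x ξ‖ ≤ C * symW X m n x ξ := by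
  obtain ⟨C, hC0, hC⟩ := osc_cut_bound hg contDiff_stdCut hasCompactSupport_stdCut
  exact ⟨C, hC0, fun x ξ => le_of_tendsto (tendsto_ampSymbol_std hg x ξ).norm
    (eventually_eps fun ε => hC ε x ξ)⟩

end Cutoffs

/-! ### Operations on amplitudes -/

section AmplAlgebra

variable {d : ℕ} {𝒟 : RN d → Submodule ℝ (RN d)} {X : AdaptedFrame 𝒟} {m n m' n' : ℝ}
  {g g' : V3 d → ℂ}

theorem ampW_mono {k k' : ℕ} (hm : m ≤ m') (hk : k ≤ k') (v : V3 d) :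
    ampW X m n k v ≤ ampW X m' n k' v := by
  have h1 := Real.rpow_le_rpow_of_exponent_le (one_le_jap v.2.2) hm
  have h2 := pow_le_pow_right₀ (one_le_off v) hk
  have h3 := Real.rpow_nonneg (lam_pos X v.1 v.2.2).le n
  have h4 := Real.rpow_nonneg (jap_pos v.2.2).le m'
  have h5 := one_le_off v
  unfold ampW
  gcongr

theorem Ampl.cls_of_le {k : ℕ} (h : Cls (fun _ : Unit => ampW X m n k) (fun _ => g)) {k' : ℕ}
    (hk : k ≤ k') : Cls (fun _ : Unit => ampW X m n k') (fun _ => g) :=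
  h.mono scale_nonneg (fun _ v => (ampW_pos X m n k v).le) 1 fun _ v => by
    rw [one_mul]; exact ampW_mono le_rfl hk v

theorem Ampl.of_le (h : Ampl X m n g) (hm : m ≤ m') : Ampl X m' n g := by
  obtain ⟨k, hk⟩ := h
  exact ⟨k, hk.mono scale_nonneg (fun _ v => (ampW_pos X m n k v).le) 1 fun _ v => by
    rw [one_mul]; exact ampW_mono hm le_rfl v⟩

/-- Half an order of `⟨ξ⟩` is worth at most one order of `1 + ρ_x(ξ) + |ξ|^{1/2}`. -/
theorem Ampl.trade (h : Ampl X (m + 1 / 2) (n - 1) g) : Ampl X m n g := by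
  obtain ⟨k, hk⟩ := h
  refine ⟨k, hk.mono scale_nonneg (fun _ v => (ampW_pos X _ _ k v).le) 1 fun _ v => ?_⟩
  rw [one_mul, ampW, ampW, Real.rpow_add (jap_pos _), Real.rpow_sub_one (lam_pos _ _ _).ne']
  refine mul_le_mul_of_nonneg_right ?_ (pow_nonneg (by linarith [one_le_off v]) _)
  rw [mul_assoc]
  refine mul_le_mul_of_nonneg_left ?_ (Real.rpow_nonneg (jap_pos _).le _)
  rw [← mul_div_assoc, div_le_iff₀ (lam_pos _ _ _), mul_comm]
  exact mul_le_mul_of_nonneg_left (sqrt_jap_le_lam X _ _) (Real.rpow_nonneg (lam_pos _ _ _).le _)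

theorem Ampl.add (h : Ampl X m n g) (h' : Ampl X m n g') : Ampl X m n (fun v => g v + g' v) := by
  obtain ⟨k, hk⟩ := h
  obtain ⟨k', hk'⟩ := h'
  exact ⟨max k k', (Ampl.cls_of_le hk (le_max_left _ _)).add
    (Ampl.cls_of_le hk' (le_max_right _ _))⟩

theorem Ampl.zero : Ampl X m n (fun _ => 0) :=
  ⟨0, SymClass.zero scale_nonneg fun _ v => (ampW_pos X m n 0 v).le⟩

theorem Ampl.sum {κ : Type*} (S : Finset κ) {f : κ → V3 d → ℂ} (h : ∀ j ∈ S, Ampl X m n (f j)) :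
    Ampl X m n (fun v => ∑ j ∈ S, f j v) := by
  classical
  induction S using Finset.induction_on with
  | empty => simpa using Ampl.zero
  | insert a S ha ih =>
    simp only [Finset.sum_insert ha]
    exact (h a (Finset.mem_insert_self a S)).add
      (ih fun j hj => h j (Finset.mem_insert_of_mem hj))

theorem Ampl.const_mul (h : Ampl X m n g) (a : ℂ) : Ampl X m n (fun v => a * g v) := by
  obtain ⟨k, hk⟩ := h
  exact ⟨k, hk.clm (a • ContinuousLinearMap.id ℝ ℂ)⟩

theorem Ampl.fderiv_xi (h : Ampl X m n g) (j : Fin (d + 1)) :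
    Ampl X (m - 1 / 2) n (fun v => fderiv ℝ g v (dir (.inr (.inr j)))) := by
  obtain ⟨k, hk⟩ := h
  refine ⟨k, (hk.fderiv_apply (.inr (.inr j))).congr (fun _ v => ?_) fun _ _ => rfl⟩
  rw [ampW, ampW, show m - 1 / 2 = m + -1 / 2 by ring, Real.rpow_add (jap_pos _), scale]
  ring

theorem Ampl.fderiv_x (h : Ampl X m n g) (j : Fin (d + 1)) :
    Ampl X (m + 1 / 2) n (fun v => fderiv ℝ g v (dir (.inl j))) := by
  obtain ⟨k, hk⟩ := h
  refine ⟨k, (hk.fderiv_apply (.inl j)).congr (fun _ v => ?_) fun _ _ => rfl⟩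
  rw [ampW, ampW, Real.rpow_add (jap_pos _), scale]
  ring

theorem Ampl.fderiv_y (h : Ampl X m n g) (j : Fin (d + 1)) :
    Ampl X (m + 1 / 2) n (fun v => fderiv ℝ g v (dir (.inr (.inl j)))) := by
  obtain ⟨k, hk⟩ := h
  refine ⟨k, (hk.fderiv_apply (.inr (.inl j))).congr (fun _ v => ?_) fun _ _ => rfl⟩
  rw [ampW, ampW, Real.rpow_add (jap_pos _), scale]
  ring

/-- The coordinates of a vector of `V3 d`. -/
def coord : Dir d → V3 d → ℝ
  | .inl i, a => a.1 i
  | .inr (.inl i), a => a.2.1 i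
  | .inr (.inr i), a => a.2.2 i

theorem sum_smul_single (x : RN d) : ∑ i, x i • (EuclideanSpace.single i 1 : RN d) = x := by
  ext j
  simp [Finset.sum_apply, Pi.single_apply]

theorem sum_coord_smul_dir (a : V3 d) : ∑ i, coord i a • dir i = a := by
  rw [Fintype.sum_sum_type, Fintype.sum_sum_type]
  refine Prod.ext ?_ (Prod.ext ?_ ?_)
  · simp [coord, dir, Prod.fst_sum, sum_smul_single]
  · simp [coord, dir, Prod.fst_sum, Prod.snd_sum, sum_smul_single]
  · simp [coord, dir, Prod.snd_sum, sum_smul_single]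

theorem Ampl.fderiv_apply (h : Ampl X m n g) (a : V3 d) :
    Ampl X (m + 1 / 2) n (fun v => fderiv ℝ g v a) := by
  have e : (fun v => fderiv ℝ g v a) = fun v => ∑ i, (coord i a : ℂ) * fderiv ℝ g v (dir i) := by
    funext v
    conv_lhs => rw [← sum_coord_smul_dir a]
    simp
  rw [e]
  refine Ampl.sum _ fun i _ => Ampl.const_mul ?_ _
  rcases i with i | i | i
  · exact h.fderiv_x i
  · exact h.fderiv_y i
  · exact (h.fderiv_xi i).of_le (by linarith)

theorem Ampl.xi_mul (h : Ampl X m n g) (j : Fin (d + 1)) :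
    Ampl X (m + 1) n (fun v => (v.2.2 j : ℂ) * g v) := by
  obtain ⟨k, hk⟩ := h
  have h1 := cls_xi (P := Unit) (w := fun _ v => jap v.2.2) j (fun _ => 0)
    ⟨1, fun p v => by simpa using (abs_apply_le_norm v.2.2 j).trans (norm_le_jap v.2.2)⟩
    (fun p v => by
      simpa using Real.rpow_le_rpow_of_exponent_le (one_le_jap v.2.2) (by norm_num : (1/2:ℝ) ≤ 1))
  refine ⟨k, (h1.ofReal.mul hk).congr (fun _ v => ?_) fun _ v => by simp⟩
  rw [ampW, ampW, Real.rpow_add_one (jap_pos _).ne']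
  ring

/-- $|x-y|\le\langle\eta\rangle^{-1/2}(1+\langle\eta\rangle|x-y|^2)$: half an order is gained by
raising the off-diagonal exponent by one. This is one reason why `Ampl` leaves that exponent free.
-/
theorem Ampl.xy_mul (h : Ampl X m n g) (j : Fin (d + 1)) :
    Ampl X (m - 1 / 2) n (fun v => ((v.1 j - v.2.1 j : ℝ) : ℂ) * g v) := by
  obtain ⟨k, hk⟩ := h
  have h1 := cls_xy (P := Unit) (w := fun _ v => jap v.2.2 ^ (-1 / 2 : ℝ) *
    (1 + jap v.2.2 * ‖v.1 - v.2.1‖ ^ 2)) j ⟨1, fun _ v => ?_⟩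
    fun _ v => le_mul_of_one_le_right (Real.rpow_nonneg (jap_pos _).le _) (one_le_off v)
  · refine ⟨k + 1, (h1.ofReal.mul hk).congr (fun _ v => ?_) fun _ v => rfl⟩
    rw [ampW, ampW, show m - 1 / 2 = -1 / 2 + m by ring, Real.rpow_add (jap_pos _), pow_succ]
    ring
  · rw [one_mul]
    refine (abs_apply_le_norm (v.1 - v.2.1) j).trans ?_
    have h2 := sqrt_jap_sq v.2.2
    have h3 := inv_sqrt_jap_mul v.2.2
    set r := ‖v.1 - v.2.1‖
    set s := jap v.2.2 ^ (1 / 2 : ℝ)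
    have h4 : s * r ≤ 1 + jap v.2.2 * r ^ 2 := by
      rw [← h2]; nlinarith [sq_nonneg (s * r - 1)]
    calc r = jap v.2.2 ^ (-1 / 2 : ℝ) * (s * r) := by rw [← mul_assoc, h3, one_mul]
      _ ≤ _ := mul_le_mul_of_nonneg_left h4 (Real.rpow_nonneg (jap_pos _).le _)

/-! ### Bounded smooth coefficients and the inverse of the frame matrix -/

/-- Real functions of `x` with bounded derivatives of all orders. -/
def BddSmooth (b : RN d → ℝ) : Prop :=
  SymClass (fun i : Fin (d + 1) => (EuclideanSpace.single i 1 : RN d)) (fun _ _ => 1)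
    (fun (_ : Unit) _ => 1) (fun _ => b)

/-- An $x$-derivative may cost $\langle\xi\rangle^{1/2}\ge1$, and bounded coefficients cost less. -/
theorem BddSmooth.cls {b : RN d → ℝ} (hb : BddSmooth b) :
    Cls (fun (_ : Unit) (_ : V3 d) => 1) (fun _ v => b v.1) := by
  have hd : ∀ b : RN d → ℝ, ContDiff ℝ ∞ b → ∀ v a : V3 d,
      fderiv ℝ (fun v : V3 d => b v.1) v a = fderiv ℝ b v.1 a.1 := fun b hb v a => by
    have := ((hb.differentiable (by simp) v.1).hasFDerivAt.comp v
      (ContinuousLinearMap.fst ℝ (RN d) (RN d × RN d)).hasFDerivAt).fderiv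
    change fderiv ℝ (fun v : V3 d => b v.1) v = _ at this
    rw [this]
    simp
  refine ⟨fun _ => (hb.smooth ()).comp contDiff_fst, fun k => ?_⟩
  induction k generalizing b with
  | zero =>
    obtain ⟨C, -, hC⟩ := (hb.bound 0).zeroth
    exact ⟨C, fun p v => hC p v.1 zero_le_one⟩
  | succ k ih =>
    obtain ⟨C, -, hC⟩ := (hb.bound 0).zeroth
    refine ⟨⟨C, fun p v => hC p v.1 zero_le_one⟩, fun i => ?_⟩
    simp only [hd b (hb.smooth ())]
    rcases i with i | i | i
    · have h1 : BddSmooth (fun x => fderiv ℝ b x (EuclideanSpace.single i 1)) :=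
        (hb.fderiv_apply i).congr (fun _ _ => one_mul _) fun _ _ => rfl
      exact (ih h1).mono scale_nonneg (fun _ _ => zero_le_one) (K := 1) fun _ v => by
        simpa [scale] using one_le_sqrt_jap v.2.2
    · simpa [dir] using SymBound.zero (P := Unit) (F := ℝ)
        (fun p v => mul_nonneg zero_le_one (scale_nonneg _ v)) scale_nonneg
    · simpa [dir] using SymBound.zero (P := Unit) (F := ℝ)
        (fun p v => mul_nonneg zero_le_one (scale_nonneg _ v)) scale_nonneg

theorem Ampl.fn_mul (h : Ampl X m n g) {b : RN d → ℝ} (hb : BddSmooth b) :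
    Ampl X m n (fun v => (b v.1 : ℂ) * g v) := by
  obtain ⟨k, hk⟩ := h
  exact ⟨k, (hb.cls.ofReal.mul hk).congr (fun _ _ => one_mul _) fun _ _ => rfl⟩

theorem BddSmooth.mul {b b' : RN d → ℝ} (hb : BddSmooth b) (hb' : BddSmooth b') :
    BddSmooth (fun x => b x * b' x) :=
  (SymClass.mul hb hb').congr (fun _ _ => one_mul _) fun _ _ => rfl

theorem BddSmooth.const (a : ℝ) : BddSmooth (fun _ : RN d => a) :=
  SymClass.const (fun _ _ => zero_le_one) (fun _ _ => zero_le_one) (fun _ => a)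
    ⟨‖a‖, fun _ _ => by simp⟩

theorem BddSmooth.neg {b : RN d → ℝ} (hb : BddSmooth b) : BddSmooth (fun x => -b x) :=
  SymClass.neg hb

theorem BddSmooth.sum {κ : Type*} (S : Finset κ) {b : κ → RN d → ℝ} (hb : ∀ j ∈ S, BddSmooth (b j)) :
    BddSmooth (fun x => ∑ j ∈ S, b j x) :=
  SymClass.sum (fun _ _ => zero_le_one) (fun _ _ => zero_le_one) S hb

theorem BddSmooth.prod {κ : Type*} (S : Finset κ) {b : κ → RN d → ℝ}
    (hb : ∀ j ∈ S, BddSmooth (b j)) : BddSmooth (fun x => ∏ j ∈ S, b j x) := by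
  classical
  induction S using Finset.induction_on with
  | empty => simpa using BddSmooth.const 1
  | insert a S ha ih =>
    simp only [Finset.prod_insert ha]
    exact (hb a (Finset.mem_insert_self a S)).mul
      (ih fun j hj => hb j (Finset.mem_insert_of_mem hj))

theorem BddSmooth.pd {b : RN d → ℝ} (hb : BddSmooth b) (i : Fin (d + 1)) : BddSmooth (pd i b) :=
  (hb.fderiv_apply i).congr (fun _ _ => one_mul _) fun _ _ => rfl

/-- Since `b` may be negative, write $1/b=b\cdot(b^2)^{-1}$. The positive function $b^2\ge c^2$ is
controlled by itself, so `SymClass.rpow` applies to it. -/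
theorem BddSmooth.inv {b : RN d → ℝ} (hb : BddSmooth b) {c : ℝ} (hc : 0 < c)
    (h : ∀ x, c ≤ |b x|) : BddSmooth (fun x => (b x)⁻¹) := by
  have hsq : ∀ x, c ^ 2 ≤ b x * b x := fun x => by
    rw [← sq, ← sq_abs (b x)]
    exact pow_le_pow_left₀ hc.le (h x) 2
  have hpos : ∀ x, 0 < b x * b x := fun x => (pow_pos hc 2).trans_le (hsq x)
  have h1 : SymClass (fun i : Fin (d + 1) => (EuclideanSpace.single i 1 : RN d)) (fun _ _ => 1)
      (fun (_ : Unit) x => b x * b x) (fun _ x => b x * b x) :=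
    (hb.mul hb).mono (fun _ _ => zero_le_one) (fun _ _ => zero_le_one) (c ^ 2)⁻¹ fun _ x => by
      rw [inv_mul_eq_div, one_le_div (pow_pos hc 2)]
      exact hsq x
  have h2 := h1.rpow (fun _ x => hpos x) (-1)
  have h3 : BddSmooth (fun x => (b x * b x) ^ (-1 : ℝ)) :=
    h2.mono (fun _ _ => zero_le_one) (fun _ x => Real.rpow_nonneg (hpos x).le _) (c ^ 2)⁻¹
      fun _ x => by
        rw [Real.rpow_neg_one, mul_one]
        exact inv_anti₀ (pow_pos hc 2) (hsq x)
  refine (hb.mul h3).congr (fun _ _ => rfl) fun _ x => ?_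
  have hb0 : b x ≠ 0 := fun h0 => by simpa [h0] using hpos x
  rw [Real.rpow_neg_one]
  field_simp

theorem BddSmooth.of_ipd {b : RN d → ℝ} (hb : ContDiff ℝ ∞ b)
    (h : ∀ I : List (Fin (d + 1)), ∃ C : ℝ, ∀ x, |ipd I b x| ≤ C) : BddSmooth b := by
  refine ⟨fun _ => hb, fun k => ?_⟩
  have key : ∀ I : List (Fin (d + 1)), SymBound
      (fun i : Fin (d + 1) => (EuclideanSpace.single i 1 : RN d)) (fun _ _ => 1) k
      (fun (_ : Unit) _ => 1) (fun _ => ipd I b) := by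
    induction k with
    | zero => exact fun I => (h I).imp fun C hC _ x => by simpa using hC x
    | succ k ih =>
      refine fun I => ⟨(h I).imp fun C hC _ x => by simpa using hC x, fun i => ?_⟩
      simp only [mul_one]
      exact ih (i :: I)
  exact key []

/-- Cramer's rule: the entries of the inverse are determinants of modified matrices divided by $\det
A$, which stays away from zero. -/
theorem BddSmooth.B (X : AdaptedFrame 𝒟) (j k : Fin (d + 1)) : BddSmooth (fun x => X.B x j k) := by
  have hA : ∀ i j, BddSmooth (fun x => X.A x i j) := fun i j =>
    BddSmooth.of_ipd (X.smooth i j) fun I => X.bounded I i j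
  have hdet : ∀ M : RN d → Matrix (Fin (d + 1)) (Fin (d + 1)) ℝ,
      (∀ i j, BddSmooth (fun x => M x i j)) → BddSmooth (fun x => (M x).det) := fun M hM => by
    simp only [Matrix.det_apply']
    exact BddSmooth.sum _ fun σ _ => (BddSmooth.const _).mul (BddSmooth.prod _ fun i _ => hM _ _)
  obtain ⟨c, hc, h⟩ := X.nondegenerate
  have h1 := (hdet X.A hA).inv hc h
  simp only [AdaptedFrame.B, Matrix.inv_def, Matrix.smul_apply, smul_eq_mul, Ring.inverse_eq_inv']
  refine h1.mul ?_
  simp only [Matrix.adjugate_apply]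
  refine hdet _ fun i l => ?_
  by_cases hi : i = k
  · subst hi
    simpa using BddSmooth.const _
  · simpa [Matrix.updateRow_ne hi] using hA i l

end AmplAlgebra

/-! ### Operations on the symbol of an amplitude -/

section AmpSymbol

open Filter Topology MeasureTheory

variable {d : ℕ} {𝒟 : RN d → Submodule ℝ (RN d)} {X : AdaptedFrame 𝒟} {m n m' n' : ℝ}
  {g g' : V3 d → ℂ}

theorem adm_stdCut (ε : Eps) (hg : ContDiff ℝ ∞ g) : Adm (fun v => cut stdCut ε v * g v) :=
  adm_cut contDiff_stdCut hasCompactSupport_stdCut ε.2.1.ne' hg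

theorem eventually_eps_eq {f f' : ℝ → ℂ} (h : ∀ ε : Eps, f ε = f' ε) :
    f =ᶠ[𝓝[>] (0 : ℝ)] f' := eventually_eps h

theorem ampSymbol_add (hg : Ampl X m n g) (hg' : Ampl X m' n' g') (x ξ : RN d) :
    ampSymbol (fun v => g v + g' v) x ξ = ampSymbol g x ξ + ampSymbol g' x ξ := by
  refine Tendsto.limUnder_eq (((tendsto_ampSymbol_std hg x ξ).add
    (tendsto_ampSymbol_std hg' x ξ)).congr' (eventually_eps_eq fun ε => ?_))
  rw [← osc_add (adm_stdCut ε hg.smooth) (adm_stdCut ε hg'.smooth)]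
  simp only [mul_add]

theorem ampSymbol_fn_mul (hg : Ampl X m n g) (b : RN d → ℂ) (x ξ : RN d) :
    ampSymbol (fun v => b v.1 * g v) x ξ = b x * ampSymbol g x ξ := by
  refine Tendsto.limUnder_eq (((tendsto_ampSymbol_std hg x ξ).const_mul (b x)).congr'
    (eventually_eps_eq fun ε => ?_))
  rw [← osc_mul_left]
  congr 1; funext v; ring

theorem ampSymbol_const_mul (hg : Ampl X m n g) (a : ℂ) (x ξ : RN d) :
    ampSymbol (fun v => a * g v) x ξ = a * ampSymbol g x ξ :=
  ampSymbol_fn_mul hg (fun _ => a) x ξ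

theorem ampSymbol_zero (x ξ : RN d) : ampSymbol (fun _ => 0) x ξ = 0 := by
  refine Tendsto.limUnder_eq (tendsto_const_nhds.congr fun ε => ?_)
  simp [osc]

theorem ampSymbol_sum {κ : Type*} (S : Finset κ) {f : κ → V3 d → ℂ}
    (h : ∀ j ∈ S, Ampl X m n (f j)) (x ξ : RN d) :
    ampSymbol (fun v => ∑ j ∈ S, f j v) x ξ = ∑ j ∈ S, ampSymbol (f j) x ξ := by
  classical
  induction S using Finset.induction_on with
  | empty => simpa using ampSymbol_zero x ξ
  | insert a S ha ih =>
    simp only [Finset.sum_insert ha]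
    rw [ampSymbol_add (h a (Finset.mem_insert_self a S))
      (Ampl.sum S fun j hj => h j (Finset.mem_insert_of_mem hj)),
      ih fun j hj => h j (Finset.mem_insert_of_mem hj)]

/-- The derivative of a regularized amplitude. -/
theorem osc_fderiv_cut (ε : Eps) (hg : ContDiff ℝ ∞ g) (a : V3 d) (x ξ : RN d) :
    osc (fun v => fderiv ℝ (fun v => cut stdCut ε v * g v) v a) x ξ =
      osc (fun v => cut stdCut ε v * fderiv ℝ g v a) x ξ +
        (ε : ℝ) * osc (fun v => cut (fun t => fderiv ℝ stdCut t a.2) ε v * g v) x ξ := by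
  rw [← osc_const_mul, ← osc_add (adm_stdCut ε (contDiff_fderiv_apply_const hg a))
    ((adm_cut (contDiff_fderiv_apply_const contDiff_stdCut a.2)
      (hasCompactSupport_fderiv_apply hasCompactSupport_stdCut a.2) ε.2.1.ne' hg).const_mul _)]
  congr 1
  funext v
  rw [fderiv_fun_mul ((contDiff_cut contDiff_stdCut ε).differentiable (by simp) v)
    (hg.differentiable (by simp) v), add_apply, smul_apply, smul_apply, fderiv_cut contDiff_stdCut]
  simp only [smul_eq_mul]
  ring

theorem exists_symW_le (X : AdaptedFrame 𝒟) (m n : ℝ) :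
    ∃ C M, 0 ≤ C ∧ ∀ x ξ : RN d, symW X m n x ξ ≤ C * jap ξ ^ (M : ℕ) := by
  obtain ⟨C, hC0, hC⟩ := X.exists_rho_le
  have hl : ∀ x ξ, lam X x ξ ≤ (C + 2) * jap ξ := fun x ξ => by
    have h1 := hC x ξ
    have h2 := norm_le_jap ξ
    have h3 : ‖ξ‖ ^ (1 / 2 : ℝ) ≤ jap ξ :=
      (Real.rpow_le_rpow (norm_nonneg _) h2 (by norm_num)).trans
        ((Real.rpow_le_rpow_of_exponent_le (one_le_jap ξ) (by norm_num : (1 / 2 : ℝ) ≤ 1)).trans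
          (Real.rpow_one _).le)
    have h4 := mul_le_mul_of_nonneg_left h2 hC0
    unfold lam
    linarith [one_le_jap ξ]
  obtain ⟨M, hM⟩ := exists_nat_ge (|m| + |n|)
  refine ⟨(C + 2) ^ |n|, M, by positivity, fun x ξ => ?_⟩
  have hJ := one_le_jap ξ
  have h1 : jap ξ ^ m ≤ jap ξ ^ |m| := Real.rpow_le_rpow_of_exponent_le hJ (le_abs_self m)
  have h2 : lam X x ξ ^ n ≤ ((C + 2) * jap ξ) ^ |n| :=
    (Real.rpow_le_rpow_of_exponent_le (one_le_lam X x ξ) (le_abs_self n)).trans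
      (Real.rpow_le_rpow (lam_pos X x ξ).le (hl x ξ) (abs_nonneg n))
  calc symW X m n x ξ ≤ jap ξ ^ |m| * ((C + 2) * jap ξ) ^ |n| :=
        mul_le_mul h1 h2 (Real.rpow_nonneg (lam_pos X x ξ).le _)
          (Real.rpow_nonneg (jap_pos ξ).le _)
    _ = (C + 2) ^ |n| * jap ξ ^ (|m| + |n|) := by
        rw [Real.mul_rpow (by linarith) (jap_pos ξ).le, Real.rpow_add (jap_pos ξ)]; ring
    _ ≤ (C + 2) ^ |n| * jap ξ ^ (M : ℝ) :=
        mul_le_mul_of_nonneg_left (Real.rpow_le_rpow_of_exponent_le hJ hM) (by positivity)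
    _ = _ := by rw [Real.rpow_natCast]

/-- The convergence of the regularizations is locally uniform, and uniform in `ξ` up to polynomial
factors. -/
theorem ampSymbol_rate_poly (hg : Ampl X m n g) {χ : RN d × RN d → ℂ} (hχ : ContDiff ℝ ∞ χ)
    (hc : HasCompactSupport χ) (h1 : χ 0 = 1) :
    ∃ C M, 0 ≤ C ∧ ∀ (ε : Eps) (x ξ : RN d),
      ‖osc (fun v => cut χ ε v * g v) x ξ - ampSymbol g x ξ‖ ≤
        C * ((ε : ℝ) * ((1 + ‖x‖) * jap ξ ^ (M : ℕ))) := by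
  obtain ⟨C, hC0, hC⟩ := ampSymbol_rate hg hχ hc h1
  obtain ⟨C', M, hC'0, hC'⟩ := exists_symW_le X (m + 1) n
  refine ⟨C * C', M, by positivity, fun ε x ξ => (hC ε x ξ).trans ?_⟩
  rw [mul_assoc]
  refine mul_le_mul_of_nonneg_left ?_ hC0
  calc (ε : ℝ) * ((1 + ‖x‖) * symW X (m + 1) n x ξ)
      ≤ (ε : ℝ) * ((1 + ‖x‖) * (C' * jap ξ ^ M)) :=
        mul_le_mul_of_nonneg_left (mul_le_mul_of_nonneg_left (hC' x ξ) (by positivity)) ε.2.1.le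
    _ = _ := by ring

/-- Two errors occur: that of regularizing the differentiated amplitude, and $\varepsilon$ times a
term in which the cut-off is differentiated. The latter is bounded uniformly in $\varepsilon$ by
`osc_cut_bound`. -/
theorem osc_fderiv_cut_rate (hg : Ampl X m n g) (a : V3 d) :
    ∃ C M, 0 ≤ C ∧ ∀ (ε : Eps) (x ξ : RN d),
      ‖osc (fun v => fderiv ℝ (fun v => cut stdCut ε v * g v) v a) x ξ -
        ampSymbol (fun v => fderiv ℝ g v a) x ξ‖ ≤
        C * ((ε : ℝ) * ((1 + ‖x‖) * jap ξ ^ (M : ℕ))) := by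
  obtain ⟨C, M, hC0, hC⟩ := ampSymbol_rate_poly (hg.fderiv_apply a) contDiff_stdCut
    hasCompactSupport_stdCut stdCut_zero
  obtain ⟨C₁, hC₁0, hC₁⟩ := osc_cut_bound hg
    (contDiff_fderiv_apply_const contDiff_stdCut a.2)
    (hasCompactSupport_fderiv_apply hasCompactSupport_stdCut a.2)
  obtain ⟨C₂, M₂, hC₂0, hC₂⟩ := exists_symW_le X m n
  refine ⟨C + C₁ * C₂, max M M₂, by positivity, fun ε x ξ => ?_⟩
  rw [osc_fderiv_cut ε hg.smooth, add_sub_right_comm]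
  refine (norm_add_le _ _).trans ?_
  rw [norm_mul, Complex.norm_real, Real.norm_of_nonneg ε.2.1.le, add_mul]
  have hJ := one_le_jap ξ
  have hε := ε.2.1.le
  have h1 : jap ξ ^ M ≤ jap ξ ^ max M M₂ := pow_le_pow_right₀ hJ (le_max_left _ _)
  have h2 : jap ξ ^ M₂ ≤ jap ξ ^ max M M₂ := pow_le_pow_right₀ hJ (le_max_right _ _)
  have h3 : jap ξ ^ M₂ ≤ (1 + ‖x‖) * jap ξ ^ max M M₂ :=
    h2.trans (le_mul_of_one_le_left (by positivity) (by linarith [norm_nonneg x]))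
  refine add_le_add ((hC ε x ξ).trans (by gcongr)) ?_
  calc (ε : ℝ) * _ ≤ (ε : ℝ) * (C₁ * (C₂ * ((1 + ‖x‖) * jap ξ ^ max M M₂))) := by
        refine mul_le_mul_of_nonneg_left ((hC₁ ε x ξ).trans
          (mul_le_mul_of_nonneg_left ((hC₂ x ξ).trans ?_) hC₁0)) hε
        exact mul_le_mul_of_nonneg_left h3 hC₂0
    _ = _ := by ring

theorem tendsto_of_rate {f : ℝ → ℂ} {z : ℂ} {C : ℝ} (h : ∀ ε : Eps, ‖f ε - z‖ ≤ C * ε) :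
    Tendsto f (𝓝[>] 0) (𝓝 z) := by
  rw [tendsto_iff_norm_sub_tendsto_zero]
  refine squeeze_zero' (g := fun ε : ℝ => C * ε) (Eventually.of_forall fun _ => norm_nonneg _)
    (eventually_eps h) ?_
  have : Tendsto (fun ε : ℝ => C * ε) (𝓝 0) (𝓝 (C * 0)) := tendsto_id.const_mul _
  simpa using this.mono_left nhdsWithin_le_nhds

theorem tendsto_osc_fderiv_cut (hg : Ampl X m n g) (a : V3 d) (x ξ : RN d) :
    Tendsto (fun ε => osc (fun v => fderiv ℝ (fun v => cut stdCut ε v * g v) v a) x ξ)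
      (𝓝[>] (0 : ℝ)) (𝓝 (ampSymbol (fun v => fderiv ℝ g v a) x ξ)) := by
  obtain ⟨C, M, -, hC⟩ := osc_fderiv_cut_rate hg a
  exact tendsto_of_rate (C := C * ((1 + ‖x‖) * jap ξ ^ M)) fun ε =>
    (hC ε x ξ).trans (le_of_eq (by ring))

/-- The factor $\eta_j-\xi_j$ is produced by a $y_j$-derivative of the phase. This converts the
factors $\xi_l$ in $D_i$ acting on symbols. -/
theorem xi_mul_ampSymbol (hg : Ampl X m n g) (j : Fin (d + 1)) (x ξ : RN d) :
    (ξ j : ℂ) * ampSymbol g x ξ = ampSymbol (fun v => (v.2.2 j : ℂ) * g v) x ξ -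
      (2 * Real.pi * Complex.I)⁻¹ *
        ampSymbol (fun v => fderiv ℝ g v (dir (.inr (.inl j)))) x ξ := by
  have hπ : (2 * Real.pi * Complex.I : ℂ) ≠ 0 := by simp [Real.pi_ne_zero]
  have h1 := tendsto_osc_fderiv_cut hg (dir (.inr (.inl j))) x ξ
  have h2 := (((tendsto_ampSymbol_std (hg.xi_mul j) x ξ).sub
    ((tendsto_ampSymbol_std hg x ξ).const_mul (ξ j : ℂ)))).const_mul (2 * Real.pi * Complex.I)
  have h3 := tendsto_nhds_unique h1 (h2.congr' (eventually_eps_eq fun ε => ?_))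
  · rw [h3, ← mul_assoc, inv_mul_cancel₀ hπ]
    ring
  · rw [osc_fderiv_y (adm_stdCut ε hg.smooth), ← osc_const_mul,
      ← osc_sub (adm_stdCut ε (hg.xi_mul j).smooth) ((adm_stdCut ε hg.smooth).const_mul _)]
    congr 2
    funext v
    push_cast
    ring

/-! ### Smoothness of the symbol of an amplitude -/

/-- The kernel `e^{-2πi y·η}`. -/
def oscKernel (t : RN d × RN d) : ℂ :=
  Complex.exp (2 * Real.pi * Complex.I * (-⟪t.1, t.2⟫_ℝ : ℝ))

theorem continuous_oscKernel : Continuous (oscKernel (d := d)) := by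
  unfold oscKernel
  refine Complex.continuous_exp.comp (continuous_const.mul (Complex.continuous_ofReal.comp ?_))
  exact (continuous_fst.inner continuous_snd).neg

/-- The phase is $-(x-y)\cdot(\xi-\eta)$, a function of $(x,\xi)-(y,\eta)$ alone. For frozen $x$ in
the amplitude the integral is therefore a convolution. -/
theorem osc_eq_convolution (u : V3 d → ℂ) (x ξ : RN d) :
    osc u x ξ = (MeasureTheory.convolution oscKernel (fun t => u (x, t))
      (ContinuousLinearMap.mul ℝ ℂ) volume) (x, ξ) := by
  have : (volume : Measure (RN d × RN d)).IsAddHaarMeasure :=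
    Measure.prod.instIsAddHaarMeasure volume volume
  have := Measure.IsAddHaarMeasure.isNegInvariant_of_regular (volume : Measure (RN d × RN d))
  rw [MeasureTheory.convolution_eq_swap, osc]
  congr 1
  funext t
  rw [ContinuousLinearMap.mul_apply', mul_comm, oscKernel, oscPhase]
  congr 4
  simp only [Prod.fst_sub, Prod.snd_sub]
  rw [← inner_neg_right, neg_sub]

/-- The variable $x$ enters twice, as a parameter of the amplitude and as a convolution variable.
Derivatives of the convolution fall on the $(y,\eta)$ slots, so the direction $(a,b)$ in $(x,\xi)$
becomes $(a,a,b)$. -/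
theorem exists_hasFDerivAt_osc {u : V3 d → ℂ} (hu : Adm u) (p : RN d × RN d) :
    ∃ L : RN d × RN d →L[ℝ] ℂ, HasFDerivAt (fun p : RN d × RN d => osc u p.1 p.2) L p ∧
      ∀ a b, L (a, b) = osc (fun v => fderiv ℝ u v (a, a, b)) p.1 p.2 := by
  have : (volume : Measure (RN d × RN d)).IsAddHaarMeasure :=
    Measure.prod.instIsAddHaarMeasure volume volume
  obtain ⟨K, hK, h⟩ := hu.cpt
  have hL := continuous_oscKernel.locallyIntegrable (μ := (volume : Measure (RN d × RN d)))
  have h1 := hasFDerivAt_convolution_right_with_param (μ := volume) (ContinuousLinearMap.mul ℝ ℂ)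
    (g := fun (x : RN d) t => u (x, t)) isOpen_univ hK (fun x t _ ht => h x t ht) hL
    (hu.smooth.of_le (by simp)).contDiffOn (p.1, p) (Set.mem_univ _)
  have h2 : HasFDerivAt (fun p : RN d × RN d => (p.1, p))
      ((ContinuousLinearMap.fst ℝ (RN d) (RN d)).prod (ContinuousLinearMap.id ℝ _)) p :=
    hasFDerivAt_fst.prodMk (hasFDerivAt_id p)
  refine ⟨_, (HasFDerivAt.comp (f := fun p : RN d × RN d => (p.1, p)) p h1 h2).congr_of_eventuallyEq (Eventually.of_forall fun q =>
    osc_eq_convolution u q.1 q.2), fun a b => ?_⟩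
  rw [osc_eq_convolution]
  simp only [ContinuousLinearMap.comp_apply]
  have hcs : HasCompactSupport (fun t => fderiv ℝ u (p.1, t)) := by
    refine HasCompactSupport.intro hK fun t ht => ?_
    have hev : u =ᶠ[nhds (p.1, t)] fun _ => 0 := by
      have : {v : V3 d | v.2 ∉ K} ∈ nhds (p.1, t) :=
        (hK.isClosed.isOpen_compl.preimage continuous_snd).mem_nhds ht
      filter_upwards [this] with v hv
      exact h v.1 v.2 hv
    simp [hev.fderiv_eq]
  exact convolution_precompR_apply (ContinuousLinearMap.mul ℝ ℂ) hL hcs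
    ((hu.smooth.continuous_fderiv (by simp)).comp (by fun_prop)) p (a, a, b)

/-- The derivative of the symbol of an amplitude. -/
theorem hasFDerivAt_ampSymbol (hg : Ampl X m n g) (p : RN d × RN d) :
    ∃ L : RN d × RN d →L[ℝ] ℂ, HasFDerivAt (fun p : RN d × RN d => ampSymbol g p.1 p.2) L p ∧
      ∀ a b, L (a, b) = ampSymbol (fun v => fderiv ℝ g v (a, a, b)) p.1 p.2 := by
  let H : RN d × RN d → (RN d × RN d →L[ℝ] ℂ) := fun p => LinearMap.toContinuousLinearMap
    { toFun := fun a => ampSymbol (fun v => fderiv ℝ g v (a.1, a.1, a.2)) p.1 p.2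
      map_add' := fun a b => by
        rw [← ampSymbol_add (hg.fderiv_apply _) (hg.fderiv_apply _)]
        congr 1; funext v
        rw [← map_add]; rfl
      map_smul' := fun r a => by
        rw [RingHom.id_apply, Complex.real_smul, ← ampSymbol_const_mul (hg.fderiv_apply _)]
        congr 1; funext v
        rw [← Complex.real_smul, ← map_smul]; rfl }
  refine ⟨H p, ?_, fun a b => rfl⟩
  let e : ℕ → Eps := fun k => ⟨1 / ((k : ℝ) + 1), by positivity, by
    rw [div_le_one (by positivity)]; linarith [(Nat.cast_nonneg k : (0 : ℝ) ≤ k)]⟩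
  have he : Tendsto (fun k => ((e k : Eps) : ℝ)) atTop (𝓝[>] 0) :=
    tendsto_nhdsWithin_iff.2 ⟨tendsto_one_div_add_atTop_nhds_zero_nat,
      Eventually.of_forall fun k => (e k).2.1⟩
  choose L hL1 hL2 using fun (k : ℕ) (p : RN d × RN d) =>
    exists_hasFDerivAt_osc (adm_stdCut (e k) hg.smooth) p
  refine hasFDerivAt_of_tendstoLocallyUniformlyOn (l := atTop) isOpen_univ ?_
    (fun k p _ => hL1 k p)
    (fun p _ => (tendsto_ampSymbol_std hg p.1 p.2).comp he) (Set.mem_univ p)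
  -- An operator norm is controlled by finitely many basis vectors, so finitely many directional
  -- rates give convergence of the full derivative.
  obtain ⟨K, hK0, hK⟩ := (Module.finBasis ℝ (RN d × RN d)).exists_opNorm_le (F := ℂ)
  choose C M hC0 hC using fun i =>
    osc_fderiv_cut_rate hg ((Module.finBasis ℝ (RN d × RN d) i).1,
      (Module.finBasis ℝ (RN d × RN d) i).1, (Module.finBasis ℝ (RN d × RN d) i).2)
  set Φ : RN d × RN d → ℝ := fun p => ∑ i, C i * ((1 + ‖p.1‖) * jap p.2 ^ M i) with hΦ
  have hjap : Continuous (jap (d := d)) :=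
    Continuous.rpow_const (by fun_prop) fun _ => Or.inr (by norm_num)
  have hΦc : Continuous Φ := continuous_finsetSum _ fun i _ => by fun_prop
  have hterm : ∀ i p, 0 ≤ C i * ((1 + ‖(p : RN d × RN d).1‖) * jap p.2 ^ M i) := fun i p => by
    have := hC0 i
    have := (jap_pos p.2).le
    positivity
  have hbound : ∀ k p, ‖L k p - H p‖ ≤ K * (((e k : Eps) : ℝ) * Φ p) := fun k p => by
    refine hK (mul_nonneg (e k).2.1.le (Finset.sum_nonneg fun i _ => hterm i p)) fun i => ?_
    have h1 := hC i (e k) p.1 p.2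
    rw [sub_apply]
    have h2 := hL2 k p (Module.finBasis ℝ (RN d × RN d) i).1 (Module.finBasis ℝ (RN d × RN d) i).2
    rw [Prod.mk.eta] at h2
    rw [h2]
    refine h1.trans ?_
    rw [mul_left_comm]
    refine mul_le_mul_of_nonneg_left ?_ (e k).2.1.le
    exact Finset.single_le_sum (f := fun i => C i * ((1 + ‖p.1‖) * jap p.2 ^ M i))
      (fun i _ => hterm i p) (Finset.mem_univ i)
  rw [Metric.tendstoLocallyUniformlyOn_iff]
  intro δ hδ p _
  -- The rate is multiplied by the continuous function `Φ`, which is bounded on this neighbourhood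
  -- of `p`; that gives local uniformity.
  refine ⟨{q | Φ q < Φ p + 1}, mem_nhdsWithin_of_mem_nhds
    ((isOpen_lt hΦc continuous_const).mem_nhds (by simp)), ?_⟩
  have hlim : Tendsto (fun k => K * (((e k : Eps) : ℝ) * (Φ p + 1))) atTop
      (𝓝 (K * (0 * (Φ p + 1)))) :=
    ((tendsto_nhds_of_tendsto_nhdsWithin he).mul_const _).const_mul _
  simp only [zero_mul, mul_zero] at hlim
  filter_upwards [hlim.eventually_lt_const hδ] with k hk q hq
  rw [dist_comm, dist_eq_norm]
  refine (hbound k q).trans_lt (lt_of_le_of_lt ?_ hk)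
  exact mul_le_mul_of_nonneg_left (mul_le_mul_of_nonneg_left (le_of_lt hq) (e k).2.1.le) hK0.le

/-- Directional derivatives are again symbols of amplitudes, so the induction on the order of
differentiability lets `m` and `g` vary. The loss of half an order per derivative is irrelevant for
smoothness. -/
theorem contDiff_ampSymbol (hg : Ampl X m n g) :
    ContDiff ℝ ∞ (fun p : RN d × RN d => ampSymbol g p.1 p.2) := by
  refine contDiff_infty.2 fun k => ?_
  induction k generalizing m g with
  | zero =>
    exact contDiff_zero.2 (continuous_iff_continuousAt.2 fun p => by
      obtain ⟨L, hL, -⟩ := hasFDerivAt_ampSymbol hg p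
      exact hL.continuousAt)
  | succ k ih =>
    refine (contDiff_succ_iff_fderiv_apply (n := k)).2 ⟨fun p => ?_, by simp, fun a => ?_⟩
    · obtain ⟨L, hL, -⟩ := hasFDerivAt_ampSymbol hg p
      exact hL.differentiableAt
    · convert ih (hg.fderiv_apply (a.1, a.1, a.2)) using 2 with p
      obtain ⟨L, hL, hL'⟩ := hasFDerivAt_ampSymbol hg p
      rw [hL.fderiv]
      exact hL' a.1 a.2

theorem pd_ampSymbol_fst (hg : Ampl X m n g) (i : Fin (d + 1)) (x ξ : RN d) :
    pd i (fun z => ampSymbol g z ξ) x = ampSymbol (fun v => fderiv ℝ g v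
      (EuclideanSpace.single i 1, EuclideanSpace.single i 1, 0)) x ξ := by
  obtain ⟨L, hL, hL'⟩ := hasFDerivAt_ampSymbol hg (x, ξ)
  have h := (HasFDerivAt.comp (f := fun z => (z, ξ)) x hL (hasFDerivAt_prodMk_left x ξ)).fderiv
  rw [← hL', pd]
  change fderiv ℝ (fun z => ampSymbol g z ξ) x = _ at h
  rw [h]
  simp

theorem pd_ampSymbol_snd (hg : Ampl X m n g) (i : Fin (d + 1)) (x ξ : RN d) :
    pd i (ampSymbol g x) ξ = ampSymbol (fun v => fderiv ℝ g v (dir (.inr (.inr i)))) x ξ := by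
  obtain ⟨L, hL, hL'⟩ := hasFDerivAt_ampSymbol hg (x, ξ)
  have h := (HasFDerivAt.comp (f := fun z => (x, z)) ξ hL (hasFDerivAt_prodMk_right x ξ)).fderiv
  have h' := hL' 0 (EuclideanSpace.single i 1)
  rw [dir]
  refine Eq.trans ?_ h'
  rw [pd]
  change fderiv ℝ (ampSymbol g x) ξ = _ at h
  rw [h]
  simp

end AmpSymbol

/-! ### The vector fields acting on amplitudes -/

section VectorFields

variable {d : ℕ} {𝒟 : RN d → Submodule ℝ (RN d)} {X : AdaptedFrame 𝒟} {m n m' n' : ℝ}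
  {G G' : V3 d → ℂ}

/-- The derivative of `G` along the vector field `Z`. -/
def lie (Z : V3 d → V3 d) (G : V3 d → ℂ) (v : V3 d) : ℂ := fderiv ℝ G v (Z v)

/-- `∂/∂ξ_j` on functions of `(x, y, ξ)`. -/
abbrev dXi (j : Fin (d + 1)) (G : V3 d → ℂ) : V3 d → ℂ := lie (fun _ => dir (.inr (.inr j))) G

/-- `∂/∂y_j` on functions of `(x, y, ξ)`. -/
abbrev dY (j : Fin (d + 1)) (G : V3 d → ℂ) : V3 d → ℂ := lie (fun _ => dir (.inr (.inl j))) G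

theorem dir_xi_fst (j : Fin (d + 1)) : (dir (.inr (.inr j)) : V3 d).1 = 0 := rfl

theorem contDiff_lie {Z : V3 d → V3 d} (hZ : ContDiff ℝ ∞ Z) (hG : ContDiff ℝ ∞ G) :
    ContDiff ℝ ∞ (lie Z G) :=
  (hG.fderiv_right (m := ∞) (by simp)).clm_apply hZ

theorem lie_lie {Z W : V3 d → V3 d} (hW : ContDiff ℝ ∞ W) (hG : ContDiff ℝ ∞ G) (v : V3 d) :
    lie Z (lie W G) v = fderiv ℝ (fderiv ℝ G) v (Z v) (W v) + fderiv ℝ G v (fderiv ℝ W v (Z v)) := by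
  have h1 : HasFDerivAt (fderiv ℝ G) (fderiv ℝ (fderiv ℝ G) v) v :=
    ((hG.fderiv_right (m := ∞) (by simp)).differentiable (by simp) v).hasFDerivAt
  have h2 : HasFDerivAt W (fderiv ℝ W v) v := (hW.differentiable (by simp) v).hasFDerivAt
  have h3 := (h1.clm_apply h2).fderiv
  change fderiv ℝ (lie W G) v = _ at h3
  rw [lie, h3]
  simp [add_comm]

/-- The second derivatives cancel by symmetry, leaving the Lie bracket of the two fields. -/
theorem lie_comm {Z W : V3 d → V3 d} (hZ : ContDiff ℝ ∞ Z) (hW : ContDiff ℝ ∞ W)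
    (hG : ContDiff ℝ ∞ G) (v : V3 d) :
    lie Z (lie W G) v = lie W (lie Z G) v +
      fderiv ℝ G v (fderiv ℝ W v (Z v) - fderiv ℝ Z v (W v)) := by
  have hs : IsSymmSndFDerivAt ℝ G v :=
    hG.contDiffAt.isSymmSndFDerivAt (by simpa using (WithTop.coe_le_coe.2 le_top : ((2 : ℕ∞) : WithTop ℕ∞) ≤ ∞))
  rw [lie_lie hW hG, lie_lie hZ hG, hs.eq (Z v) (W v), map_sub]
  ring

theorem lie_fn_mul (Z : V3 d → V3 d) {b : RN d → ℝ} (hb : ContDiff ℝ ∞ b) (hG : ContDiff ℝ ∞ G)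
    (v : V3 d) :
    lie Z (fun v => (b v.1 : ℂ) * G v) v =
      (fderiv ℝ b v.1 (Z v).1 : ℂ) * G v + (b v.1 : ℂ) * lie Z G v := by
  have h1 : HasFDerivAt (fun v : V3 d => (b v.1 : ℂ)) (Complex.ofRealCLM.comp
      ((fderiv ℝ b v.1).comp (ContinuousLinearMap.fst ℝ (RN d) (RN d × RN d)))) v :=
    Complex.ofRealCLM.hasFDerivAt.comp v
      ((hb.differentiable (by simp) v.1).hasFDerivAt.comp v hasFDerivAt_fst)
  have h2 := (h1.mul (hG.differentiable (by simp) v).hasFDerivAt).fderiv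
  change fderiv ℝ (fun v => (b v.1 : ℂ) * G v) v = _ at h2
  rw [lie, h2]
  simp [lie]
  ring

theorem lie_add (Z : V3 d → V3 d) (hG : ContDiff ℝ ∞ G) (hG' : ContDiff ℝ ∞ G') :
    lie Z (fun v => G v + G' v) = fun v => lie Z G v + lie Z G' v := by
  funext v
  simp [lie, fderiv_fun_add (hG.differentiable (by simp) v) (hG'.differentiable (by simp) v)]

theorem lie_const_mul (Z : V3 d → V3 d) (hG : ContDiff ℝ ∞ G) (a : ℂ) :
    lie Z (fun v => a * G v) = fun v => a * lie Z G v := by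
  funext v
  simp [lie, fderiv_const_mul (hG.differentiable (by simp) v)]

theorem contDiff_iff_comp {W : V3 d → RN d} :
    ContDiff ℝ ∞ W ↔ ∀ j, ContDiff ℝ ∞ (fun v => W v j) := contDiff_euclidean

/-- The matrix coefficients `∑_p (∂B_k^p/∂x^i) A_p^l`. -/
def shearCoef (X : AdaptedFrame 𝒟) (i k l : Fin (d + 1)) (x : RN d) : ℝ :=
  ∑ p, pd i (fun z => X.B z k p) x * X.A x p l

theorem AdaptedFrame.bddSmooth_A (X : AdaptedFrame 𝒟) (i j : Fin (d + 1)) :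
    BddSmooth (fun x => X.A x i j) := BddSmooth.of_ipd (X.smooth i j) fun I => X.bounded I i j

theorem bddSmooth_shearCoef (X : AdaptedFrame 𝒟) (i k l : Fin (d + 1)) :
    BddSmooth (shearCoef X i k l) :=
  BddSmooth.sum _ fun p _ => ((BddSmooth.B X k p).pd i).mul (X.bddSmooth_A p l)

/-- The vector field `∑_j B_j^N(x) ∂/∂ξ_j`. -/
def vertField (X : AdaptedFrame 𝒟) (v : V3 d) : V3 d :=
  (0, 0, WithLp.toLp 2 fun j => X.B v.1 j (Fin.last d))

/-- The vector field `∂/∂y^i + ∂/∂x^i + ∑ (∂B_k^p/∂x^i) A_p^l ξ_l ∂/∂ξ_k`. -/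
def horField (X : AdaptedFrame 𝒟) (i : Fin (d + 1)) (v : V3 d) : V3 d :=
  (EuclideanSpace.single i 1, EuclideanSpace.single i 1,
    WithLp.toLp 2 fun k => ∑ l, shearCoef X i k l v.1 * v.2.2 l)

theorem contDiff_vertField (X : AdaptedFrame 𝒟) : ContDiff ℝ ∞ (vertField X) :=
  contDiff_const.prodMk (contDiff_const.prodMk (contDiff_iff_comp.2 fun j =>
    ((BddSmooth.B X j (Fin.last d)).smooth ()).comp contDiff_fst))

theorem contDiff_horField (X : AdaptedFrame 𝒟) (i : Fin (d + 1)) :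
    ContDiff ℝ ∞ (horField X i) :=
  contDiff_const.prodMk (contDiff_const.prodMk (contDiff_iff_comp.2 fun k => by
    change ContDiff ℝ ∞ (fun v : V3 d => ∑ l, shearCoef X i k l v.1 * v.2.2 l)
    exact ContDiff.sum fun l _ =>
      (((bddSmooth_shearCoef X i k l).smooth ()).comp contDiff_fst).mul (xiL l).contDiff))

/-- The coefficients of the fields are affine along vertical lines, so their vertical derivatives
can be read off without differentiating them. -/
theorem fderiv_eq_of_slice {W : V3 d → V3 d} (hW : ContDiff ℝ ∞ W) (v a w : V3 d)
    (h : ∀ t : ℝ, W (v + t • a) = W v + t • w) : fderiv ℝ W v a = w := by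
  have h1 : HasDerivAt (fun t : ℝ => W (v + t • a)) (fderiv ℝ W v a) 0 := by
    have h2 : HasDerivAt (fun t : ℝ => v + t • a) a 0 := by
      simpa using ((hasDerivAt_id (0 : ℝ)).smul_const a).const_add v
    have h3 : HasFDerivAt W (fderiv ℝ W v) (v + (0 : ℝ) • a) := by
      simpa using (hW.differentiable (by simp) v).hasFDerivAt
    exact h3.comp_hasDerivAt (0 : ℝ) h2
  simp only [h] at h1
  refine h1.unique ?_
  simpa using ((hasDerivAt_id (0 : ℝ)).smul_const w).const_add (W v)

theorem fderiv_vertField_vertical (X : AdaptedFrame 𝒟) (v : V3 d) (a b : RN d) :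
    fderiv ℝ (vertField X) v (0, a, b) = 0 :=
  fderiv_eq_of_slice (contDiff_vertField X) v _ _ fun t => by simp [vertField]

theorem fderiv_horField_vertical (X : AdaptedFrame 𝒟) (i : Fin (d + 1)) (v : V3 d) (a b : RN d) :
    fderiv ℝ (horField X i) v (0, a, b) =
      (0, 0, WithLp.toLp 2 fun k => ∑ l, shearCoef X i k l v.1 * b l) :=
  fderiv_eq_of_slice (contDiff_horField X i) v _ _ fun t => by
    refine Prod.ext (by simp [horField]) (Prod.ext (by simp [horField]) ?_)
    ext k
    simp only [horField, Prod.snd_add, Prod.fst_add, Prod.smul_snd, Prod.smul_fst, smul_zero,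
      add_zero, PiLp.add_apply, PiLp.smul_apply, smul_eq_mul, mul_add, Finset.sum_add_distrib,
      Finset.mul_sum]
    congr 1
    exact Finset.sum_congr rfl fun l _ => by ring

theorem fderiv_vertField_horField (X : AdaptedFrame 𝒟) (i : Fin (d + 1)) (v : V3 d) :
    fderiv ℝ (vertField X) v (horField X i v) =
      (0, 0, WithLp.toLp 2 fun k => pd i (fun z => X.B z k (Fin.last d)) v.1) := by
  have h1 : HasFDerivAt (fun x : RN d => (WithLp.toLp 2 fun j => X.B x j (Fin.last d) : RN d))
      ((PiLp.continuousLinearEquiv 2 ℝ fun _ => ℝ).symm.toContinuousLinearMap.comp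
        (ContinuousLinearMap.pi fun j => fderiv ℝ (fun x => X.B x j (Fin.last d)) v.1)) v.1 :=
    (PiLp.continuousLinearEquiv 2 ℝ fun _ => ℝ).symm.hasFDerivAt.comp v.1
      (hasFDerivAt_pi.2 fun j =>
        (((BddSmooth.B X j (Fin.last d)).smooth ()).differentiable (by simp) v.1).hasFDerivAt)
  have h2 := ((hasFDerivAt_const (0 : RN d) v).prodMk ((hasFDerivAt_const (0 : RN d) v).prodMk
    (h1.comp v (hasFDerivAt_fst (𝕜 := ℝ) (E := RN d) (F := RN d × RN d) (p := v))))).fderiv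
  change fderiv ℝ (vertField X) v = _ at h2
  rw [h2]
  rfl

/-- The sum is $(\partial_iB)AB$ and $AB=1$. The shear term in $D_i$ is designed so that $D_\xi$ is
invariant under it. -/
theorem sum_shearCoef_mul_B (X : AdaptedFrame 𝒟) (i k : Fin (d + 1)) (x : RN d) :
    ∑ l, shearCoef X i k l x * X.B x l (Fin.last d) = pd i (fun z => X.B z k (Fin.last d)) x := by
  have h : ∀ p, ∑ l, X.A x p l * X.B x l (Fin.last d) = if p = Fin.last d then 1 else 0 := fun p => by
    rw [← Matrix.mul_apply, X.A_mul_B, Matrix.one_apply]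
  unfold shearCoef
  simp only [Finset.sum_mul]
  rw [Finset.sum_comm]
  simp only [mul_assoc, ← Finset.mul_sum, h]
  simp

theorem fderiv_vertical (v : V3 d) (b : RN d) :
    fderiv ℝ G v (0, 0, b) = ∑ k, (b k : ℂ) * dXi k G v := by
  have : ((0, 0, b) : V3 d) = ∑ k, b k • dir (.inr (.inr k)) := by
    refine Prod.ext ?_ (Prod.ext ?_ ?_)
    · simp [dir, Prod.fst_sum]
    · simp [dir, Prod.fst_sum, Prod.snd_sum]
    · simp [dir, Prod.snd_sum, sum_smul_single]
  rw [this, map_sum]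
  simp [lie]

/-- The coefficients $B_k^N$ differentiated along $D_i$, and the shear differentiated along $D_\xi$,
both give $\partial_iB_k^N$; the bracket vanishes. -/
theorem lie_horField_vertField (hG : ContDiff ℝ ∞ G) (i : Fin (d + 1)) :
    lie (horField X i) (lie (vertField X) G) = lie (vertField X) (lie (horField X i) G) := by
  funext v
  rw [lie_comm (contDiff_horField X i) (contDiff_vertField X) hG, fderiv_vertField_horField]
  have : fderiv ℝ (horField X i) v (vertField X v) =
      (0, 0, WithLp.toLp 2 fun k => pd i (fun z => X.B z k (Fin.last d)) v.1) := by
    rw [vertField, fderiv_horField_vertical]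
    simp only [sum_shearCoef_mul_B]
  rw [this]
  simp

/-- The commutator costs nothing: it has bounded coefficients and the same number of
$\xi$-derivatives. -/
theorem lie_horField_dXi (hG : ContDiff ℝ ∞ G) (i j : Fin (d + 1)) :
    lie (horField X i) (dXi j G) = fun v => dXi j (lie (horField X i) G) v +
      ∑ k, ((-shearCoef X i k j v.1 : ℝ) : ℂ) * dXi k G v := by
  funext v
  rw [lie_comm (contDiff_horField X i) contDiff_const hG]
  have h2 : fderiv ℝ (horField X i) v (dir (.inr (.inr j))) =
      (0, 0, WithLp.toLp 2 fun k => shearCoef X i k j v.1) := by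
    rw [dir, fderiv_horField_vertical]
    simp
  rw [h2, fderiv_fun_const]
  simp only [Pi.zero_apply, zero_apply, zero_sub, map_neg]
  rw [fderiv_vertical]
  simp

theorem lie_vertField_dXi (hG : ContDiff ℝ ∞ G) (j : Fin (d + 1)) :
    lie (vertField X) (dXi j G) = dXi j (lie (vertField X) G) := by
  funext v
  rw [lie_comm (contDiff_vertField X) contDiff_const hG]
  simp only [dir]
  rw [fderiv_vertField_vertical]
  simp
  rfl

theorem lie_vertField_dY (hG : ContDiff ℝ ∞ G) (j : Fin (d + 1)) :
    lie (vertField X) (dY j G) = dY j (lie (vertField X) G) := by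
  funext v
  rw [lie_comm (contDiff_vertField X) contDiff_const hG]
  simp only [dir]
  rw [fderiv_vertField_vertical]
  simp
  rfl

theorem lie_horField_dY (hG : ContDiff ℝ ∞ G) (i j : Fin (d + 1)) :
    lie (horField X i) (dY j G) = dY j (lie (horField X i) G) := by
  funext v
  rw [lie_comm (contDiff_horField X i) contDiff_const hG]
  simp only [dir]
  rw [fderiv_horField_vertical]
  have h0 : ((0, 0, WithLp.toLp 2 0) : V3 d) = 0 := rfl
  simp only [PiLp.zero_apply, mul_zero, Finset.sum_const_zero, fderiv_fun_const]
  have : ((0, 0, WithLp.toLp 2 fun _ => 0) : V3 d) = 0 := rfl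
  rw [this]
  simp
  rfl

theorem dXi_dY (hG : ContDiff ℝ ∞ G) (i j : Fin (d + 1)) : dXi i (dY j G) = dY j (dXi i G) := by
  funext v
  simpa using lie_comm (Z := fun _ => dir (.inr (.inr i))) (W := fun _ => dir (.inr (.inl j)))
    contDiff_const contDiff_const hG v

/-! ### Amplitudes that are stable under these vector fields -/

/-- All words of length at most `k` in the vector fields `D_i`, `∂_ξ` and `D_ξ`, in any order, map
`G` to amplitudes of the expected order. -/
def Stable (X : AdaptedFrame 𝒟) : ℕ → ℝ → ℝ → (V3 d → ℂ) → Prop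
  | 0, m, n, G => Ampl X m n G
  | k + 1, m, n, G => Ampl X m n G ∧ (∀ i, Stable X k m n (lie (horField X i) G)) ∧
      (∀ j, Stable X k m (n - 1) (dXi j G)) ∧ Stable X k (m - 1) n (lie (vertField X) G)

namespace Stable

variable {k : ℕ}

theorem ampl (h : Stable X k m n G) : Ampl X m n G := by
  cases k with
  | zero => exact h
  | succ k => exact h.1

theorem smooth (h : Stable X k m n G) : ContDiff ℝ ∞ G := h.ampl.smooth

theorem of_succ (h : Stable X (k + 1) m n G) : Stable X k m n G := by
  induction k generalizing m n G with
  | zero => exact h.1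
  | succ k ih => exact ⟨h.1, fun i => ih (h.2.1 i), fun j => ih (h.2.2.1 j), ih h.2.2.2⟩

theorem add (h : Stable X k m n G) (h' : Stable X k m n G') :
    Stable X k m n (fun v => G v + G' v) := by
  induction k generalizing m n G G' with
  | zero => exact Ampl.add h h'
  | succ k ih =>
    refine ⟨h.1.add h'.1, fun i => ?_, fun j => ?_, ?_⟩
    · rw [lie_add _ h.smooth h'.smooth]; exact ih (h.2.1 i) (h'.2.1 i)
    · rw [dXi, lie_add _ h.smooth h'.smooth]; exact ih (h.2.2.1 j) (h'.2.2.1 j)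
    · rw [lie_add _ h.smooth h'.smooth]; exact ih h.2.2.2 h'.2.2.2

theorem zero : Stable X k m n (fun _ => 0) := by
  have h0 : ∀ Z : V3 d → V3 d, lie Z (fun _ => (0 : ℂ)) = fun _ => 0 := fun Z => by
    funext v; simp [lie]
  induction k generalizing m n with
  | zero => exact Ampl.zero
  | succ k ih =>
    exact ⟨Ampl.zero, fun i => by rw [h0]; exact ih, fun j => by rw [dXi, h0]; exact ih,
      by rw [h0]; exact ih⟩

theorem const_mul (h : Stable X k m n G) (a : ℂ) : Stable X k m n (fun v => a * G v) := by
  induction k generalizing m n G with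
  | zero => exact Ampl.const_mul h a
  | succ k ih =>
    refine ⟨h.1.const_mul a, fun i => ?_, fun j => ?_, ?_⟩
    · rw [lie_const_mul _ h.smooth]; exact ih (h.2.1 i)
    · rw [dXi, lie_const_mul _ h.smooth]; exact ih (h.2.2.1 j)
    · rw [lie_const_mul _ h.smooth]; exact ih h.2.2.2

theorem sum {κ : Type*} (S : Finset κ) {f : κ → V3 d → ℂ} (h : ∀ j ∈ S, Stable X k m n (f j)) :
    Stable X k m n (fun v => ∑ j ∈ S, f j v) := by
  classical
  induction S using Finset.induction_on with
  | empty => simpa using zero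
  | insert a S ha ih =>
    simp only [Finset.sum_insert ha]
    exact (h a (Finset.mem_insert_self a S)).add
      (ih fun j hj => h j (Finset.mem_insert_of_mem hj))

theorem fn_mul (h : Stable X k m n G) {b : RN d → ℝ} (hb : BddSmooth b) :
    Stable X k m n (fun v => (b v.1 : ℂ) * G v) := by
  induction k generalizing m n G b with
  | zero => exact Ampl.fn_mul h hb
  | succ k ih =>
    refine ⟨h.1.fn_mul hb, fun i => ?_, fun j => ?_, ?_⟩
    · have e : lie (horField X i) (fun v => (b v.1 : ℂ) * G v) = fun v =>
          ((pd i b v.1 : ℝ) : ℂ) * G v + (b v.1 : ℂ) * lie (horField X i) G v :=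
        funext fun v => lie_fn_mul _ (hb.smooth ()) h.smooth v
      rw [e]
      exact (ih h.of_succ (hb.pd i)).add (ih (h.2.1 i) hb)
    · have e : dXi j (fun v => (b v.1 : ℂ) * G v) = fun v => (b v.1 : ℂ) * dXi j G v :=
        funext fun v => by rw [dXi, lie_fn_mul _ (hb.smooth ()) h.smooth v]; simp [dir_xi_fst]
      rw [e]
      exact ih (h.2.2.1 j) hb
    · have e : lie (vertField X) (fun v => (b v.1 : ℂ) * G v) = fun v =>
          (b v.1 : ℂ) * lie (vertField X) G v :=
        funext fun v => by rw [lie_fn_mul _ (hb.smooth ()) h.smooth v]; simp [vertField]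
      rw [e]
      exact ih h.2.2.2 hb

theorem trade (h : Stable X k (m + 1 / 2) (n - 1) G) : Stable X k m n G := by
  induction k generalizing m n G with
  | zero => exact Ampl.trade h
  | succ k ih =>
    refine ⟨h.1.trade, fun i => ih (h.2.1 i), fun j => ih (h.2.2.1 j), ih ?_⟩
    have := h.2.2.2
    rwa [add_sub_right_comm] at this

theorem dY (h : Stable X k m n G) (j : Fin (d + 1)) : Stable X k (m + 1 / 2) n (dY j G) := by
  induction k generalizing m n G with
  | zero => exact Ampl.fderiv_y h j
  | succ k ih =>
    refine ⟨h.1.fderiv_y j, fun i => ?_, fun l => ?_, ?_⟩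
    · rw [lie_horField_dY h.smooth]; exact ih (h.2.1 i)
    · rw [dXi_dY h.smooth]; exact ih (h.2.2.1 l)
    · rw [lie_vertField_dY h.smooth, add_sub_right_comm]; exact ih h.2.2.2

end Stable

/-- The operator on amplitudes that corresponds to `D_i` on symbols. -/
def corrD (X : AdaptedFrame 𝒟) (i : Fin (d + 1)) (G : V3 d → ℂ) (v : V3 d) : ℂ :=
  lie (horField X i) G v + -(2 * Real.pi * Complex.I)⁻¹ *
    ∑ k, ∑ l, (shearCoef X i k l v.1 : ℂ) * dY l (dXi k G) v

/-- In the correction, $\partial_{\xi_k}$ lowers `n` by one and $\partial_{y_l}$ raises `m` by one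
half; `Stable.trade` turns this back into order $(m,n)$. One level of stability is spent. -/
theorem Stable.corrD {k : ℕ} (h : Stable X (k + 1) m n G) (i : Fin (d + 1)) :
    Stable X k m n (corrD X i G) :=
  (h.2.1 i).add (Stable.const_mul (Stable.sum _ fun k _ => Stable.sum _ fun l _ =>
    (((h.2.2.1 k).dY l).trade).fn_mul (bddSmooth_shearCoef X i k l)) _)

/-! ### Reordering words in the vector fields -/

theorem contDiff_foldr_dXi (α : List (Fin (d + 1))) (hG : ContDiff ℝ ∞ G) :
    ContDiff ℝ ∞ (α.foldr dXi G) := by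
  induction α with
  | nil => exact hG
  | cons j α ih => exact contDiff_lie contDiff_const ih

theorem contDiff_iterate_lie (β : ℕ) (hG : ContDiff ℝ ∞ G) :
    ContDiff ℝ ∞ ((lie (vertField X))^[β] G) := by
  induction β with
  | zero => exact hG
  | succ β ih => rw [Function.iterate_succ_apply']; exact contDiff_lie (contDiff_vertField X) ih

theorem contDiff_foldr_lie (I : List (Fin (d + 1))) (hG : ContDiff ℝ ∞ G) :
    ContDiff ℝ ∞ (I.foldr (fun i => lie (horField X i)) G) := by
  induction I with
  | nil => exact hG
  | cons i I ih => exact contDiff_lie (contDiff_horField X i) ih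

theorem lie_vertField_foldr_dXi (α : List (Fin (d + 1))) (hG : ContDiff ℝ ∞ G) :
    lie (vertField X) (α.foldr dXi G) = α.foldr dXi (lie (vertField X) G) := by
  induction α with
  | nil => rfl
  | cons j α ih =>
    rw [List.foldr_cons, lie_vertField_dXi (contDiff_foldr_dXi α hG), ih, List.foldr_cons]

theorem lie_horField_iterate (i : Fin (d + 1)) (β : ℕ) (hG : ContDiff ℝ ∞ G) :
    lie (horField X i) ((lie (vertField X))^[β] G) =
      (lie (vertField X))^[β] (lie (horField X i) G) := by
  induction β with
  | zero => rfl
  | succ β ih =>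
    rw [Function.iterate_succ_apply', lie_horField_vertField (contDiff_iterate_lie β hG), ih,
      Function.iterate_succ_apply']

theorem foldr_dXi_add (α : List (Fin (d + 1))) (hG : ContDiff ℝ ∞ G) (hG' : ContDiff ℝ ∞ G') :
    α.foldr dXi (fun v => G v + G' v) = fun v => α.foldr dXi G v + α.foldr dXi G' v := by
  induction α with
  | nil => rfl
  | cons j α ih =>
    rw [List.foldr_cons, ih, dXi, lie_add _ (contDiff_foldr_dXi α hG) (contDiff_foldr_dXi α hG')]
    rfl

theorem foldr_dXi_fn_mul (α : List (Fin (d + 1))) {b : RN d → ℝ} (hb : ContDiff ℝ ∞ b)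
    (hG : ContDiff ℝ ∞ G) :
    α.foldr dXi (fun v => (b v.1 : ℂ) * G v) = fun v => (b v.1 : ℂ) * α.foldr dXi G v := by
  induction α with
  | nil => rfl
  | cons j α ih =>
    rw [List.foldr_cons, ih]
    funext v
    rw [dXi, lie_fn_mul _ hb (contDiff_foldr_dXi α hG)]
    simp [dir_xi_fst, dXi]

theorem foldr_dXi_sum {κ : Type*} (α : List (Fin (d + 1))) (S : Finset κ) {f : κ → V3 d → ℂ}
    (h : ∀ j, ContDiff ℝ ∞ (f j)) :
    α.foldr dXi (fun v => ∑ j ∈ S, f j v) = fun v => ∑ j ∈ S, α.foldr dXi (f j) v := by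
  classical
  induction S using Finset.induction_on with
  | empty =>
    simp only [Finset.sum_empty]
    induction α with
    | nil => rfl
    | cons j α ih => rw [List.foldr_cons, ih]; funext v; simp [lie]
  | insert a S ha ih =>
    simp only [Finset.sum_insert ha]
    rw [foldr_dXi_add α (h a) (ContDiff.sum fun j _ => h j), ih]

/-- $D_i$ is moved inwards through the $\xi$-derivatives; `γ` lists those already passed and `α`
those still ahead. Their total number `L` is preserved, hence so is the order. -/
theorem stable_foldr_lie_foldr {k : ℕ} (i : Fin (d + 1)) (hG : ContDiff ℝ ∞ G) (L : ℕ)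
    (h1 : ∀ α : List (Fin (d + 1)), α.length = L → Stable X k m n (α.foldr dXi G))
    (h2 : ∀ α : List (Fin (d + 1)), α.length = L →
      Stable X k m n (α.foldr dXi (lie (horField X i) G)))
    (α γ : List (Fin (d + 1))) (hL : γ.length + α.length = L) :
    Stable X k m n (γ.foldr dXi (lie (horField X i) (α.foldr dXi G))) := by
  induction α generalizing γ with
  | nil => exact h2 γ (by simpa using hL)
  | cons j α ih =>
    have hα := contDiff_foldr_dXi α hG
    have hs : ∀ k, ContDiff ℝ ∞ (dXi k (α.foldr dXi G)) := fun k => contDiff_lie contDiff_const hα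
    have hb := fun k => (bddSmooth_shearCoef X i k j).neg
    have hs' : ∀ k, ContDiff ℝ ∞ (fun v : V3 d =>
        ((-shearCoef X i k j v.1 : ℝ) : ℂ) * dXi k (α.foldr dXi G) v) := fun k =>
      (Complex.ofRealCLM.contDiff.comp (((hb k).smooth ()).comp contDiff_fst)).mul (hs k)
    have h0 : ContDiff ℝ ∞ (dXi j (lie (horField X i) (α.foldr dXi G))) :=
      contDiff_lie contDiff_const (contDiff_lie (contDiff_horField X i) hα)
    rw [List.foldr_cons, lie_horField_dXi hα,
      foldr_dXi_add γ h0 (ContDiff.sum fun k _ => hs' k)]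
    refine Stable.add ?_ ?_
    -- Main term: $D_i$ has passed $\partial_{\xi_j}$, which joins `γ`.
    · have := ih (γ ++ [j]) (by simp at hL ⊢; omega)
      rwa [List.foldr_append] at this
    · rw [foldr_dXi_sum γ _ hs']
      refine Stable.sum _ fun k _ => ?_
      have e := foldr_dXi_fn_mul γ ((hb k).smooth ()) (hs k)
      rw [e]
      refine Stable.fn_mul ?_ (hb k)
      -- Commutator term: $D_i$ has disappeared and $\partial_{\xi_k}$ replaces $\partial_{\xi_j}$.
      have := h1 (γ ++ k :: α) (by simp at hL ⊢; omega)
      rwa [List.foldr_append] at this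

/-- The definition of $CS^{m,n}$ controls only words ordered as $\partial_\xi^\alpha D_\xi^\beta
D^I$, whereas iterating `corrD` produces mixed orders. The commutation rules bring every word back
to ordered ones. -/
theorem stable_of_words (hG : ContDiff ℝ ∞ G)
    (h : ∀ (α : List (Fin (d + 1))) (β : ℕ) (I : List (Fin (d + 1))),
      Ampl X (m - β) (n - α.length) (α.foldr dXi
        ((lie (vertField X))^[β] (I.foldr (fun i => lie (horField X i)) G))))
    (k : ℕ) (α : List (Fin (d + 1))) (β : ℕ) (I : List (Fin (d + 1))) :
    Stable X k (m - β) (n - α.length) (α.foldr dXi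
      ((lie (vertField X))^[β] (I.foldr (fun i => lie (horField X i)) G))) := by
  induction k generalizing α β I with
  | zero => exact h α β I
  | succ k ih =>
    have hI := contDiff_foldr_lie (X := X) I hG
    have hβ := contDiff_iterate_lie (X := X) β hI
    refine ⟨h α β I, fun i => ?_, fun j => ?_, ?_⟩
    · refine stable_foldr_lie_foldr i hβ α.length (fun α' h' => h' ▸ ih α' β I)
        (fun α' h' => ?_) α [] (by simp)
      rw [lie_horField_iterate i β hI, ← h']
      exact ih α' β (i :: I)
    · have := ih (j :: α) β I
      rw [List.length_cons] at this
      push_cast at this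
      rwa [← sub_sub] at this
    · rw [lie_vertField_foldr_dXi α hβ, ← Function.iterate_succ_apply' (lie (vertField X))]
      have := ih α (β + 1) I
      push_cast at this
      rwa [← sub_sub] at this

/-- Each letter, `corrD` included, consumes one level of stability, so stability at all levels is
required. -/
theorem ampl_of_stable (h : ∀ k, Stable X k m n G) (α : List (Fin (d + 1))) (β : ℕ)
    (I : List (Fin (d + 1))) :
    Ampl X (m - β) (n - α.length) (α.foldr dXi
      ((lie (vertField X))^[β] (I.foldr (corrD X) G))) := by
  have h1 : ∀ k, Stable X k m n (I.foldr (corrD X) G) := by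
    induction I with
    | nil => exact h
    | cons i I ih => exact fun k => (ih (k + 1)).corrD i
  have h2 : ∀ k, Stable X k (m - β) n ((lie (vertField X))^[β] (I.foldr (corrD X) G)) := by
    induction β with
    | zero => simpa using h1
    | succ β ih =>
      intro k
      rw [Function.iterate_succ_apply']
      have := (ih (k + 1)).2.2.2
      push_cast
      rwa [← sub_sub]
  have h3 : ∀ k, Stable X k (m - β) (n - α.length) (α.foldr dXi
      ((lie (vertField X))^[β] (I.foldr (corrD X) G))) := by
    induction α with
    | nil => simpa using h2
    | cons j α ih =>
      intro k
      have := (ih (k + 1)).2.2.1 j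
      rw [List.length_cons]
      push_cast
      rwa [← sub_sub]
  exact (h3 0).ampl

end VectorFields

/-! ### Preliminary compound symbols are amplitudes -/

section Preliminary

variable {d : ℕ} {𝒟 : RN d → Submodule ℝ (RN d)} {X : AdaptedFrame 𝒟} {m n : ℝ}
  {G : V3 d → ℂ}

/-- The partial derivative in a coordinate direction of `V3 d`. -/
abbrev dd (i : Dir d) (G : V3 d → ℂ) : V3 d → ℂ := lie (fun _ => dir i) G

/-- The directions of the `x` variables in the list `δ`. -/
abbrev dirsX (δ : List (Fin (d + 1))) : List (Dir d) := δ.map fun i => .inl i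

/-- The directions of the `y` variables in the list `γ`. -/
abbrev dirsY (γ : List (Fin (d + 1))) : List (Dir d) := γ.map fun i => .inr (.inl i)

/-- The directions of the `ξ` variables in the list `α`. -/
abbrev dirsXi (α : List (Fin (d + 1))) : List (Dir d) := α.map fun i => .inr (.inr i)

theorem contDiff_foldr_dd (L : List (Dir d)) (hG : ContDiff ℝ ∞ G) :
    ContDiff ℝ ∞ (L.foldr dd G) := by
  induction L with
  | nil => exact hG
  | cons j L ih => exact contDiff_lie contDiff_const ih

/-- The symbol classes differentiate in arbitrary order, the definition of $PCS^{m,n}$ in a fixed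
one; symmetry of mixed partial derivatives reconciles them. -/
theorem foldr_dd_perm {L L' : List (Dir d)} (h : L.Perm L') (hG : ContDiff ℝ ∞ G) :
    L.foldr dd G = L'.foldr dd G := by
  induction h with
  | nil => rfl
  | cons i _ ih => rw [List.foldr_cons, ih, List.foldr_cons]
  | swap i j L =>
    funext v
    simpa using lie_comm (Z := fun _ => dir j) (W := fun _ => dir i) contDiff_const contDiff_const
      (contDiff_foldr_dd L hG) v
  | trans _ _ ih1 ih2 => rw [ih1, ih2]

theorem exists_perm_ordered (L : List (Dir d)) : ∃ α γ δ : List (Fin (d + 1)),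
    L.Perm (dirsXi α ++ (dirsY γ ++ dirsX δ)) := by
  induction L with
  | nil => exact ⟨[], [], [], by simp⟩
  | cons j L ih =>
    obtain ⟨α, γ, δ, h⟩ := ih
    rcases j with j | j | j
    · refine ⟨α, γ, j :: δ, (h.cons _).trans ?_⟩
      rw [← List.append_assoc, ← List.append_assoc, dirsX, dirsX, List.map_cons]
      exact List.perm_middle.symm
    · refine ⟨α, j :: γ, δ, (h.cons _).trans ?_⟩
      rw [dirsY, dirsY, List.map_cons, List.cons_append]
      exact List.perm_middle.symm
    · exact ⟨j :: α, γ, δ, h.cons _⟩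

theorem pd_slice_x (hG : ContDiff ℝ ∞ G) (i : Fin (d + 1)) (x y ξ : RN d) :
    pd i (fun z => G (z, y, ξ)) x = dd (.inl i) G (x, y, ξ) := by
  have h0 : HasFDerivAt (fun z : RN d => ((z, y, ξ) : V3 d)) ((ContinuousLinearMap.id ℝ (RN d)).prod 0) x :=
    (hasFDerivAt_id x).prodMk (hasFDerivAt_const (y, ξ) x)
  have h := ((hG.differentiable (by simp) (x, y, ξ)).hasFDerivAt.comp x h0).fderiv
  change fderiv ℝ (fun z => G (z, y, ξ)) x = _ at h
  rw [pd, h]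
  rfl

theorem pd_slice_y (hG : ContDiff ℝ ∞ G) (i : Fin (d + 1)) (x y ξ : RN d) :
    pd i (fun z => G (x, z, ξ)) y = dd (.inr (.inl i)) G (x, y, ξ) := by
  have h0 : HasFDerivAt (fun z : RN d => ((x, z, ξ) : V3 d)) (.prod 0 ((ContinuousLinearMap.id ℝ (RN d)).prod 0)) y :=
    (hasFDerivAt_const x y).prodMk ((hasFDerivAt_id y).prodMk (hasFDerivAt_const ξ y))
  have h := ((hG.differentiable (by simp) (x, y, ξ)).hasFDerivAt.comp y h0).fderiv
  change fderiv ℝ (fun z => G (x, z, ξ)) y = _ at h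
  rw [pd, h]
  rfl

theorem pd_slice_xi (hG : ContDiff ℝ ∞ G) (i : Fin (d + 1)) (x y ξ : RN d) :
    pd i (fun z => G (x, y, z)) ξ = dd (.inr (.inr i)) G (x, y, ξ) := by
  have h0 : HasFDerivAt (fun z : RN d => ((x, y, z) : V3 d)) (.prod 0 (.prod 0 (ContinuousLinearMap.id ℝ (RN d)))) ξ :=
    (hasFDerivAt_const x ξ).prodMk ((hasFDerivAt_const y ξ).prodMk (hasFDerivAt_id ξ))
  have h := ((hG.differentiable (by simp) (x, y, ξ)).hasFDerivAt.comp ξ h0).fderiv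
  change fderiv ℝ (fun z => G (x, y, z)) ξ = _ at h
  rw [pd, h]
  rfl

theorem ipd_slice_x (hG : ContDiff ℝ ∞ G) (δ : List (Fin (d + 1))) (x y ξ : RN d) :
    ipd δ (fun z => G (z, y, ξ)) x = (dirsX δ).foldr dd G (x, y, ξ) := by
  induction δ generalizing x with
  | nil => rfl
  | cons i δ ih =>
    have : ipd δ (fun z => G (z, y, ξ)) =
        fun z => (dirsX δ).foldr dd G (z, y, ξ) := funext fun z => ih z
    change pd i (ipd δ _) x = _
    rw [this, pd_slice_x (contDiff_foldr_dd _ hG)]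
    rfl

theorem ipd_slice_y (hG : ContDiff ℝ ∞ G) (γ : List (Fin (d + 1))) (x y ξ : RN d) :
    ipd γ (fun z => G (x, z, ξ)) y = (dirsY γ).foldr dd G (x, y, ξ) := by
  induction γ generalizing y with
  | nil => rfl
  | cons i γ ih =>
    have : ipd γ (fun z => G (x, z, ξ)) =
        fun z => (dirsY γ).foldr dd G (x, z, ξ) := funext fun z => ih z
    change pd i (ipd γ _) y = _
    rw [this, pd_slice_y (contDiff_foldr_dd _ hG)]
    rfl

theorem ipd_slice_xi (hG : ContDiff ℝ ∞ G) (α : List (Fin (d + 1))) (x y ξ : RN d) :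
    ipd α (fun z => G (x, y, z)) ξ = (dirsXi α).foldr dd G (x, y, ξ) := by
  induction α generalizing ξ with
  | nil => rfl
  | cons i α ih =>
    have : ipd α (fun z => G (x, y, z)) =
        fun z => (dirsXi α).foldr dd G (x, y, z) := funext fun z => ih z
    change pd i (ipd α _) ξ = _
    rw [this, pd_slice_xi (contDiff_foldr_dd _ hG)]
    rfl

theorem cmpDeriv_eq_foldr_dd (hG : ContDiff ℝ ∞ G) (α γ δ : List (Fin (d + 1))) (x y ξ : RN d) :
    cmpDerivXi α (cmpDerivY γ (cmpDerivX δ fun x y ξ => G (x, y, ξ))) x y ξ =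
      (dirsXi α ++ (dirsY γ ++ dirsX δ)).foldr dd G (x, y, ξ) := by
  have h1 := contDiff_foldr_dd (dirsX δ) hG
  have h2 := contDiff_foldr_dd (dirsY γ) h1
  unfold cmpDerivX
  simp only [ipd_slice_x hG]
  unfold cmpDerivY
  simp only [ipd_slice_y h1]
  unfold cmpDerivXi
  rw [ipd_slice_xi h2, List.foldr_append, List.foldr_append]

theorem prod_scale_xi (α : List (Fin (d + 1))) (v : V3 d) :
    ((dirsXi α).map fun i => scale i v).prod =
      jap v.2.2 ^ (-(α.length : ℝ) / 2) := by
  induction α with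
  | nil => simp
  | cons i α ih =>
    rw [show dirsXi (i :: α) = (.inr (.inr i)) :: dirsXi α from rfl, List.map_cons, List.prod_cons, ih,
      List.length_cons, show scale (.inr (.inr i)) v = jap v.2.2 ^ (-1 / 2 : ℝ) from rfl,
      ← Real.rpow_add (jap_pos _)]
    congr 1
    push_cast
    ring

theorem prod_scale_y (γ : List (Fin (d + 1))) (v : V3 d) :
    ((dirsY γ).map fun i => scale i v).prod =
      jap v.2.2 ^ ((γ.length : ℝ) / 2) := by
  induction γ with
  | nil => simp
  | cons i γ ih =>
    rw [show dirsY (i :: γ) = (.inr (.inl i)) :: dirsY γ from rfl, List.map_cons, List.prod_cons, ih,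
      List.length_cons, show scale (.inr (.inl i)) v = jap v.2.2 ^ (1 / 2 : ℝ) from rfl,
      ← Real.rpow_add (jap_pos _)]
    congr 1
    push_cast
    ring

theorem prod_scale_x (δ : List (Fin (d + 1))) (v : V3 d) :
    ((dirsX δ).map fun i => scale i v).prod =
      jap v.2.2 ^ ((δ.length : ℝ) / 2) := by
  induction δ with
  | nil => simp
  | cons i δ ih =>
    rw [show dirsX (i :: δ) = (.inl i) :: dirsX δ from rfl, List.map_cons, List.prod_cons, ih,
      List.length_cons, show scale (.inl i) v = jap v.2.2 ^ (1 / 2 : ℝ) from rfl,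
      ← Real.rpow_add (jap_pos _)]
    congr 1
    push_cast
    ring

/-- Bounds for the ordered derivatives `∂_ξ^α ∂_y^γ ∂_x^δ` suffice for membership in a class. -/
theorem cls_of_ordered {w : V3 d → ℝ} (hG : ContDiff ℝ ∞ G)
    (h : ∀ α γ δ : List (Fin (d + 1)), ∃ C : ℝ, ∀ v : V3 d,
      ‖(dirsXi α ++ (dirsY γ ++ dirsX δ)).foldr dd G v‖ ≤
      C * (w v * jap v.2.2 ^ (((γ.length : ℝ) + δ.length - α.length) / 2))) :
    Cls (fun _ : Unit => w) (fun _ => G) := by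
  have h1 : ∀ L : List (Dir d), ∃ C : ℝ, ∀ (_ : Unit) v, ‖L.foldr dd G v‖ ≤
      C * (w v * (L.map fun i => scale i v).prod) := fun L => by
    obtain ⟨α, γ, δ, hL⟩ := exists_perm_ordered L
    obtain ⟨C, hC⟩ := h α γ δ
    refine ⟨C, fun _ v => ?_⟩
    rw [foldr_dd_perm hL hG, (hL.map fun i => scale i v).prod_eq, List.map_append, List.map_append,
      List.prod_append, List.prod_append, prod_scale_xi, prod_scale_y, prod_scale_x,
      ← Real.rpow_add (jap_pos _), ← Real.rpow_add (jap_pos _)]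
    convert hC v using 4
    ring
  refine ⟨fun _ => hG, fun k => ?_⟩
  have key : ∀ L : List (Dir d), SymBound dir scale k
      (fun (_ : Unit) v => w v * (L.map fun i => scale i v).prod) (fun _ => L.foldr dd G) := by
    induction k with
    | zero => exact h1
    | succ k ih =>
      refine fun L => ⟨h1 L, fun i => ?_⟩
      have := ih (i :: L)
      simp only [List.map_cons, List.prod_cons] at this
      have e : (fun (_ : Unit) v => w v * (scale i v * (L.map fun i => scale i v).prod)) =
          fun _ v => w v * (L.map fun i => scale i v).prod * scale i v := by
        funext _ v; ring
      rw [e] at this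
      exact this
  simpa using key []

/-- With $t=\langle\xi\rangle^{1/2}$ one has $|x-y||\xi|\le(|x-y|t)\,t$, where
$|x-y|t\le1+\langle\xi\rangle|x-y|^2$ and $t\le1+|\xi|^{1/2}$. So changing $\rho_{x,y}$ into
$\rho_x$ costs one off-diagonal factor. -/
theorem IsCompatible.exists_comparable {r : RN d → RN d → RN d → ℝ} (hr : IsCompatible X r) :
    ∃ K : ℝ, 0 < K ∧ ∀ v : V3 d, 0 < 1 + r v.1 v.2.1 v.2.2 + ‖v.2.2‖ ^ (1 / 2 : ℝ) ∧
      1 + r v.1 v.2.1 v.2.2 + ‖v.2.2‖ ^ (1 / 2 : ℝ) ≤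
        (K * (1 + jap v.2.2 * ‖v.1 - v.2.1‖ ^ 2)) * lam X v.1 v.2.2 ∧
      lam X v.1 v.2.2 ≤ (K * (1 + jap v.2.2 * ‖v.1 - v.2.1‖ ^ 2)) *
        (1 + r v.1 v.2.1 v.2.2 + ‖v.2.2‖ ^ (1 / 2 : ℝ)) := by
  obtain ⟨h0, C, hC⟩ := hr
  refine ⟨1 + |C|, by positivity, fun v => ?_⟩
  have hq := one_le_off v
  have hs : 0 ≤ ‖v.2.2‖ ^ (1 / 2 : ℝ) := by positivity
  have hr0 := h0 v.1 v.2.1 v.2.2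
  have hd := abs_le.1 (hC v.1 v.2.1 v.2.2)
  have hρ := X.rho_nonneg v.1 v.2.2
  have hd' : C * ‖v.1 - v.2.1‖ * ‖v.2.2‖ ≤
      |C| * ((1 + jap v.2.2 * ‖v.1 - v.2.1‖ ^ 2) * (1 + ‖v.2.2‖ ^ (1 / 2 : ℝ))) := by
    have h1 := norm_le_jap v.2.2
    have h2 := sqrt_jap_sq v.2.2
    have h3 := sqrt_jap_le v.2.2
    have h4 := one_le_sqrt_jap v.2.2
    set t := jap v.2.2 ^ (1 / 2 : ℝ)
    set e := ‖v.1 - v.2.1‖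
    have he : 0 ≤ e := norm_nonneg _
    have h5 : e * t ≤ 1 + jap v.2.2 * e ^ 2 := by rw [← h2]; nlinarith [sq_nonneg (e * t - 1)]
    calc C * e * ‖v.2.2‖ ≤ |C| * e * jap v.2.2 := by
          have := le_abs_self C
          gcongr
      _ = |C| * ((e * t) * t) := by rw [← h2]; ring
      _ ≤ _ := by gcongr
  set q := 1 + jap v.2.2 * ‖v.1 - v.2.1‖ ^ 2
  set s := ‖v.2.2‖ ^ (1 / 2 : ℝ)
  have hlam : lam X v.1 v.2.2 = 1 + X.rho v.1 v.2.2 + s := rfl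
  have key : ∀ l l' : ℝ, 1 + s ≤ l' → l ≤ l' + C * ‖v.1 - v.2.1‖ * ‖v.2.2‖ →
      l ≤ ((1 + |C|) * q) * l' := fun l l' h1 h2 => by
    have h3 : |C| * (q * (1 + s)) ≤ |C| * (q * l') := by gcongr
    have h4 : l' ≤ q * l' := le_mul_of_one_le_left (by linarith) hq
    linarith
  refine ⟨by linarith, key _ _ ?_ ?_, key _ _ ?_ ?_⟩ <;> linarith

/-- Every weight built from some $\rho^{(j)}$ is replaced by $\lambda$ at the cost of the power
$|\nu_j|$ of the off-diagonal factor; hence an exponent `k'` of at least $\sum_j|\nu_j|$. -/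
theorem IsPCSTerm.ampl {c : RN d → RN d → RN d → ℂ} (hc : IsPCSTerm X m n c) :
    Ampl X m n (fun v => c v.1 v.2.1 v.2.2) := by
  obtain ⟨hs, k, ν, r, hν, hr, hb⟩ := hc
  choose K hK0 hK using fun j => (hr j).exists_comparable
  obtain ⟨k', hk'⟩ := exists_nat_ge (∑ j, |ν j|)
  refine ⟨k', cls_of_ordered hs fun α γ δ => ?_⟩
  obtain ⟨C, hC⟩ := hb α γ δ
  set s := m + ((γ.length : ℝ) + δ.length - α.length) / 2 with hsdef
  refine ⟨|C| * 2 ^ |s| * ∏ j, K j ^ |ν j|, fun v => ?_⟩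
  rw [← cmpDeriv_eq_foldr_dd (G := fun v : V3 d => c v.1 v.2.1 v.2.2) hs α γ δ v.1 v.2.1 v.2.2]
  refine (hC v.1 v.2.1 v.2.2).trans ?_
  have hq := one_le_off v
  have hJ := jap_pos v.2.2
  have hl := lam_pos X v.1 v.2.2
  have h1 : (1 + ‖v.2.2‖) ^ s ≤ 2 ^ |s| * jap v.2.2 ^ s :=
    rpow_le_rpow_of_comparable (by positivity) hJ zero_lt_two (one_add_norm_le_jap _)
      (by linarith [jap_le v.2.2, norm_nonneg v.2.2]) s
  set q := 1 + jap v.2.2 * ‖v.1 - v.2.1‖ ^ 2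
  have hq0 : 0 < q := by linarith
  have h2 : ∏ j, (1 + r j v.1 v.2.1 v.2.2 + ‖v.2.2‖ ^ (1 / 2 : ℝ)) ^ ν j ≤
      (∏ j, K j ^ |ν j|) * (q ^ k' * lam X v.1 v.2.2 ^ n) := by
    calc ∏ j, (1 + r j v.1 v.2.1 v.2.2 + ‖v.2.2‖ ^ (1 / 2 : ℝ)) ^ ν j
        ≤ ∏ j, (K j ^ |ν j| * q ^ |ν j|) * lam X v.1 v.2.2 ^ ν j := by
          refine Finset.prod_le_prod (fun j _ => Real.rpow_nonneg (hK j v).1.le _) fun j _ => ?_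
          rw [← Real.mul_rpow (hK0 j).le hq0.le]
          exact rpow_le_rpow_of_comparable (hK j v).1 hl (mul_pos (hK0 j) hq0) (hK j v).2.1
            (hK j v).2.2 _
      _ = (∏ j, K j ^ |ν j|) * (q ^ (∑ j, |ν j|) * lam X v.1 v.2.2 ^ n) := by
          rw [Finset.prod_mul_distrib, Finset.prod_mul_distrib, ← hν,
            Real.rpow_sum_of_pos hq0, Real.rpow_sum_of_pos hl, mul_assoc]
      _ ≤ _ := by
          refine mul_le_mul_of_nonneg_left (mul_le_mul_of_nonneg_right ?_
            (Real.rpow_nonneg hl.le _))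
            (Finset.prod_nonneg fun j _ => Real.rpow_nonneg (hK0 j).le _)
          rw [← Real.rpow_natCast]
          exact Real.rpow_le_rpow_of_exponent_le hq hk'
  have h3 : 0 ≤ ∏ j, (1 + r j v.1 v.2.1 v.2.2 + ‖v.2.2‖ ^ (1 / 2 : ℝ)) ^ ν j :=
    Finset.prod_nonneg fun j _ => Real.rpow_nonneg (hK j v).1.le _
  have h4 : 0 ≤ (1 + ‖v.2.2‖) ^ s := by positivity
  calc C * (1 + ‖v.2.2‖) ^ s * ∏ j, (1 + r j v.1 v.2.1 v.2.2 + ‖v.2.2‖ ^ (1 / 2 : ℝ)) ^ ν j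
      ≤ |C| * (2 ^ |s| * jap v.2.2 ^ s) *
        ((∏ j, K j ^ |ν j|) * (q ^ k' * lam X v.1 v.2.2 ^ n)) := by
        refine mul_le_mul (mul_le_mul (le_abs_self C) h1 h4 (abs_nonneg C)) h2 h3 ?_
        exact mul_nonneg (abs_nonneg C) (h4.trans h1)
    _ = _ := by
        rw [hsdef, Real.rpow_add hJ, ampW]
        ring

theorem IsPCS.ampl {c : RN d → RN d → RN d → ℂ} (hc : IsPCS X m n c) :
    Ampl X m n (fun v => c v.1 v.2.1 v.2.2) := by
  obtain ⟨s, t, ht, hc⟩ := hc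
  simp only [hc]
  exact Ampl.sum _ fun i _ => (ht i).ampl

theorem Ampl.xy_pow_mul (h : Ampl X m n G) (j : Fin (d + 1)) (p : ℕ) :
    Ampl X (m - p / 2) n (fun v => (((v.1 j - v.2.1 j) ^ p : ℝ) : ℂ) * G v) := by
  induction p with
  | zero => simpa using h
  | succ p ih =>
    have := ih.xy_mul j
    convert this using 1
    · push_cast; ring
    · funext v; push_cast; ring

/-- The half orders gained from $(x-y)^\sigma$ compensate exactly the shift $|\sigma|/2$ allowed in
the definition of $CS^{m,n}$. -/
theorem Ampl.xy_prod_mul (h : Ampl X m n G) (S : Finset (Fin (d + 1))) (σ : Fin (d + 1) → ℕ) :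
    Ampl X (m - (∑ i ∈ S, (σ i : ℝ)) / 2) n
      (fun v => ((∏ i ∈ S, (v.1 i - v.2.1 i) ^ σ i : ℝ) : ℂ) * G v) := by
  classical
  induction S using Finset.induction_on with
  | empty => simpa using h
  | insert a S ha ih =>
    have := ih.xy_pow_mul a (σ a)
    convert this using 1
    · rw [Finset.sum_insert ha]; ring
    · funext v; rw [Finset.prod_insert ha]; push_cast; ring

/-! ### Coordinate operators on compound symbols as Lie derivatives -/

theorem cmpDxi_eq_lie (hG : ContDiff ℝ ∞ G) :
    cmpDxi X (fun x y ξ => G (x, y, ξ)) = fun x y ξ => lie (vertField X) G (x, y, ξ) := by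
  funext x y ξ
  rw [lie, vertField, fderiv_vertical]
  simp only [cmpDxi, AdaptedFrame.vert, pd_slice_xi hG]

theorem shear_eq_sum (i : Fin (d + 1)) (x : RN d) (g : RN d → ℂ) (ξ : RN d) :
    X.shear i x g ξ = ∑ k, ((∑ l, shearCoef X i k l x * ξ l : ℝ) : ℂ) * pd k g ξ := by
  refine Finset.sum_congr rfl fun k _ => ?_
  rw [Finset.sum_comm]
  simp only [← Finset.sum_mul, shearCoef, ← Complex.ofReal_sum]

theorem horField_eq (i : Fin (d + 1)) (v : V3 d) :
    horField X i v = dir (.inr (.inl i)) + dir (.inl i) +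
      (0, 0, WithLp.toLp 2 fun k => ∑ l, shearCoef X i k l v.1 * v.2.2 l) := by
  refine Prod.ext ?_ (Prod.ext ?_ ?_) <;> simp [horField, dir]

theorem cmpD_eq_lie (hG : ContDiff ℝ ∞ G) (i : Fin (d + 1)) :
    cmpD X i (fun x y ξ => G (x, y, ξ)) = fun x y ξ => lie (horField X i) G (x, y, ξ) := by
  funext x y ξ
  rw [lie, horField_eq, map_add, map_add, fderiv_vertical]
  simp only [cmpD, shear_eq_sum, pd_slice_xi hG, pd_slice_y hG, pd_slice_x hG]
  rfl

theorem cmp_word_eq (hG : ContDiff ℝ ∞ G) (α : List (Fin (d + 1))) (β : ℕ)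
    (I : List (Fin (d + 1))) (v : V3 d) :
    cmpDerivXi α ((cmpDxi X)^[β] (I.foldr (cmpD X) fun x y ξ => G (x, y, ξ))) v.1 v.2.1 v.2.2 =
      α.foldr dXi ((lie (vertField X))^[β] (I.foldr (fun i => lie (horField X i)) G)) v := by
  have h1 : I.foldr (cmpD X) (fun x y ξ => G (x, y, ξ)) =
      fun x y ξ => I.foldr (fun i => lie (horField X i)) G (x, y, ξ) := by
    induction I with
    | nil => rfl
    | cons i I ih => rw [List.foldr_cons, ih, cmpD_eq_lie (contDiff_foldr_lie I hG)]; rfl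
  have hI := contDiff_foldr_lie (X := X) I hG
  have h2 : (cmpDxi X)^[β] (fun x y ξ => I.foldr (fun i => lie (horField X i)) G (x, y, ξ)) =
      fun x y ξ => (lie (vertField X))^[β] (I.foldr (fun i => lie (horField X i)) G) (x, y, ξ) := by
    induction β with
    | zero => rfl
    | succ β ih =>
      rw [Function.iterate_succ_apply', ih, cmpDxi_eq_lie (contDiff_iterate_lie β hI),
        Function.iterate_succ_apply']
  rw [h1, h2, cmpDerivXi, ipd_slice_xi (contDiff_iterate_lie β hI), List.foldr_map]

/-- Compound symbols are stable amplitudes. -/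
theorem IsCompoundSymbol.stable {c : RN d → RN d → RN d → ℂ} (hc : IsCompoundSymbol X m n c)
    (k : ℕ) : Stable X k m n (fun v => c v.1 v.2.1 v.2.2) := by
  obtain ⟨hs, hc⟩ := hc
  have h := stable_of_words (X := X) (m := m) (n := n) (G := fun v : V3 d => c v.1 v.2.1 v.2.2) hs
    (fun α β I => ?_) k [] 0 []
  · simpa using h
  obtain ⟨S, e, he, hS⟩ := hc α β I
  have h1 : (fun v : V3 d => ∑ σ ∈ S, ((∏ i, (v.1 i - v.2.1 i) ^ σ i : ℝ) : ℂ) *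
      e σ v.1 v.2.1 v.2.2) = α.foldr dXi ((lie (vertField X))^[β]
        (I.foldr (fun i => lie (horField X i)) (fun v : V3 d => c v.1 v.2.1 v.2.2))) := by
    funext v
    rw [← hS v.1 v.2.1 v.2.2]
    exact cmp_word_eq (G := fun v : V3 d => c v.1 v.2.1 v.2.2) hs α β I v
  rw [← h1]
  refine Ampl.sum _ fun σ hσ => ?_
  simpa using (he σ hσ).ampl.xy_prod_mul Finset.univ σ

end Preliminary

/-! ### The symbol of an amplitude -/

section SymbolIdentities

variable {d : ℕ} {𝒟 : RN d → Submodule ℝ (RN d)} {X : AdaptedFrame 𝒟} {m n : ℝ}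
  {G : V3 d → ℂ}

theorem Ampl.dXi (h : Ampl X m n G) (j : Fin (d + 1)) : Ampl X (m - 1 / 2) n (dXi j G) :=
  h.fderiv_xi j

theorem Ampl.dY (h : Ampl X m n G) (j : Fin (d + 1)) : Ampl X (m + 1 / 2) n (dY j G) :=
  h.fderiv_y j

theorem symDxi_ampSymbol (hG : Ampl X m n G) :
    symDxi X (ampSymbol G) = ampSymbol (lie (vertField X) G) := by
  funext x ξ
  have e : lie (vertField X) G =
      fun v => ∑ j, (X.B v.1 j (Fin.last d) : ℂ) * dXi j G v := by
    funext v
    rw [lie, vertField, fderiv_vertical]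
  have hb := fun j => (hG.dXi j).fn_mul (BddSmooth.B X j (Fin.last d))
  rw [e, ampSymbol_sum _ fun j _ => hb j]
  simp only [symDxi, AdaptedFrame.vert]
  refine Finset.sum_congr rfl fun j _ => ?_
  rw [pd_ampSymbol_snd hG]
  exact (ampSymbol_fn_mul (hG.dXi j) (fun x => (X.B x j (Fin.last d) : ℂ)) x ξ).symm

/-- The $x$-derivative of the symbol comes from $\partial_x+\partial_y$ on the amplitude. In the
shear term $\xi_l$ becomes $\eta_l$, which completes $D_i$, minus $(2\pi i)^{-1}\partial_{y_l}$,
which gives the correction in `corrD`. -/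
theorem symD_ampSymbol (hG : Ampl X m n G) (i : Fin (d + 1)) :
    symD X i (ampSymbol G) = ampSymbol (corrD X i G) := by
  funext x ξ
  have hη : ∀ k l, Ampl X (m + 1 / 2) n
      (fun v => (v.2.2 l : ℂ) * dXi k G v) := fun k l =>
    ((hG.dXi k).xi_mul l).of_le (by linarith)
  have hy : ∀ k l, Ampl X (m + 1 / 2) n (dY l (dXi k G)) := fun k l =>
    ((hG.dXi k).dY l).of_le (by linarith)
  have hbη := fun k l => (hη k l).fn_mul (bddSmooth_shearCoef X i k l)
  have hby := fun k l => (hy k l).fn_mul (bddSmooth_shearCoef X i k l)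
  have e : corrD X i G = fun v => (fderiv ℝ G v
        (EuclideanSpace.single i 1, EuclideanSpace.single i 1, 0) +
      ∑ k, ∑ l, (shearCoef X i k l v.1 : ℂ) * ((v.2.2 l : ℂ) * dXi k G v)) +
      -(2 * Real.pi * Complex.I)⁻¹ * ∑ k, ∑ l, (shearCoef X i k l v.1 : ℂ) *
        dY l (dXi k G) v := by
    funext v
    rw [corrD, lie, horField_eq, map_add, fderiv_vertical]
    congr 2
    · congr 1
      refine Prod.ext ?_ (Prod.ext ?_ ?_) <;> simp [dir]
    · refine Finset.sum_congr rfl fun k _ => ?_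
      push_cast
      rw [Finset.sum_mul]
      exact Finset.sum_congr rfl fun l _ => by ring
  have hs1 := Ampl.sum Finset.univ fun k _ => Ampl.sum Finset.univ fun l _ => hbη k l
  have hs2 := Ampl.sum Finset.univ fun k _ => Ampl.sum Finset.univ fun l _ => hby k l
  rw [e, ampSymbol_add ((hG.fderiv_apply _).add hs1) (hs2.const_mul _),
    ampSymbol_add (hG.fderiv_apply _) hs1, ampSymbol_const_mul hs2,
    ampSymbol_sum _ fun k _ => Ampl.sum Finset.univ fun l _ => hbη k l,
    ampSymbol_sum _ fun k _ => Ampl.sum Finset.univ fun l _ => hby k l]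
  rw [symD, shear_eq_sum, pd_ampSymbol_fst hG, add_assoc, Finset.mul_sum,
    ← Finset.sum_add_distrib]
  congr 1
  refine Finset.sum_congr rfl fun k _ => ?_
  rw [ampSymbol_sum _ fun l _ => hbη k l, ampSymbol_sum _ fun l _ => hby k l, Finset.mul_sum,
    ← Finset.sum_add_distrib, pd_ampSymbol_snd hG]
  push_cast
  rw [Finset.sum_mul]
  refine Finset.sum_congr rfl fun l _ => ?_
  have h1 := xi_mul_ampSymbol (hG.dXi k) l x ξ
  have h2 := ampSymbol_fn_mul (hη k l) (fun x => (shearCoef X i k l x : ℂ)) x ξ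
  have h3 := ampSymbol_fn_mul (hy k l) (fun x => (shearCoef X i k l x : ℂ)) x ξ
  rw [h2, h3, mul_assoc]
  change _ * (_ * ampSymbol (dXi k G) x ξ) = _
  rw [h1]
  change _ * (_ - _ * ampSymbol (dY l (dXi k G)) x ξ) = _
  ring

theorem sym_word_eq (h : ∀ k, Stable X k m n G) (α : List (Fin (d + 1))) (β : ℕ)
    (I : List (Fin (d + 1))) :
    symDerivXi α ((symDxi X)^[β] (I.foldr (symD X) (ampSymbol G))) =
      ampSymbol (α.foldr dXi ((lie (vertField X))^[β] (I.foldr (corrD X) G))) := by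
  have h1 : I.foldr (symD X) (ampSymbol G) = ampSymbol (I.foldr (corrD X) G) := by
    induction I with
    | nil => rfl
    | cons i I ih =>
      rw [List.foldr_cons, ih, List.foldr_cons]
      exact symD_ampSymbol (ampl_of_stable h [] 0 I) i
  have h2 : (symDxi X)^[β] (ampSymbol (I.foldr (corrD X) G)) =
      ampSymbol ((lie (vertField X))^[β] (I.foldr (corrD X) G)) := by
    induction β with
    | zero => rfl
    | succ β ih =>
      rw [Function.iterate_succ_apply', ih, Function.iterate_succ_apply']
      exact symDxi_ampSymbol (ampl_of_stable h [] β I)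
  rw [h1, h2]
  induction α with
  | nil => rfl
  | cons j α ih =>
    funext x ξ
    have h3 : ipd α (ampSymbol ((lie (vertField X))^[β] (I.foldr (corrD X) G)) x) =
        ampSymbol (α.foldr dXi ((lie (vertField X))^[β] (I.foldr (corrD X) G))) x :=
      congrFun ih x
    change pd j (ipd α _) ξ = _
    rw [h3, pd_ampSymbol_snd (ampl_of_stable h α β I)]
    rfl

theorem symW_le (X : AdaptedFrame 𝒟) (m n : ℝ) (x ξ : RN d) :
    symW X m n x ξ ≤ 2 ^ |m| * ((1 + ‖ξ‖) ^ m *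
      (1 + X.rho x ξ + ‖ξ‖ ^ (1 / 2 : ℝ)) ^ n) := by
  have h1 : jap ξ ^ m ≤ 2 ^ |m| * (1 + ‖ξ‖) ^ m :=
    rpow_le_rpow_of_comparable (jap_pos ξ) (by positivity) zero_lt_two
      (by linarith [jap_le ξ, norm_nonneg ξ]) (one_add_norm_le_jap ξ) m
  rw [← mul_assoc]
  exact mul_le_mul_of_nonneg_right h1 (Real.rpow_nonneg (lam_pos X x ξ).le n)

theorem isSymbol_ampSymbol (h : ∀ k, Stable X k m n G) : IsSymbol X m n (ampSymbol G) := by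
  refine ⟨contDiff_ampSymbol (h 0).ampl, fun α β I => ?_⟩
  obtain ⟨C, hC0, hC⟩ := ampSymbol_bound (ampl_of_stable h α β I)
  refine ⟨C * 2 ^ |m - β|, fun x ξ => ?_⟩
  rw [sym_word_eq h]
  refine (hC x ξ).trans ?_
  rw [mul_assoc, mul_assoc]
  exact mul_le_mul_of_nonneg_left (symW_le X _ _ x ξ) hC0

end SymbolIdentities

/-! ### The operator of a compound symbol -/

section Operator

open MeasureTheory

variable {d : ℕ} {𝒟 : RN d → Submodule ℝ (RN d)} {X : AdaptedFrame 𝒟} {m n : ℝ}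
  {G : V3 d → ℂ}

/-- The character `e^{2πi x·ξ}`. -/
def chr (x ξ : RN d) : ℂ := Complex.exp (2 * Real.pi * Complex.I * (⟪x, ξ⟫_ℝ : ℝ))

theorem norm_chr (x ξ : RN d) : ‖chr x ξ‖ = 1 := by
  rw [chr, Complex.norm_exp]
  simp

theorem continuous_chr : Continuous (fun p : RN d × RN d => chr p.1 p.2) :=
  Complex.continuous_exp.comp (continuous_const.mul (Complex.continuous_ofReal.comp
    (continuous_fst.inner continuous_snd)))

/-- $(x-y)\cdot(\eta-\xi)+x\cdot\xi=(x-y)\cdot\eta+y\cdot\xi$: the remaining $\xi$-dependence is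
that of Fourier inversion at $y$. -/
theorem oscPhase_mul_chr (x ξ : RN d) (t : RN d × RN d) :
    oscPhase x ξ t * chr x ξ = chr (x - t.1) t.2 * chr t.1 ξ := by
  rw [oscPhase, chr, chr, chr, ← Complex.exp_add, ← Complex.exp_add, ← mul_add, ← mul_add,
    ← Complex.ofReal_add, ← Complex.ofReal_add, inner_sub_right, inner_sub_left _ _ ξ]
  congr 3
  ring

theorem integral_fourier_mul_chr (f : 𝓢(RN d, ℂ)) (y : RN d) :
    ∫ ξ, 𝓕 (f : RN d → ℂ) ξ * chr y ξ = f y := by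
  have h := congrFun (f.continuous.fourierInv_fourier_eq f.integrable (𝓕 f).integrable) y
  rw [← h, Real.fourierInv_eq']
  refine integral_congr_ae (.of_forall fun ξ => ?_)
  simp only [chr, smul_eq_mul]
  rw [mul_comm, real_inner_comm]
  congr 2
  push_cast
  ring

theorem integrable_osc_prod {u : V3 d → ℂ} (hu : Adm u) (f : 𝓢(RN d, ℂ)) (x : RN d) :
    Integrable (fun p : RN d × (RN d × RN d) =>
      u (x, p.2) * oscPhase x p.1 p.2 * (𝓕 (f : RN d → ℂ) p.1 * chr x p.1))
      (volume.prod volume) := by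
  have hux : Continuous (fun t : RN d × RN d => u (x, t)) :=
    hu.smooth.continuous.comp (by fun_prop)
  have h1 : Integrable (fun t : RN d × RN d => u (x, t)) :=
    hux.integrable_of_hasCompactSupport (hu.cpt.slice x)
  have h2 : Integrable (fun ξ : RN d => 𝓕 (f : RN d → ℂ) ξ) := (𝓕 f).integrable
  have h3 := h2.mul_prod h1
  have h4 : Continuous (fun p : RN d × (RN d × RN d) => oscPhase x p.1 p.2) := by
    unfold oscPhase
    exact Complex.continuous_exp.comp (continuous_const.mul (Complex.continuous_ofReal.comp
      (Continuous.inner (by fun_prop) (by fun_prop))))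
  have h5 : Continuous (fun p : RN d × (RN d × RN d) => chr x p.1) :=
    continuous_chr.comp (by fun_prop : Continuous fun p : RN d × (RN d × RN d) => (x, p.1))
  have h6 : Continuous (fun p : RN d × (RN d × RN d) => 𝓕 (f : RN d → ℂ) p.1) :=
    (𝓕 f).continuous.comp continuous_fst
  refine h3.mono (((hux.comp continuous_snd).mul h4).mul (h6.mul h5)).aestronglyMeasurable
    (.of_forall fun p => le_of_eq ?_)
  simp only [norm_mul, norm_oscPhase, norm_chr, mul_one]
  exact mul_comm _ _

theorem osc_mul_eq (u : V3 d → ℂ) (f : RN d → ℂ) (x ξ : RN d) :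
    osc u x ξ * f ξ * chr x ξ =
      ∫ t : RN d × RN d, u (x, t) * oscPhase x ξ t * (f ξ * chr x ξ) := by
  rw [mul_assoc, osc, ← integral_mul_const]

theorem integrable_osc_mul {u : V3 d → ℂ} (hu : Adm u) (f : 𝓢(RN d, ℂ)) (x : RN d) :
    Integrable (fun ξ => osc u x ξ * 𝓕 (f : RN d → ℂ) ξ * chr x ξ) := by
  simp only [osc_mul_eq]
  exact (integrable_osc_prod hu f x).integral_prod_left

/-- Fubini, justified by the compact support of `u` and the integrability of $\widehat f$, followed
by Fourier inversion in $\xi$. -/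
theorem integral_osc_mul {u : V3 d → ℂ} (hu : Adm u) (f : 𝓢(RN d, ℂ)) (x : RN d) :
    ∫ ξ, osc u x ξ * 𝓕 (f : RN d → ℂ) ξ * chr x ξ =
      ∫ y, ∫ η, u (x, y, η) * f y * chr (x - y) η := by
  have h1 : ∀ t : RN d × RN d,
      ∫ ξ, u (x, t) * oscPhase x ξ t * (𝓕 (f : RN d → ℂ) ξ * chr x ξ) =
        u (x, t) * f t.1 * chr (x - t.1) t.2 := fun t => by
    rw [← integral_fourier_mul_chr f t.1, mul_assoc, mul_comm (∫ _, _), ← mul_assoc,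
      ← integral_const_mul]
    refine integral_congr_ae (.of_forall fun ξ => ?_)
    linear_combination (u (x, t) * 𝓕 (f : RN d → ℂ) ξ) * oscPhase_mul_chr x ξ t
  simp only [osc_mul_eq]
  rw [integral_integral_swap (integrable_osc_prod hu f x)]
  simp only [h1]
  have hux : Continuous (fun t : RN d × RN d => u (x, t)) :=
    hu.smooth.continuous.comp (by fun_prop)
  have h2 : Integrable (fun t : RN d × RN d => u (x, t) * f t.1 * chr (x - t.1) t.2)
      (volume.prod volume) := by
    refine Continuous.integrable_of_hasCompactSupport (Continuous.mul (hux.mul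
      (f.continuous.comp continuous_fst)) (continuous_chr.comp
        (by fun_prop : Continuous fun t : RN d × RN d => (x - t.1, t.2)))) ?_
    exact ((hu.cpt.slice x).mul_right).mul_right
  rw [Measure.volume_eq_prod, integral_prod _ h2]

theorem exists_one_add_norm_pow_le (M : ℕ) :
    ∃ C : ℝ, ∀ ξ : RN d, jap ξ ^ M ≤ C * (1 + ‖ξ‖ ^ M) :=
  -- For `M = 0` the truncated exponent is 0 and the bound reads $1\le2$.
  ⟨2 ^ (M - 1), fun ξ => (pow_le_pow_left₀ (jap_pos ξ).le (jap_le ξ) M).trans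
    (by simpa using add_pow_le zero_le_one (norm_nonneg ξ) M)⟩

theorem continuous_jap : Continuous (jap (d := d)) := by
  unfold jap
  exact Continuous.rpow_const (by fun_prop) fun ξ => .inl (by positivity)

theorem integrable_jap_pow_mul (f : 𝓢(RN d, ℂ)) (M : ℕ) :
    Integrable (fun ξ : RN d => jap ξ ^ M * ‖f ξ‖) := by
  obtain ⟨C, hC⟩ := exists_one_add_norm_pow_le (d := d) M
  have h1 := (f.integrable (μ := volume)).norm.add (f.integrable_pow_mul volume M)
  refine (h1.const_mul C).mono' ((continuous_jap.pow M).mul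
    f.continuous.norm).aestronglyMeasurable (.of_forall fun ξ => ?_)
  have h0 : 0 ≤ jap ξ ^ M := pow_nonneg (jap_pos ξ).le M
  rw [Real.norm_of_nonneg (mul_nonneg h0 (norm_nonneg _))]
  refine (mul_le_mul_of_nonneg_right (hC ξ) (norm_nonneg (f ξ))).trans_eq ?_
  simp only [Pi.add_apply]
  ring

theorem continuous_ampSymbol (hG : Ampl X m n G) (x : RN d) : Continuous (ampSymbol G x) := by
  have h : Continuous (fun p : RN d × RN d => ampSymbol G p.1 p.2) :=
    (contDiff_ampSymbol hG).continuous
  have h' := h.comp (Continuous.prodMk_right x)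
  simpa only [Function.comp_def] using h'

theorem norm_ampSymbol_le_pow (hG : Ampl X m n G) :
    ∃ C M, ∀ x ξ : RN d, ‖ampSymbol G x ξ‖ ≤ C * jap ξ ^ (M : ℕ) := by
  obtain ⟨C, hC0, hC⟩ := ampSymbol_bound hG
  obtain ⟨C', M, -, hC'⟩ := exists_symW_le X m n
  refine ⟨C * C', M, fun x ξ => (hC x ξ).trans ?_⟩
  rw [mul_assoc]
  exact mul_le_mul_of_nonneg_left (hC' x ξ) hC0

theorem integrable_mul_fourier_mul_chr {a : RN d → ℂ} (ha : Continuous a) {C : ℝ} {M : ℕ}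
    (h : ∀ ξ, ‖a ξ‖ ≤ C * jap ξ ^ M) (f : 𝓢(RN d, ℂ)) (x : RN d) :
    Integrable (fun ξ => a ξ * 𝓕 (f : RN d → ℂ) ξ * chr x ξ) := by
  have h5 : Continuous (chr x) := continuous_chr.comp (Continuous.prodMk_right x)
  have h6 : Continuous (𝓕 (f : RN d → ℂ)) := (𝓕 f).continuous
  have h7 : Integrable (fun ξ : RN d => C * (jap ξ ^ M * ‖𝓕 (f : RN d → ℂ) ξ‖)) :=
    (integrable_jap_pow_mul (𝓕 f) M).const_mul _
  refine h7.mono' ((ha.mul h6).mul h5).aestronglyMeasurable (.of_forall fun ξ => ?_)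
  rw [norm_mul, norm_mul, norm_chr, mul_one, ← mul_assoc]
  exact mul_le_mul_of_nonneg_right (h ξ) (norm_nonneg _)

theorem integrable_ampSymbol_mul (hG : Ampl X m n G) (f : 𝓢(RN d, ℂ)) (x : RN d) :
    Integrable (fun ξ => ampSymbol G x ξ * 𝓕 (f : RN d → ℂ) ξ * chr x ξ) := by
  obtain ⟨C, M, h⟩ := norm_ampSymbol_le_pow hG
  exact integrable_mul_fourier_mul_chr (continuous_ampSymbol hG x) (h x) f x

/-- For each $\varepsilon$ the truncated integral is the operator of the regularized symbol. The
error is $\varepsilon$ times a polynomial in $\langle\xi\rangle$, integrable against the Schwartz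
function $\widehat f$, and the rate holds for every admissible `χ`. -/
theorem hasCompoundValue_ampSymbol (hG : Ampl X m n G) (f : 𝓢(RN d, ℂ)) (x : RN d) :
    HasCompoundValue (fun x y ξ => G (x, y, ξ)) f x (symbolOp (ampSymbol G) f x) := by
  intro χ hχ hc h1
  obtain ⟨C, M, hC0, hC⟩ := ampSymbol_rate_poly hG hχ hc h1
  have hint := integrable_jap_pow_mul (𝓕 f) M
  refine tendsto_of_rate (C := C * (1 + ‖x‖) * ∫ ξ, jap ξ ^ M * ‖𝓕 f ξ‖) fun ε => ?_
  have hu := adm_cut hχ hc ε.2.1.ne' hG.smooth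
  have e : compoundIntegral (truncate χ ε fun x y ξ => G (x, y, ξ)) f x =
      ∫ ξ, osc (fun v => cut χ ε v * G v) x ξ * 𝓕 (f : RN d → ℂ) ξ * chr x ξ :=
    (integral_osc_mul hu f x).symm
  have e' : symbolOp (ampSymbol G) f x =
      ∫ ξ, ampSymbol G x ξ * 𝓕 (f : RN d → ℂ) ξ * chr x ξ := rfl
  rw [e, e', ← integral_sub (integrable_osc_mul hu f x) (integrable_ampSymbol_mul hG f x),
    mul_right_comm, ← integral_const_mul]
  refine norm_integral_le_of_norm_le (hint.const_mul _) (.of_forall fun ξ => ?_)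
  rw [← sub_mul, ← sub_mul, norm_mul, norm_mul, norm_chr, mul_one]
  refine (mul_le_mul_of_nonneg_right (hC ε x ξ) (norm_nonneg _)).trans_eq ?_
  rw [SchwartzMap.fourier_coe]
  ring

end Operator

end MixedSymbols

end

theorem mainTheorem3 {d : ℕ} {𝒟 : MixedSymbols.RN d → Submodule ℝ (MixedSymbols.RN d)}
    (X : MixedSymbols.AdaptedFrame 𝒟) (m n : ℝ)
    (c : MixedSymbols.RN d → MixedSymbols.RN d → MixedSymbols.RN d → ℂ)
    (hc : MixedSymbols.IsCompoundSymbol X m n c) :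
    ∃ a : MixedSymbols.RN d → MixedSymbols.RN d → ℂ,
      MixedSymbols.IsSymbol X m n a ∧
      ∀ (f : 𝓢(MixedSymbols.RN d, ℂ)) (x : MixedSymbols.RN d),
        MixedSymbols.HasCompoundValue c f x (MixedSymbols.symbolOp a f x) :=
  ⟨_, MixedSymbols.isSymbol_ampSymbol hc.stable,
    fun f x => MixedSymbols.hasCompoundValue_ampSymbol (hc.stable 0).ampl f x⟩
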